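/- **Setting.** *Elements.* An element is a closed nondegenerate triangle or simple quadrilateral (convex or not). Its aspect ratio is the length of its longest side divided by the smallest distance from one of its vertices to a side not incident to that vertex (for triangles: longest side over shortest altitude). A *mesh covering* a set $\Omega\subset\mathbb R^2$ is a finite family of elements whose union contains $\Omega$ and in which any two distinct elements meet only in common vertices and along common sides. A *local size function* on $\Omega$ is a function $\sigma:\Omega\to(0,\infty)$; an element *obeys* $\sigma$ if all its sides have length at most $\sigma(p)$ for every $p\in\Omega$ that it contains, and a mesh obeys $\sigma$ if all its elements do. The local feature size is $\hat\sigma(p)=\inf_{q\in\Omega}\bigl(|p-q|+\sigma(q)\bigr)$. *Diamond-kite meshes.* Let $T$ be a rhombille tiling of the plane with side length $s_0$ (rhombi with angles $60^\circ$ and $120^\circ$, six meeting at their acute corners or three at their obtuse corners at each vertex). If exactly six edges of length $s$ meet at a vertex $p$ of a quadrilateral mesh obtained from $T$, their other ends are the vertices of a regular hexagon with center $p$; the *replacement step* $(p,s)$ makes each of these six edges the long diagonal of a new $60^\circ$–$120^\circ$ rhombus of side $s/\sqrt3$, and in each of the six quadrilaterals at $p$ it replaces the corner $p$ by the centroid of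 $p$ and its two neighbors in that quadrilateral. The *diamond-kite meshes formed from $T$* are the meshes obtained from $T$ by finitely many replacement steps; $M'$ is a refinement of $M$ if it is obtained from $M$ by finitely many such steps. The *coarsest* diamond-kite mesh for $\sigma$ is a diamond-kite mesh formed from $T$ that obeys $\sigma$ and of which every diamond-kite mesh formed from $T$ and obeying $\sigma$ is a refinement. *Domains.* For $\kappa\ge 0$, a bounded set $\Omega\subset\mathbb R^2$ is a *$\kappa$-domain* if it lies in the closure of its interior and any two points $p,q$ of the interior are joined by a path in the interior of length at most $\kappa|p-q|$. (Bounded convex sets with interior points are $1$-domains.) **Theorem.** For all $A$, $\kappa$ and $\lambda$ there is a constant $C=C(A,\kappa,\lambda)$ such that the following holds. Let $\Omega$ be a $\kappa$-domain, let $\sigma$ be a local size function on $\Omega$ that is bounded below by a positive constant, and let $T$ be a rhombille tiling whose side length $s_0$ is coarse in the sense that $\min(\hat\sigma(p),\operatorname{diam}\Omega)\le\lambda s_0$ for all $p\in\Omega$. Then a coarsest diamond-kite mesh formed from $T$ and obeying $\sigma$ exists, only finitely many of its elements meet $\Omega$, and the number of these is at most $C$ times the number of elements of any mesh that covers $\Omega$,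 obeys $\sigma$, and has all aspect ratios at most $A$. -/

import Mathlib

open scoped NNReal

noncomputable section

namespace DiamondKite

/-! The plane is `ℂ` with its Euclidean metric. -/

/-! ### Triangular and quadrilateral elements -/

/-- A mesh element, given by its vertices in cyclic order. Every simple quadrilateral (convex or not)
has a diagonal that runs inside it; its vertices are numbered so that this diagonal joins
vertex `0` to vertex `2`. -/
inductive Element : Type
  | tri (v : Fin 3 → ℂ) : Element
  | quad (v : Fin 4 → ℂ) : Element

namespace Element

/-- The set of vertices. -/
def vertices : Element → Set ℂ
  | tri v => Set.range v
  | quad v => Set.range v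

/-- `x` and `y` are the two ends of a side. -/
def IsSide : Element → ℂ → ℂ → Prop
  | tri v, x, y => ∃ i, (v i = x ∧ v (i + 1) = y) ∨ (v i = y ∧ v (i + 1) = x)
  | quad v, x, y => ∃ i, (v i = x ∧ v (i + 1) = y) ∨ (v i = y ∧ v (i + 1) = x)

/-- The closed region occupied by the element. -/
def region : Element → Set ℂ
  | tri v => convexHull ℝ {v 0, v 1, v 2}
  | quad v => convexHull ℝ {v 0, v 1, v 2} ∪ convexHull ℝ {v 0, v 2, v 3}

/-- The element is a nondegenerate triangle, or a simple quadrilateral that is cut by its diagonal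
from vertex `0` to vertex `2` into two nondegenerate triangles. -/
def IsProper : Element → Prop
  | tri v => AffineIndependent ℝ ![v 0, v 1, v 2]
  | quad v => AffineIndependent ℝ ![v 0, v 1, v 2] ∧ AffineIndependent ℝ ![v 0, v 2, v 3] ∧
      convexHull ℝ {v 0, v 1, v 2} ∩ convexHull ℝ {v 0, v 2, v 3} = segment ℝ (v 0) (v 2)

/-- The aspect ratio is at most `A`: no side is longer than `A` times the distance of any vertex
from any side not incident to it. For a triangle this is the usual bound on
(longest side) / (shortest altitude). -/
def AspectRatioLE (E : Element) (A : ℝ) : Prop :=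
  ∀ x y, E.IsSide x y → ∀ z w, E.IsSide z w → ∀ v ∈ E.vertices, v ≠ z → v ≠ w →
    dist x y ≤ A * Metric.infDist v (segment ℝ z w)

/-- At each point `p` of `Ω` that the element contains, its sides have length at most `σ p`
(the element is not oversized). -/
def Obeys (E : Element) (Ω : Set ℂ) (σ : ℂ → ℝ) : Prop :=
  ∀ p ∈ E.region ∩ Ω, ∀ x y, E.IsSide x y → dist x y ≤ σ p

end Element

/-- The elements `E 0, …, E (n - 1)` form a mesh that covers `Ω`, has aspect ratio at most `A`, and
obeys the size function `σ`. Distinct elements meet only in common vertices and along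
common sides. -/
structure IsMesh {n : ℕ} (E : Fin n → Element) (A : ℝ) (Ω : Set ℂ) (σ : ℂ → ℝ) : Prop where
  proper : ∀ i, (E i).IsProper
  conforming : ∀ i j, i ≠ j → ∀ x ∈ (E i).region ∩ (E j).region,
    x ∈ (E i).vertices ∩ (E j).vertices ∨
      ∃ y z, (E i).IsSide y z ∧ (E j).IsSide y z ∧ x ∈ segment ℝ y z
  covers : Ω ⊆ ⋃ i, (E i).region
  aspect : ∀ i, (E i).AspectRatioLE A
  obeys : ∀ i, (E i).Obeys Ω σ

/-! ### Diamond-kite meshes -/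

/-- The sixth root of unity `exp (i π / 3)`. -/
def zeta : ℂ := ⟨1 / 2, Real.sqrt 3 / 2⟩

/-- A (possibly infinite) set of quadrilaterals, each listed once. -/
abbrev QuadMesh : Type := Set (Fin 4 → ℂ)

/-- The rhombille tiling with a degree-six vertex at `o` and an edge from `o` to `o + a`; its side
length is `‖a‖`. The degree-six vertices are `p = o + a (1 + ζ) (m + n ζ)`. Each of them is
joined to `p + a ζ ^ k`, `0 ≤ k < 6`, and for `k = 0, 1, 2` it is listed as the first acute
vertex of a rhombus. -/
def rhombille (o a : ℂ) : QuadMesh :=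
  {Q | ∃ (m n : ℤ) (k : Fin 3) (p : ℂ), p = o + a * (1 + zeta) * (m + n * zeta) ∧
    Q = ![p, p + a * zeta ^ (k : ℕ), p + a * zeta ^ (k : ℕ) * (1 + zeta),
      p + a * zeta ^ ((k : ℕ) + 1)]}

/-- `x` and `y` are joined by an edge of the mesh. -/
def IsEdge (M : QuadMesh) (x y : ℂ) : Prop :=
  ∃ Q ∈ M, (Element.quad Q).IsSide x y

/-- The replacement step with center `p` and side length `s` may be performed: exactly six edges of
length `s` meet at `p`. The other ends of these edges are the vertices of the replaced hexagon. -/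
def Ready (M : QuadMesh) (p : ℂ) (s : ℝ) : Prop :=
  {u | IsEdge M p u ∧ dist p u = s}.ncard = 6

/-- A quadrilateral with a corner at `p` loses that corner: `p` is replaced by the
centroid of the triangle that `p` forms with its two neighbors in the quadrilateral. -/
def cutCorner (p : ℂ) (Q : Fin 4 → ℂ) : Fin 4 → ℂ :=
  fun i => if Q i = p then (Q (i - 1) + Q i + Q (i + 1)) / 3 else Q i

/-- The diamond with long diagonal from `p` to `u`, with acute angles at these two points. -/
def diamond (p u : ℂ) : Fin 4 → ℂ :=
  ![p, p + (u - p) * (1 + (starRingEnd ℂ) zeta) / 3, u, p + (u - p) * (1 + zeta) / 3]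

/-- The result of the local replacement with center `p` and side length `s`: each of the six edges of
length `s` at `p` becomes the long diagonal of a new diamond, the quadrilaterals that had a
corner at `p` retreat to the boundary of the new diamonds, and the others stay as they are. -/
def replaceAt (M : QuadMesh) (p : ℂ) (s : ℝ) : QuadMesh :=
  {Q | Q ∈ M ∧ p ∉ Set.range Q} ∪ {Q' | ∃ Q ∈ M, p ∈ Set.range Q ∧ Q' = cutCorner p Q} ∪
    {Q' | ∃ u, IsEdge M p u ∧ dist p u = s ∧ Q' = diamond p u}

/-- `M'` is obtained from `M` by one local replacement step. -/
def Step (M M' : QuadMesh) : Prop :=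
  ∃ p s, Ready M p s ∧ M' = replaceAt M p s

/-- `M'` is obtained from `M` by finitely many local replacement steps. The diamond-kite meshes formed
from `T` are the meshes `M` with `Refines T M`. -/
def Refines (M M' : QuadMesh) : Prop :=
  Relation.ReflTransGen Step M M'

/-- No quadrilateral of the mesh is oversized for the size function `σ` on `Ω`. -/
def ObeysSize (M : QuadMesh) (Ω : Set ℂ) (σ : ℂ → ℝ) : Prop :=
  ∀ Q ∈ M, (Element.quad Q).Obeys Ω σ

/-- `M` is the coarsest among the diamond-kite meshes that are formed from `T` and obey `σ` on `Ω`. -/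
structure IsCoarsest (T : QuadMesh) (Ω : Set ℂ) (σ : ℂ → ℝ) (M : QuadMesh) : Prop where
  refines : Refines T M
  obeys : ObeysSize M Ω σ
  coarsest : ∀ M', Refines T M' → ObeysSize M' Ω σ → Refines M M'

/-- The elements of the mesh that meet `Ω`. -/
def elementsMeeting (M : QuadMesh) (Ω : Set ℂ) : Set (Fin 4 → ℂ) :=
  {Q | Q ∈ M ∧ ((Element.quad Q).region ∩ Ω).Nonempty}

/-! ### Domains and size functions -/

/-- A bounded domain to be meshed: it lies in the closure of its interior, and any two points of the
interior are joined, inside the interior, by a path that is at most `κ` times as long as their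
distance (stated by a Lipschitz parametrization on `[0, 1]`). Every bounded convex set with
interior points is such a domain with `κ = 1`. -/
structure IsMeshDomain (κ : ℝ≥0) (Ω : Set ℂ) : Prop where
  bounded : Bornology.IsBounded Ω
  subset_closure : Ω ⊆ closure (interior Ω)
  joined : ∀ p ∈ interior Ω, ∀ q ∈ interior Ω, ∃ γ : ℝ → ℂ, γ 0 = p ∧ γ 1 = q ∧
    LipschitzOnWith (κ * nndist p q) γ (Set.Icc 0 1) ∧ ∀ t ∈ Set.Icc (0 : ℝ) 1, γ t ∈ interior Ω

/-- The local feature size at `p` of the size function `σ` on `Ω`. -/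
def localFeatureSize (Ω : Set ℂ) (σ : ℂ → ℝ) (p : ℂ) : ℝ :=
  ⨅ q : Ω, (dist p (q : ℂ) + σ q)

/-- Tiles of side length `s` are coarse for `σ` on `Ω`, up to the factor `lam`: nowhere are they much
smaller than both the local feature size and the whole domain. -/
def IsCoarse (lam : ℝ) (Ω : Set ℂ) (σ : ℂ → ℝ) (s : ℝ) : Prop :=
  ∀ p ∈ Ω, min (localFeatureSize Ω σ p) (Metric.diam Ω) ≤ lam * s

end DiamondKite

end

open scoped NNReal

noncomputable section

namespace DiamondKite

section

/-! ### Eisenstein integers -/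

/-! A replacement is a pair `(k, x)` of a level, whose side length `sl a k` shrinks by `√3` at each
level, and a center `x` in the triangular lattice `lat o a k`. Its prerequisites are, for positive
level `k = l + 1`, all pairs `(l, q)` with `q ∈ lat o a l` within `sl a l` of `x`. A step can be
performed exactly at a new pair whose prerequisites have been performed, and its effect is to add
that pair (`ready_imp`, `Adds.ready`, `Adds.replaceAt_eq`). So diamond-kite meshes correspond to
finite down-closed sets of pairs and refinement to inclusion (`refines_of_subset`, `mesh_injective`,
`subset_of_refines`).

Obeying `σ` survives intersection of such sets (`obeysSize_inter`): an element for the intersection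
is an element for one of the two sets, or a rhombus covered by two kites, one from each. Since `σ`
is bounded below, some finite down-closed set obeys it (`exists_bigD`), and one of least cardinality
gives the coarsest mesh. That set lies inside the explicit one of `exists_bigD`, so an element of
positive level near `z ∈ Ω` has side at least a fixed fraction of the local feature size at `z`
(`exists_of_isCoarsest`). For level zero the coarseness of `T` takes over.

In a comparison mesh of aspect ratio at most `A`, sizes vary slowly. To each corner of an element is
assigned the smallest size found among the elements linked to it around that corner by shared sides.
These values are within a constant factor of the size, because boundedly many elements meet at a
vertex. Interpolated linearly on the sides they extend to a Lipschitz function on each element, and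
the functions of two elements agree on a shared side. Following them along a path in `Ω` that misses
all vertices bounds one size by another plus a multiple of the distance
(`IsMesh.size_le_of_interior`). Hence every point of `Ω` lies in an element of size at most a
constant times its local feature size (`IsMesh.exists_size_le`).

Each tile meeting `Ω` is charged to such an element. Tiles at nearby points differ by a bounded
number of levels (`IsElt.gap`) and have separated corners (`IsElt.separated`), both by descending
through prerequisites (`IsDown.descent`). An area comparison then bounds the tiles charged to one
element. -/

lemma sqrt_three_sq : Real.sqrt 3 ^ 2 = 3 := Real.sq_sqrt (by norm_num)

lemma sqrt_three_gt : (1.73 : ℝ) < Real.sqrt 3 := by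
  rw [Real.lt_sqrt (by norm_num)]; norm_num

lemma sqrt_three_lt : Real.sqrt 3 < (1.74 : ℝ) := by
  rw [Real.sqrt_lt' (by norm_num)]; norm_num

lemma zeta_sq : zeta ^ 2 = zeta - 1 := by
  have h := sqrt_three_sq
  apply Complex.ext
  · simp [zeta, pow_two]; nlinarith
  · simp [zeta, pow_two]; ring

lemma zeta_cube : zeta ^ 3 = -1 := by linear_combination (zeta + 1) * zeta_sq

lemma zeta_pow_six : zeta ^ 6 = 1 := by linear_combination (zeta ^ 3 - 1) * zeta_cube

lemma normSq_add_mul_zeta (x y : ℝ) :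
    Complex.normSq (x + y * zeta) = x ^ 2 + x * y + y ^ 2 := by
  have h := sqrt_three_sq
  simp [zeta, Complex.normSq_apply]
  nlinarith

lemma norm_add_mul_zeta_sq (x y : ℝ) : ‖(x + y * zeta : ℂ)‖ ^ 2 = x ^ 2 + x * y + y ^ 2 := by
  rw [← Complex.normSq_eq_norm_sq, normSq_add_mul_zeta]

lemma norm_zeta : ‖zeta‖ = 1 := by
  have h := norm_add_mul_zeta_sq 0 1
  simp at h
  exact h.resolve_right (by linarith [norm_nonneg zeta])

lemma zeta_ne_zero : zeta ≠ 0 := by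
  intro h; have := norm_zeta; rw [h] at this; simp at this

lemma conj_zeta : (starRingEnd ℂ) zeta = 1 - zeta := by
  apply Complex.ext <;> simp [zeta]; norm_num

/-- The ratio of consecutive scales, as a complex number. -/
def theta : ℂ := 1 + zeta

lemma theta_sq : theta ^ 2 = 3 * zeta := by
  unfold theta; linear_combination zeta_sq

lemma norm_theta : ‖theta‖ = Real.sqrt 3 := by
  have h := norm_add_mul_zeta_sq 1 1
  rw [show ((1 : ℝ) + (1 : ℝ) * zeta : ℂ) = theta by simp [theta]] at h
  rw [← Real.sqrt_sq (norm_nonneg theta), h]; norm_num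

lemma theta_ne_zero : theta ≠ 0 := by
  intro h
  have := norm_theta
  rw [h, norm_zero] at this
  linarith [sqrt_three_gt]

/-- The Eisenstein integers. -/
def eis : Subring ℂ where
  carrier := {z | ∃ m n : ℤ, z = m + n * zeta}
  mul_mem' := by
    rintro _ _ ⟨m, n, rfl⟩ ⟨m', n', rfl⟩
    refine ⟨m * m' - n * n', m * n' + n * m' + n * n', ?_⟩
    push_cast
    linear_combination (n * n' : ℂ) * zeta_sq
  one_mem' := ⟨1, 0, by simp⟩
  add_mem' := by
    rintro _ _ ⟨m, n, rfl⟩ ⟨m', n', rfl⟩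
    exact ⟨m + m', n + n', by push_cast; ring⟩
  zero_mem' := ⟨0, 0, by simp⟩
  neg_mem' := by
    rintro _ ⟨m, n, rfl⟩
    exact ⟨-m, -n, by push_cast; ring⟩

lemma zeta_mem : zeta ∈ eis := ⟨0, 1, by simp⟩

lemma theta_mem : theta ∈ eis := add_mem (one_mem _) zeta_mem

lemma norm_sq_eis (m n : ℤ) : ‖(m + n * zeta : ℂ)‖ ^ 2 = ((m ^ 2 + m * n + n ^ 2 : ℤ) : ℝ) := by
  have := norm_add_mul_zeta_sq m n
  push_cast at this ⊢
  exact this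

lemma one_le_norm_of_mem_eis {z : ℂ} (hz : z ∈ eis) (h0 : z ≠ 0) : 1 ≤ ‖z‖ := by
  obtain ⟨m, n, rfl⟩ := hz
  have h := norm_sq_eis m n
  have hpos : 0 < ‖(m + n * zeta : ℂ)‖ ^ 2 := by positivity
  rw [h] at hpos
  have h1 : (1 : ℤ) ≤ m ^ 2 + m * n + n ^ 2 := by exact_mod_cast hpos
  have h2 : (1 : ℝ) ≤ ‖(m + n * zeta : ℂ)‖ ^ 2 := by rw [h]; exact_mod_cast h1
  exact (one_le_sq_iff₀ (norm_nonneg _)).1 h2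

/-- The norm form `m² + mn + n²` takes the value `1` at exactly six integer points, the units. -/
lemma exists_zeta_pow_of_norm_le_one {z : ℂ} (hz : z ∈ eis) (h0 : z ≠ 0) (h1 : ‖z‖ ≤ 1) :
    ∃ j < 6, z = zeta ^ j := by
  have hn : ‖z‖ = 1 := le_antisymm h1 (one_le_norm_of_mem_eis hz h0)
  obtain ⟨m, n, rfl⟩ := hz
  have h := norm_sq_eis m n
  rw [hn] at h
  have h2 : m ^ 2 + m * n + n ^ 2 = 1 := by
    have : ((1 : ℤ) : ℝ) = ((m ^ 2 + m * n + n ^ 2 : ℤ) : ℝ) := by rw [← h]; norm_num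
    exact_mod_cast this.symm
  -- `4 (m² + mn + n²) = 3 m² + (m + 2n)²`.
  have hm : -1 ≤ m ∧ m ≤ 1 := by constructor <;> nlinarith [sq_nonneg (m + 2 * n)]
  have hn : -1 ≤ n ∧ n ≤ 1 := by constructor <;> nlinarith [sq_nonneg (n + 2 * m)]
  obtain ⟨hm1, hm2⟩ := hm
  obtain ⟨hn1, hn2⟩ := hn
  have z4 : zeta ^ 4 = -zeta := by linear_combination zeta * zeta_cube
  have z5 : zeta ^ 5 = 1 - zeta := by linear_combination zeta ^ 2 * zeta_cube - zeta_sq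
  interval_cases m <;> interval_cases n <;> try (exfalso; revert h2; norm_num; done)
  · exact ⟨3, by norm_num, by rw [zeta_cube]; push_cast; ring⟩
  · exact ⟨2, by norm_num, by rw [zeta_sq]; push_cast; ring⟩
  · exact ⟨4, by norm_num, by rw [z4]; push_cast; ring⟩
  · exact ⟨1, by norm_num, by simp⟩
  · exact ⟨5, by norm_num, by rw [z5]; push_cast; ring⟩
  · exact ⟨0, by norm_num, by simp⟩

/-- Every Eisenstein integer is `0` or `± 1` modulo `θ`. -/
lemma exists_theta_mul (z : ℂ) (hz : z ∈ eis) :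
    (∃ w ∈ eis, z = theta * w) ∨ (∃ w ∈ eis, z + 1 = theta * w) ∨
      (∃ w ∈ eis, z + zeta = theta * w) := by
  -- Modulo `θ = 1 + ζ` one has `ζ ≡ -1`, so `m + n ζ ≡ m - n`, and `3 = θ (2 - ζ)`.
  have key : ∀ m n : ℤ, 3 ∣ m - n → ∃ w ∈ eis, (m + n * zeta : ℂ) = theta * w := by
    rintro m n ⟨l, hl⟩
    refine ⟨n + l * (2 - zeta), ⟨n + 2 * l, -l, by push_cast; ring⟩, ?_⟩
    have : (m : ℂ) = n + 3 * l := by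
      have : m = n + 3 * l := by omega
      rw [this]; push_cast; ring
    rw [this]; unfold theta
    linear_combination (l : ℂ) * zeta_sq
  obtain ⟨m, n, rfl⟩ := hz
  have : 3 ∣ m - n ∨ 3 ∣ m + 1 - n ∨ 3 ∣ m - (n + 1) := by omega
  rcases this with h | h | h
  · exact Or.inl (key m n h)
  · obtain ⟨w, hw, h⟩ := key _ _ h
    exact Or.inr (Or.inl ⟨w, hw, by rw [← h]; push_cast; ring⟩)
  · obtain ⟨w, hw, h⟩ := key _ _ h
    exact Or.inr (Or.inr ⟨w, hw, by rw [← h]; push_cast; ring⟩)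

/-! ### The nested lattices -/

/-- The edge vector of the rhombille tiling of level `k`. -/
def av (a : ℂ) (k : ℕ) : ℂ := a / theta ^ k

/-- The degree-six vertices of the rhombille tiling of level `k`. -/
def lat (o a : ℂ) (k : ℕ) : Set ℂ := {x | ∃ z ∈ eis, x = o + av a k * theta * z}

lemma av_zero (a : ℂ) : av a 0 = a := by simp [av]

lemma av_succ (a : ℂ) (k : ℕ) : av a (k + 1) * theta = av a k := by
  have := theta_ne_zero
  unfold av; field_simp; ring

lemma av_ne_zero {a : ℂ} (ha : a ≠ 0) (k : ℕ) : av a k ≠ 0 :=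
  div_ne_zero ha (pow_ne_zero _ theta_ne_zero)

/-- The side length of the rhombille tiling of level `k`. -/
def sl (a : ℂ) (k : ℕ) : ℝ := ‖av a k‖

lemma sl_zero (a : ℂ) : sl a 0 = ‖a‖ := by rw [sl, av_zero]

lemma sl_pos {a : ℂ} (ha : a ≠ 0) (k : ℕ) : 0 < sl a k := norm_pos_iff.2 (av_ne_zero ha k)

lemma sl_nonneg (a : ℂ) (k : ℕ) : 0 ≤ sl a k := norm_nonneg _

lemma sl_succ (a : ℂ) (k : ℕ) : sl a k = Real.sqrt 3 * sl a (k + 1) := by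
  unfold sl; rw [← av_succ, norm_mul, norm_theta, mul_comm]

lemma sl_succ_succ (a : ℂ) (k : ℕ) : sl a k = 3 * sl a (k + 2) := by
  rw [sl_succ, sl_succ, ← mul_assoc, ← pow_two, sqrt_three_sq]

lemma sl_succ_lt {a : ℂ} (ha : a ≠ 0) (k : ℕ) : sl a (k + 1) < sl a k := by
  have := sl_pos ha (k + 1)
  rw [sl_succ a k]
  nlinarith [sqrt_three_gt]

lemma sl_strictAnti {a : ℂ} (ha : a ≠ 0) : StrictAnti (sl a) :=
  strictAnti_nat_of_succ_lt (sl_succ_lt ha)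

variable {o a : ℂ} {k : ℕ}

/-- Because `av a (k + 1) * theta = av a k`, the lattice of level `k + 1` is the coset `o + av a k ·
eis`, which also contains the other ends of the level `k` edges. -/
lemma lat_succ_add {x z : ℂ} (hx : x ∈ lat o a (k + 1)) (hz : z ∈ eis) :
    x + av a k * z ∈ lat o a (k + 1) := by
  obtain ⟨w, hw, rfl⟩ := hx
  exact ⟨w + z, add_mem hw hz, by rw [← av_succ a k]; ring⟩

lemma lat_subset_succ : lat o a k ⊆ lat o a (k + 1) := by
  rintro x ⟨z, hz, rfl⟩
  exact ⟨theta * z, mul_mem theta_mem hz, by rw [← av_succ a k]; ring⟩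

lemma lat_mono : Monotone (lat o a) := monotone_nat_of_le_succ fun _ => lat_subset_succ

lemma lat_add_theta {x z : ℂ} (hx : x ∈ lat o a k) (hz : z ∈ eis) :
    x + av a k * (theta * z) ∈ lat o a k := by
  obtain ⟨w, hw, rfl⟩ := hx
  exact ⟨w + z, add_mem hw hz, by ring⟩

lemma exists_eis_of_lat {x y : ℂ} (hx : x ∈ lat o a k) (hy : y ∈ lat o a k) :
    ∃ z ∈ eis, y = x + av a k * (theta * z) := by
  obtain ⟨w, hw, rfl⟩ := hx
  obtain ⟨v, hv, rfl⟩ := hy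
  exact ⟨v - w, sub_mem hv hw, by ring⟩

lemma exists_eis_of_lat_succ {x y : ℂ} (hx : x ∈ lat o a (k + 1)) (hy : y ∈ lat o a (k + 1)) :
    ∃ z ∈ eis, y = x + av a k * z := by
  obtain ⟨z, hz, h⟩ := exists_eis_of_lat hx hy
  exact ⟨z, hz, by rw [h, ← av_succ a k]; ring⟩

lemma lat_separated {x y : ℂ} (hx : x ∈ lat o a k) (hy : y ∈ lat o a k)
    (h : dist x y < Real.sqrt 3 * sl a k) : x = y := by
  obtain ⟨z, hz, rfl⟩ := exists_eis_of_lat hx hy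
  by_cases h0 : z = 0
  · simp [h0]
  have h1 := one_le_norm_of_mem_eis hz h0
  rw [dist_self_add_right, norm_mul, norm_mul, norm_theta, ← sl] at h
  have : 0 ≤ sl a k * Real.sqrt 3 := by unfold sl; positivity
  nlinarith

lemma dist_add_zeta_pow (x : ℂ) (j : ℕ) : dist x (x + av a k * zeta ^ j) = sl a k := by
  rw [dist_self_add_right, norm_mul, norm_pow, norm_zeta, one_pow, mul_one, sl]

lemma lat_separated_two {x y : ℂ} (ha : a ≠ 0) (hx : x ∈ lat o a k) (hy : y ∈ lat o a k)
    (h : dist x y ≤ sl a k) : x = y := by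
  refine lat_separated hx hy (h.trans_lt ?_)
  have := sl_pos ha k
  nlinarith [sqrt_three_gt]

lemma add_zeta_pow_mem {x : ℂ} (hx : x ∈ lat o a k) (j : ℕ) :
    x + av a k * zeta ^ j ∈ lat o a (k + 1) :=
  lat_succ_add (lat_subset_succ hx) (pow_mem zeta_mem _)

lemma add_zeta_pow_notMem (ha : a ≠ 0) {x : ℂ} (hx : x ∈ lat o a k) (j : ℕ) :
    x + av a k * zeta ^ j ∉ lat o a k := by
  intro h
  have h1 := lat_separated_two ha hx h (dist_add_zeta_pow x j).le
  have h2 := dist_add_zeta_pow (a := a) (k := k) x j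
  rw [← h1, dist_self] at h2
  exact (sl_pos ha k).ne h2

/-- Points of `lat (k+1)` at distance at most `sl k` are equal or joined by a lattice vector. -/
lemma eq_or_exists_zeta_pow (ha : a ≠ 0) {x y : ℂ} (hx : x ∈ lat o a (k + 1))
    (hy : y ∈ lat o a (k + 1)) (h : dist x y ≤ sl a k) :
    y = x ∨ ∃ j < 6, y = x + av a k * zeta ^ j := by
  obtain ⟨z, hz, rfl⟩ := exists_eis_of_lat_succ hx hy
  by_cases h0 : z = 0
  · simp [h0]
  right
  rw [dist_self_add_right, norm_mul, ← sl] at h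
  obtain ⟨j, hj, rfl⟩ := exists_zeta_pow_of_norm_le_one hz h0
    (by nlinarith [sl_pos ha k, norm_nonneg z])
  exact ⟨j, hj, rfl⟩

/-- A vertex that is new at level `k + 1` has three neighbors in `lat k`. -/
lemma exists_neighbors {x : ℂ} (hx : x ∈ lat o a (k + 1)) :
    x ∈ lat o a k ∨ ∃ i, ∀ m, x + av a k * zeta ^ (i + 2 * m) ∈ lat o a k := by
  -- Turning an edge by `120°` changes its end by a multiple of `ζ² - 1 = θ (ζ - 1)`, hence by a
  -- vector of the level `k` lattice.
  have key : ∀ w ∈ eis, x + av a k * w ∈ lat o a k →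
      ∀ m : ℕ, x + av a k * (w * zeta ^ (2 * m)) ∈ lat o a k := by
    intro w hw h m
    induction m with
    | zero => simpa using h
    | succ m ih =>
      have := lat_add_theta ih (z := w * zeta ^ (2 * m) * (zeta - 1))
        (mul_mem (mul_mem hw (pow_mem zeta_mem _)) (sub_mem zeta_mem (one_mem _)))
      convert this using 1
      unfold theta
      ring
  obtain ⟨z, hz, hxz⟩ := hx
  have hx' : x = o + av a k * z := by rw [hxz, ← av_succ a k]
  rcases exists_theta_mul z hz with ⟨w, hw, h⟩ | ⟨w, hw, h⟩ | ⟨w, hw, h⟩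
  · exact Or.inl ⟨w, hw, by rw [hx', h]; ring⟩
  · refine Or.inr ⟨0, fun m => ?_⟩
    have := key 1 (one_mem _) ⟨w, hw, by rw [hx']; linear_combination av a k * h⟩ m
    simpa using this
  · refine Or.inr ⟨1, fun m => ?_⟩
    have := key zeta zeta_mem ⟨w, hw, by rw [hx']; linear_combination av a k * h⟩ m
    convert this using 3
    ring

lemma fin_four_add_two_two (i : Fin 4) : i + 2 + 2 = i := by revert i; decide

lemma fin_four_add_two_three (i : Fin 4) : i + 2 + 3 = i + 1 := by revert i; decide

lemma fin_four_add_one_three (i : Fin 4) : i + 1 + 3 = i := by revert i; decide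

lemma fin_four_sub_one (i : Fin 4) : i - 1 = i + 3 := by revert i; decide

/-! ### Rhombi of level `k` -/

/-- The rhombus with acute corners `p` and `p + e (1 + ζ)`. -/
def rho (p e : ℂ) : Fin 4 → ℂ := ![p, p + e, p + e * theta, p + e * zeta]

/-- `Q` lists the corners of a tile of the rhombille tiling of level `k`. -/
def IsRhomb (o a : ℂ) (k : ℕ) (Q : Fin 4 → ℂ) : Prop :=
  ∃ p ∈ lat o a k, ∃ j : ℕ, ∃ r : Fin 4, ∀ i, Q i = rho p (av a k * zeta ^ j) (i + r)

/-- The corners of `Q`, listed from `i` on, are those of `rho (Q i) (av a k * zeta ^ j)`. -/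
structure Corner (a : ℂ) (k : ℕ) (Q : Fin 4 → ℂ) (i : Fin 4) (j : ℕ) : Prop where
  one : Q (i + 1) = Q i + av a k * zeta ^ j
  two : Q (i + 2) = Q i + av a k * zeta ^ j * theta
  three : Q (i + 3) = Q i + av a k * zeta ^ j * zeta

lemma zeta_pow_add_three (j : ℕ) : zeta ^ (j + 3) = - zeta ^ j := by
  rw [pow_add, zeta_cube]; ring

lemma IsRhomb.mem_succ {Q : Fin 4 → ℂ} (h : IsRhomb o a k Q) (i : Fin 4) :
    Q i ∈ lat o a (k + 1) := by
  obtain ⟨p, hp, j, r, h⟩ := h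
  rw [h]
  have e1 := add_zeta_pow_mem hp j
  have e2 := add_zeta_pow_mem hp (j + 1)
  have e3 := lat_subset_succ (lat_add_theta hp (pow_mem zeta_mem j))
  generalize i + r = l
  fin_cases l
  · exact lat_subset_succ hp
  · exact e1
  · simp only [rho]; convert e3 using 1; simp; ring
  · simp only [rho]; convert e2 using 1; simp [pow_succ]; ring

/-- Exactly the acute corners lie in `lat o a k`. The tile looks the same from both of them up to a
half turn, which is the shift of the exponent by `3`. -/
lemma IsRhomb.corner (ha : a ≠ 0) {Q : Fin 4 → ℂ} (h : IsRhomb o a k Q) {i : Fin 4}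
    (hi : Q i ∈ lat o a k) : ∃ j, Corner a k Q i j := by
  obtain ⟨p, hp, j, r, h⟩ := h
  have e1 := add_zeta_pow_notMem ha hp j
  have e2 := add_zeta_pow_notMem ha hp (j + 1)
  have h1 : ∀ l, Q (i + l) = rho p (av a k * zeta ^ j) (i + r + l) := by
    intro l; rw [h]; congr 1; abel
  have h0 := h i
  generalize i + r = t at h1 h0
  fin_cases t
  · have h0 : Q i = p := h0
    refine ⟨j, ⟨?_, ?_, ?_⟩⟩ <;> rw [h1, h0] <;> simp [rho]
  · rw [h0] at hi; exact absurd hi e1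
  · have h0 : Q i = p + av a k * zeta ^ j * theta := h0
    refine ⟨j + 3, ⟨?_, ?_, ?_⟩⟩ <;> rw [h1, h0, zeta_pow_add_three]
    · change p + av a k * zeta ^ j * zeta = _
      unfold theta; ring
    · change p = _
      unfold theta; ring
    · change p + av a k * zeta ^ j = _
      unfold theta; ring
  · rw [h0] at hi
    refine absurd ?_ e2
    convert hi using 1
    simp [rho, pow_succ]; ring

lemma IsRhomb.or_succ {Q : Fin 4 → ℂ} (h : IsRhomb o a k Q) (i : Fin 4) :
    Q i ∈ lat o a k ∨ Q (i + 1) ∈ lat o a k := by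
  obtain ⟨p, hp, j, r, h⟩ := h
  have e3 := lat_add_theta hp (pow_mem zeta_mem j)
  have e4 : p + av a k * zeta ^ j * theta ∈ lat o a k := by convert e3 using 1; ring
  have h1 : Q (i + 1) = rho p (av a k * zeta ^ j) (i + r + 1) := by
    rw [h]; congr 1; abel
  have h0 := h i
  rw [h1, h0]
  generalize i + r = t
  fin_cases t
  · exact Or.inl hp
  · exact Or.inr e4
  · exact Or.inl e4
  · exact Or.inr hp

lemma IsRhomb.exists_mem {Q : Fin 4 → ℂ} (h : IsRhomb o a k Q) : ∃ i, Q i ∈ lat o a k :=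
  (h.or_succ 0).elim (fun h => ⟨_, h⟩) fun h => ⟨_, h⟩

lemma Corner.isRhomb {Q : Fin 4 → ℂ} {i : Fin 4} {j : ℕ} (hi : Q i ∈ lat o a k)
    (h : Corner a k Q i j) : IsRhomb o a k Q := by
  refine ⟨Q i, hi, j, -i, fun l => ?_⟩
  obtain ⟨m, rfl⟩ : ∃ m, l = i + m := ⟨l - i, by abel⟩
  rw [show i + m + -i = m by abel]
  fin_cases m
  · simp [rho]
  · exact h.one
  · exact h.two
  · exact h.three

namespace Corner
variable {Q : Fin 4 → ℂ} {i : Fin 4} {j : ℕ}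

lemma three' (h : Corner a k Q i j) : Q (i + 3) = Q i + av a k * zeta ^ (j + 1) := by
  rw [h.three]; ring

lemma dist_one (h : Corner a k Q i j) : dist (Q i) (Q (i + 1)) = sl a k := by
  rw [h.one, dist_add_zeta_pow]

lemma dist_three (h : Corner a k Q i j) : dist (Q i) (Q (i + 3)) = sl a k := by
  rw [h.three', dist_add_zeta_pow]

lemma two_mem (hi : Q i ∈ lat o a k) (h : Corner a k Q i j) : Q (i + 2) ∈ lat o a k := by
  rw [h.two]
  convert lat_add_theta hi (pow_mem zeta_mem j) using 1; ring

lemma opp (h : Corner a k Q i j) : Corner a k Q (i + 2) (j + 3) := by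
  have e1 : i + 2 + 1 = i + 3 := by abel
  have e2 : i + 2 + 2 = i := fin_four_add_two_two i
  have e3 : i + 2 + 3 = i + 1 := fin_four_add_two_three i
  refine ⟨?_, ?_, ?_⟩
  · rw [e1, h.two, h.three, zeta_pow_add_three]; unfold theta; ring
  · rw [e2, h.two, zeta_pow_add_three]; unfold theta; ring
  · rw [e3, h.two, h.one, zeta_pow_add_three]; unfold theta; ring

lemma one_notMem (ha : a ≠ 0) (hi : Q i ∈ lat o a k) (h : Corner a k Q i j) :
    Q (i + 1) ∉ lat o a k := by
  rw [h.one]; exact add_zeta_pow_notMem ha hi j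

lemma three_notMem (ha : a ≠ 0) (hi : Q i ∈ lat o a k) (h : Corner a k Q i j) :
    Q (i + 3) ∉ lat o a k := by
  rw [h.three']; exact add_zeta_pow_notMem ha hi _

end Corner

/-- The centroid of a corner and its two neighbors. -/
def cen (Q : Fin 4 → ℂ) (i : Fin 4) : ℂ := (Q (i - 1) + Q i + Q (i + 1)) / 3

/-- `θ / 3 = ζ / θ`, so the centroid is one edge of level `k + 1` away from the corner, along the
long diagonal. -/
lemma Corner.cen_eq {Q : Fin 4 → ℂ} {i : Fin 4} {j : ℕ} (h : Corner a k Q i j) :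
    cen Q i = Q i + av a (k + 1) * zeta ^ (j + 1) := by
  have e : i - 1 = i + 3 := fin_four_sub_one i
  unfold cen
  rw [e, h.one, h.three, ← av_succ a k]
  have := theta_sq
  unfold theta at *
  linear_combination (1/3 : ℂ) * av a (k+1) * zeta ^ j * this

end

section

variable {o a : ℂ} {k : ℕ}

/-! ### Centroids of cut corners -/

lemma fin_four_add_one_one (i : Fin 4) : i + 1 + 1 = i + 2 := by revert i; decide

lemma fin_four_add_one_two (i : Fin 4) : i + 1 + 2 = i + 3 := by revert i; decide

lemma fin_four_add_three_one (i : Fin 4) : i + 3 + 1 = i := by revert i; decide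

lemma fin_four_add_two_one (i : Fin 4) : i + 2 + 1 = i + 3 := by revert i; decide

lemma fin_four_cases (i l : Fin 4) : l = i ∨ l = i + 1 ∨ l = i + 2 ∨ l = i + 3 := by
  revert i l; decide

namespace Corner
variable {Q : Fin 4 → ℂ} {i : Fin 4} {j : ℕ}

lemma one_eq_cen (h : Corner a k Q i j) : Q (i + 1) = cen Q i + av a (k + 1) * zeta ^ j := by
  rw [h.cen_eq, h.one, ← av_succ a k]; unfold theta; ring

lemma three_eq_cen (h : Corner a k Q i j) :
    Q (i + 3) = cen Q i + av a (k + 1) * zeta ^ (j + 2) := by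
  rw [h.cen_eq, h.three, ← av_succ a k]; unfold theta; ring

lemma cen_eq_one (h : Corner a k Q i j) :
    cen Q i = Q (i + 1) + av a (k + 1) * zeta ^ (j + 3) := by
  rw [h.one_eq_cen, zeta_pow_add_three]; ring

lemma cen_eq_three (h : Corner a k Q i j) :
    cen Q i = Q (i + 3) + av a (k + 1) * zeta ^ (j + 5) := by
  rw [h.three_eq_cen, show j + 5 = j + 2 + 3 by ring, zeta_pow_add_three]; ring

lemma dist_cen (h : Corner a k Q i j) : dist (Q i) (cen Q i) = sl a (k + 1) := by
  rw [h.cen_eq, dist_add_zeta_pow]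

lemma dist_one_cen (h : Corner a k Q i j) : dist (Q (i + 1)) (cen Q i) = sl a (k + 1) := by
  rw [h.cen_eq_one, dist_add_zeta_pow]

lemma dist_three_cen (h : Corner a k Q i j) : dist (Q (i + 3)) (cen Q i) = sl a (k + 1) := by
  rw [h.cen_eq_three, dist_add_zeta_pow]

lemma cen_mem (hi : Q i ∈ lat o a k) (h : Corner a k Q i j) : cen Q i ∈ lat o a (k + 2) := by
  rw [h.cen_eq]; exact add_zeta_pow_mem (lat_subset_succ hi) _

lemma cen_notMem (ha : a ≠ 0) (hi : Q i ∈ lat o a k) (h : Corner a k Q i j) :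
    cen Q i ∉ lat o a (k + 1) := by
  rw [h.cen_eq]; exact add_zeta_pow_notMem ha (lat_subset_succ hi) _

lemma one_mem (hi : Q i ∈ lat o a k) (h : Corner a k Q i j) : Q (i + 1) ∈ lat o a (k + 1) := by
  rw [h.one]; exact add_zeta_pow_mem hi _

end Corner

/-! ### Cutting corners and the meshes of down-closed sets of replacements -/

open Classical in
/-- All corners that lie in `S` are cut. -/
def cutSet (S : Set ℂ) (Q : Fin 4 → ℂ) : Fin 4 → ℂ :=
  fun i => if Q i ∈ S then cen Q i else Q i

lemma cutSet_of_mem {S : Set ℂ} {Q : Fin 4 → ℂ} {i : Fin 4} (h : Q i ∈ S) :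
    cutSet S Q i = cen Q i := if_pos h

lemma cutSet_of_notMem {S : Set ℂ} {Q : Fin 4 → ℂ} {i : Fin 4} (h : Q i ∉ S) :
    cutSet S Q i = Q i := if_neg h

lemma cutSet_congr {S S' : Set ℂ} {Q : Fin 4 → ℂ} (h : ∀ i, Q i ∈ S ↔ Q i ∈ S') :
    cutSet S Q = cutSet S' Q := by
  funext i
  by_cases hi : Q i ∈ S
  · rw [cutSet_of_mem hi, cutSet_of_mem ((h i).1 hi)]
  · rw [cutSet_of_notMem hi, cutSet_of_notMem (fun h' => hi ((h i).2 h'))]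

lemma cutSet_eq_self {S : Set ℂ} {Q : Fin 4 → ℂ} (h : ∀ i, Q i ∉ S) : cutSet S Q = Q :=
  funext fun i => cutSet_of_notMem (h i)

/-- The centers of the replacements of level `k` in `D`. -/
def lev (D : Finset (ℕ × ℂ)) (k : ℕ) : Set ℂ := {x | (k, x) ∈ D}

/-- `D` is a set of replacements that contains the prerequisites of each of its members. -/
structure IsDown (o a : ℂ) (D : Finset (ℕ × ℂ)) : Prop where
  mem : ∀ k x, x ∈ lev D k → x ∈ lat o a k
  down : ∀ k x q, x ∈ lev D (k + 1) → q ∈ lat o a k → dist x q ≤ sl a k → q ∈ lev D k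

/-- The tiles of level `k` that appear (possibly with cut corners) when the replacements in `D` are
performed. -/
def Ex (o a : ℂ) (D : Finset (ℕ × ℂ)) : ℕ → Set (Fin 4 → ℂ)
  | 0 => rhombille o a
  | k + 1 => {Q | ∃ x ∈ lev D k, ∃ j : ℕ, Q = diamond x (x + av a k * zeta ^ j)} ∪
      {Q' | ∃ Q ∈ Ex o a D k, (∀ i, Q i ∈ lat o a k → Q i ∈ lev D k) ∧ Q' = cutSet (lev D k) Q}

/-- Some acute corner of the level `k` tile `Q` is not cut. -/
def Uncut (o a : ℂ) (D : Finset (ℕ × ℂ)) (k : ℕ) (Q : Fin 4 → ℂ) : Prop :=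
  ∃ i, Q i ∈ lat o a k ∧ Q i ∉ lev D k

/-- The mesh after the replacements in `D`. -/
def mesh (o a : ℂ) (D : Finset (ℕ × ℂ)) : QuadMesh :=
  {Q' | ∃ k, ∃ Q ∈ Ex o a D k, Uncut o a D k Q ∧ Q' = cutSet (lev D k) Q}

/-- An edge of level `k` has `√3` times the length of one of level `k + 1`, as has the long diagonal
of a rhombus of level `k + 1`. The factor `(1 + conj ζ) / 3` in `diamond` is `1 / θ`. -/
lemma diamond_corner (x : ℂ) (j : ℕ) :
    Corner a (k + 1) (diamond x (x + av a k * zeta ^ j)) 0 j := by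
  have h := conj_zeta
  have h2 := zeta_sq
  refine ⟨?_, ?_, ?_⟩
  · simp only [diamond, zero_add, h, ← av_succ a k]
    simp only [Matrix.cons_val_one, Matrix.cons_val_zero, theta]
    linear_combination (-1/3 : ℂ) * av a (k + 1) * zeta ^ j * h2
  · simp only [diamond, zero_add, h, ← av_succ a k]
    simp [theta]
    ring
  · simp only [diamond, zero_add, h, ← av_succ a k]
    simp [theta]
    linear_combination (1/3 : ℂ) * av a (k + 1) * zeta ^ j * h2

/-- When both acute corners are cut, the old obtuse corners become the acute ones: the short
diagonal, of length `sl a k = √3 · sl a (k + 1)`, is the long diagonal of the new rhombus. -/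
lemma cutSet_corner (ha : a ≠ 0) {S : Set ℂ} {Q : Fin 4 → ℂ} {i : Fin 4} {j : ℕ}
    (hS : S ⊆ lat o a k) (hi : Q i ∈ lat o a k) (h : Corner a k Q i j) (h0 : Q i ∈ S)
    (h2 : Q (i + 2) ∈ S) : Corner a (k + 1) (cutSet S Q) (i + 1) (j + 2) := by
  have n1 : Q (i + 1) ∉ S := fun h' => h.one_notMem ha hi (hS h')
  have n3 : Q (i + 3) ∉ S := fun h' => h.three_notMem ha hi (hS h')
  have c2 := h.opp.cen_eq_three
  rw [fin_four_add_two_three] at c2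
  refine ⟨?_, ?_, ?_⟩
  · rw [fin_four_add_one_one, cutSet_of_mem h2, cutSet_of_notMem n1, c2,
      show j + 3 + 5 = j + 2 + 6 by ring, pow_add _ (j + 2), zeta_pow_six, mul_one]
  · rw [fin_four_add_one_two, cutSet_of_notMem n3, cutSet_of_notMem n1, h.three, h.one,
      ← av_succ a k]
    unfold theta
    linear_combination (- av a (k + 1) * zeta ^ j - av a (k + 1) * zeta ^ (j + 1)) * zeta_sq
  · rw [fin_four_add_one_three, cutSet_of_mem h0, cutSet_of_notMem n1, h.cen_eq_one]
    ring

lemma rhombille_corner {Q : Fin 4 → ℂ} (h : Q ∈ rhombille o a) :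
    Q 0 ∈ lat o a 0 ∧ ∃ j, Corner a 0 Q 0 j := by
  obtain ⟨m, n, j, p, hp, rfl⟩ := h
  refine ⟨⟨m + n * zeta, ⟨m, n, rfl⟩, ?_⟩, j, ⟨?_, ?_, ?_⟩⟩
  · simp [av, theta, hp]
  · simp [av]
  · simp [av, theta]
  · simp [av]; ring

lemma IsDown.lev_subset {D : Finset (ℕ × ℂ)} (hD : IsDown o a D) (k : ℕ) :
    lev D k ⊆ lat o a k := fun x hx => hD.mem k x hx

/-- A point of both lattices is its own prerequisite, at distance zero. -/
lemma IsDown.self_down {D : Finset (ℕ × ℂ)} (hD : IsDown o a D) {l k : ℕ} (hlk : l ≤ k)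
    {x : ℂ} (hx : x ∈ lev D k) (hl : x ∈ lat o a l) : x ∈ lev D l := by
  induction k, hlk using Nat.le_induction with
  | base => exact hx
  | succ k hk ih =>
    exact ih (hD.down k x x hx (lat_mono hk hl) (by rw [dist_self]; exact sl_nonneg _ _))

lemma isRhomb_of_mem_Ex (ha : a ≠ 0) {D : Finset (ℕ × ℂ)} (hD : IsDown o a D)
    {Q : Fin 4 → ℂ} (hQ : Q ∈ Ex o a D k) : IsRhomb o a k Q := by
  induction k generalizing Q with
  | zero =>
    obtain ⟨h0, j, hj⟩ := rhombille_corner hQ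
    exact hj.isRhomb h0
  | succ k ih =>
    rcases hQ with ⟨x, hx, j, rfl⟩ | ⟨Q, hQ, hall, rfl⟩
    · have hx1 : diamond x (x + av a k * zeta ^ j) 0 ∈ lat o a (k + 1) :=
        lat_subset_succ (hD.mem _ _ hx)
      exact (diamond_corner x j).isRhomb hx1
    · obtain ⟨i, hi⟩ := (ih hQ).exists_mem
      obtain ⟨j, hj⟩ := (ih hQ).corner ha hi
      refine (cutSet_corner ha (hD.lev_subset k) hi hj (hall _ hi)
        (hall _ (hj.two_mem hi))).isRhomb ?_
      rw [cutSet_of_notMem fun h' => hj.one_notMem ha hi (hD.mem _ _ h')]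
      exact hj.one_mem hi

/-- A tile of positive level needs either a center or a tile whose acute corners are all cut, and
every rhombus has an acute corner. -/
lemma mesh_empty (ha : a ≠ 0) : mesh o a ∅ = rhombille o a := by
  have hD : IsDown o a ∅ := ⟨by simp [lev], by simp [lev]⟩
  have hl : ∀ k, lev ∅ k = ∅ := fun k => by simp [lev]
  have hE : ∀ k Q, Q ∈ Ex o a ∅ k → k = 0 := by
    intro k Q hQ
    cases k with
    | zero => rfl
    | succ k =>
      rcases hQ with ⟨x, hx, j, rfl⟩ | ⟨Q, hQ, hall, rfl⟩
      · simp [hl] at hx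
      · obtain ⟨i, hi⟩ := (isRhomb_of_mem_Ex ha hD hQ).exists_mem
        have := hall _ hi
        simp [hl] at this
  ext Q
  constructor
  · rintro ⟨k, Q, hQ, -, rfl⟩
    obtain rfl := hE k Q hQ
    rw [cutSet_eq_self (by simp [hl])]
    exact hQ
  · intro hQ
    refine ⟨0, Q, hQ, ?_, (cutSet_eq_self (by simp [hl])).symm⟩
    exact ⟨0, (rhombille_corner hQ).1, by simp [hl]⟩

/-! ### Edges -/

/-- The edge from `x ∈ lat k` to `c ∈ lat (k + 1)` is one that the mesh of `D` may have. -/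
structure EdgeAt (o a : ℂ) (D : Finset (ℕ × ℂ)) (k : ℕ) (x c : ℂ) : Prop where
  mem : x ∈ lat o a k
  notMem : x ∉ lev D k
  eq : ∃ j, c = x + av a k * zeta ^ j
  pred : ∀ l, k = l + 1 → ∃ y ∈ lev D l, dist y c = sl a k

/-- Such a corner is either an obtuse corner of a new diamond or the centroid of a cut corner. This
supplies `EdgeAt.pred`: an edge remembers a replacement that created it. -/
lemma exists_pred_obtuse (ha : a ≠ 0) {D : Finset (ℕ × ℂ)} (hD : IsDown o a D)
    {Q : Fin 4 → ℂ} (hQ : Q ∈ Ex o a D (k + 1)) {l : Fin 4} (hl : Q l ∉ lat o a (k + 1)) :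
    ∃ y ∈ lev D k, dist y (Q l) = sl a (k + 1) := by
  have hR := isRhomb_of_mem_Ex ha hD hQ
  rcases hQ with ⟨x, hx, j, rfl⟩ | ⟨Q, hQ, hall, rfl⟩
  · have hc := diamond_corner (a := a) (k := k) x j
    have h0 : diamond x (x + av a k * zeta ^ j) 0 = x := rfl
    have hx1 : diamond x (x + av a k * zeta ^ j) 0 ∈ lat o a (k + 1) :=
      lat_subset_succ (hD.mem _ _ hx)
    refine ⟨x, hx, ?_⟩
    rcases fin_four_cases 0 l with rfl | rfl | rfl | rfl
    · exact absurd hx1 hl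
    · exact hc.dist_one
    · exact absurd (hc.two_mem hx1) hl
    · exact hc.dist_three
  · by_cases hm : Q l ∈ lev D k
    · obtain ⟨j, hj⟩ := (isRhomb_of_mem_Ex ha hD hQ).corner ha (hD.mem _ _ hm)
      exact ⟨Q l, hm, by rw [cutSet_of_mem hm, hj.dist_cen]⟩
    · rw [cutSet_of_notMem hm] at hl
      exact absurd ((isRhomb_of_mem_Ex ha hD hQ).mem_succ l) hl

/-- An acute corner is an end of a new diamond or an old obtuse corner next to a cut one. This is
how a small tile is later traced back to a replacement one level up. -/
lemma exists_pred_acute (ha : a ≠ 0) {D : Finset (ℕ × ℂ)} (hD : IsDown o a D)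
    {Q : Fin 4 → ℂ} (hQ : Q ∈ Ex o a D (k + 1)) {l : Fin 4} (hl : Q l ∈ lat o a (k + 1)) :
    ∃ y ∈ lev D k, dist y (Q l) ≤ sl a k := by
  rcases hQ with ⟨x, hx, j, rfl⟩ | ⟨Q, hQ, hall, rfl⟩
  · have hc := diamond_corner (a := a) (k := k) x j
    have hx1 : diamond x (x + av a k * zeta ^ j) 0 ∈ lat o a (k + 1) :=
      lat_subset_succ (hD.mem _ _ hx)
    refine ⟨x, hx, ?_⟩
    rcases fin_four_cases 0 l with rfl | rfl | rfl | rfl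
    · simp only [diamond, Matrix.cons_val_zero, dist_self]; exact sl_nonneg _ _
    · exact absurd hl (hc.one_notMem ha hx1)
    · exact (dist_add_zeta_pow x j).le
    · exact absurd hl (hc.three_notMem ha hx1)
  · have hR := isRhomb_of_mem_Ex ha hD hQ
    by_cases hm : Q l ∈ lat o a k
    · obtain ⟨j, hj⟩ := hR.corner ha hm
      rw [cutSet_of_mem (hall l hm)] at hl
      exact absurd hl (hj.cen_notMem ha hm)
    · have hm1 := (hR.or_succ l).resolve_left hm
      obtain ⟨j, hj⟩ := hR.corner ha hm1
      refine ⟨Q (l + 1), hall _ hm1, ?_⟩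
      rw [cutSet_of_notMem fun h => hm (hD.mem _ _ h)]
      have := hj.dist_three
      rw [fin_four_add_one_three] at this
      exact this.le

lemma edgeAt_of_corner (ha : a ≠ 0) {D : Finset (ℕ × ℂ)} (hD : IsDown o a D)
    {Q : Fin 4 → ℂ} (hQ : Q ∈ Ex o a D k) (hU : Uncut o a D k Q) {i : Fin 4}
    (hi : Q i ∈ lat o a k) {l : Fin 4} (hl : l = i + 1 ∨ l = i + 3) :
    ∃ k', EdgeAt o a D k' (cutSet (lev D k) Q i) (cutSet (lev D k) Q l) ∨
      EdgeAt o a D k' (cutSet (lev D k) Q l) (cutSet (lev D k) Q i) := by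
  have hR := isRhomb_of_mem_Ex ha hD hQ
  obtain ⟨j, hj⟩ := hR.corner ha hi
  have hln : Q l ∉ lat o a k := by
    rcases hl with rfl | rfl
    exacts [hj.one_notMem ha hi, hj.three_notMem ha hi]
  rw [cutSet_of_notMem fun h => hln (hD.mem _ _ h)]
  by_cases hm : Q i ∈ lev D k
  · rw [cutSet_of_mem hm]
    refine ⟨k + 1, Or.inr ⟨hR.mem_succ l, ?_, ?_, ?_⟩⟩
    -- A replacement of level `k + 1` at the obtuse corner would require both acute corners to be
    -- cut, but one of them is not.
    · intro hlm
      obtain ⟨i', hi', hn⟩ := hU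
      apply hn
      rcases fin_four_cases i i' with rfl | rfl | rfl | rfl
      · exact hm
      · exact absurd hi' (hj.one_notMem ha hi)
      · refine hD.down _ _ _ hlm hi' ?_
        rw [dist_comm]
        rcases hl with rfl | rfl
        · have := hj.opp.dist_three
          rw [fin_four_add_two_three] at this
          exact this.le
        · have := hj.opp.dist_one
          rw [fin_four_add_two_one] at this
          exact this.le
      · exact absurd hi' (hj.three_notMem ha hi)
    · rcases hl with rfl | rfl
      exacts [⟨_, hj.cen_eq_one⟩, ⟨_, hj.cen_eq_three⟩]
    · intro l' hl'
      obtain rfl : k = l' := by omega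
      exact ⟨_, hm, hj.dist_cen⟩
  · rw [cutSet_of_notMem hm]
    refine ⟨k, Or.inl ⟨hi, hm, ?_, ?_⟩⟩
    · rcases hl with rfl | rfl
      exacts [⟨_, hj.one⟩, ⟨_, hj.three'⟩]
    · rintro l' rfl
      exact exists_pred_obtuse ha hD hQ hln

lemma edgeAt_of_mem_mesh (ha : a ≠ 0) {D : Finset (ℕ × ℂ)} (hD : IsDown o a D)
    {Q : Fin 4 → ℂ} (hQ : Q ∈ mesh o a D) (i : Fin 4) :
    ∃ k, EdgeAt o a D k (Q i) (Q (i + 1)) ∨ EdgeAt o a D k (Q (i + 1)) (Q i) := by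
  obtain ⟨k, Q, hQ, hU, rfl⟩ := hQ
  rcases (isRhomb_of_mem_Ex ha hD hQ).or_succ i with h | h
  · exact edgeAt_of_corner ha hD hQ hU h (Or.inl rfl)
  · obtain ⟨k', h'⟩ := edgeAt_of_corner ha hD hQ hU h
      (Or.inr (fin_four_add_one_three i).symm)
    exact ⟨k', h'.symm⟩

lemma edgeAt_of_isEdge (ha : a ≠ 0) {D : Finset (ℕ × ℂ)} (hD : IsDown o a D)
    {x y : ℂ} (h : IsEdge (mesh o a D) x y) :
    ∃ k, EdgeAt o a D k x y ∨ EdgeAt o a D k y x := by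
  obtain ⟨Q, hQ, i, ⟨rfl, rfl⟩ | ⟨rfl, rfl⟩⟩ := h
  · exact edgeAt_of_mem_mesh ha hD hQ i
  · obtain ⟨k, h⟩ := edgeAt_of_mem_mesh ha hD hQ i
    exact ⟨k, h.symm⟩

lemma EdgeAt.dist_eq {D : Finset (ℕ × ℂ)} {x c : ℂ} (h : EdgeAt o a D k x c) :
    dist x c = sl a k := by
  obtain ⟨j, rfl⟩ := h.eq
  exact dist_add_zeta_pow x j

/-! ### The six edges at a replacement center -/

lemma zeta_pow_injOn : Set.InjOn (fun j : ℕ => zeta ^ j) (Set.Iio 6) := by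
  have key : ∀ i j : ℕ, i < j → j < 6 → zeta ^ i ≠ zeta ^ j := by
    intro i j hij hj h
    obtain ⟨d, rfl⟩ := Nat.exists_eq_add_of_lt hij
    rw [add_assoc, pow_add] at h
    have h1 : zeta ^ (d + 1) = 1 := by
      have := pow_ne_zero i zeta_ne_zero
      field_simp at h
      exact h.symm
    have hre : zeta.re = 1 / 2 := rfl
    have him : zeta.im = Real.sqrt 3 / 2 := rfl
    have h3 := sqrt_three_gt
    have hd : d < 5 := by omega
    have e4 : zeta ^ 4 = -zeta := by linear_combination zeta * zeta_cube
    have e5 : zeta ^ 5 = 1 - zeta := by linear_combination zeta ^ 2 * zeta_cube - zeta_sq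
    interval_cases d <;> simp only [zero_add, Nat.reduceAdd, pow_one] at h1
    · rw [h1] at hre; norm_num at hre
    · rw [zeta_sq] at h1
      have := congrArg Complex.re h1
      rw [Complex.sub_re, hre] at this; norm_num at this
    · rw [zeta_cube] at h1; norm_num at h1
    · rw [e4] at h1
      have := congrArg Complex.im h1
      rw [Complex.neg_im, him, Complex.one_im] at this; linarith
    · rw [e5] at h1
      have := congrArg Complex.re h1
      rw [Complex.sub_re, hre] at this; norm_num at this
  intro i hi j hj h
  rcases lt_trichotomy i j with h' | h' | h'
  · exact absurd h (key i j h' hj)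
  · exact h'
  · exact absurd h.symm (key j i h' hi)

/-- The six points joined to `p` in the tiling of level `k`. -/
def nbrs (a : ℂ) (k : ℕ) (p : ℂ) : Set ℂ := (fun j : ℕ => p + av a k * zeta ^ j) '' Set.Iio 6

lemma ncard_nbrs (ha : a ≠ 0) (p : ℂ) : (nbrs a k p).ncard = 6 := by
  have hinj : Set.InjOn (fun j : ℕ => p + av a k * zeta ^ j) (Set.Iio 6) := fun i hi j hj h =>
    zeta_pow_injOn hi hj (mul_left_cancel₀ (av_ne_zero ha k) (add_left_cancel h))
  rw [nbrs, hinj.ncard_image, ← Finset.coe_Iio, Set.ncard_coe_finset]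
  simp

lemma mem_nbrs (p : ℂ) (j : ℕ) : p + av a k * zeta ^ j ∈ nbrs a k p := by
  refine ⟨j % 6, Nat.mod_lt _ (by norm_num), ?_⟩
  simp only
  conv_rhs => rw [← Nat.div_add_mod j 6, pow_add, pow_mul, zeta_pow_six, one_pow, one_mul]

/-- Edges of equal length have equal level, so the six given edges are all the level `k` edges at
`p`. Each carries a replacement of the level before, and together these are the prerequisites of
`(k, p)`. -/
lemma ready_imp (ha : a ≠ 0) {D : Finset (ℕ × ℂ)} (hD : IsDown o a D) {p : ℂ} {s : ℝ}
    (h : Ready (mesh o a D) p s) :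
    ∃ k, s = sl a k ∧ p ∈ lat o a k ∧ p ∉ lev D k ∧
      ∀ l, k = l + 1 → ∀ q ∈ lat o a l, dist p q ≤ sl a l → q ∈ lev D l := by
  unfold Ready at h
  set U := {u | IsEdge (mesh o a D) p u ∧ dist p u = s} with hU
  have hne : U.Nonempty := Set.nonempty_of_ncard_ne_zero (by rw [h]; norm_num)
  obtain ⟨u₀, hu₀, hs₀⟩ := hne
  obtain ⟨k, hk⟩ := edgeAt_of_isEdge ha hD hu₀
  have hsk : s = sl a k := by
    rw [← hs₀]; rcases hk with hk | hk
    · exact hk.dist_eq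
    · rw [dist_comm]; exact hk.dist_eq
  have hall : ∀ u ∈ U, EdgeAt o a D k p u ∨ EdgeAt o a D k u p := by
    rintro u ⟨hu, hs⟩
    obtain ⟨k', hk'⟩ := edgeAt_of_isEdge ha hD hu
    have : sl a k = sl a k' := by
      rw [← hsk, ← hs]; rcases hk' with hk' | hk'
      · exact hk'.dist_eq
      · rw [dist_comm]; exact hk'.dist_eq
    rw [(sl_strictAnti ha).injective this]; exact hk'
  have hsub : U ⊆ nbrs a k p := by
    intro u hu
    rcases hall u hu with h' | h'
    · obtain ⟨j, rfl⟩ := h'.eq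
      exact mem_nbrs p j
    · obtain ⟨j, rfl⟩ := h'.eq
      convert mem_nbrs (u + av a k * zeta ^ j) (j + 3) using 1
      rw [zeta_pow_add_three]; ring
  have heq : U = nbrs a k p := by
    refine Set.eq_of_subset_of_ncard_le hsub ?_ ((Set.finite_Iio 6).image _)
    rw [h, ncard_nbrs ha]
  -- Otherwise all six other ends would lie in `lat o a k`, although neighboring ones are only `sl a
  -- k` apart.
  have hpmem : p ∈ lat o a k := by
    by_contra hp
    have hin : ∀ j, p + av a k * zeta ^ j ∈ lat o a k := by
      intro j
      have := mem_nbrs (a := a) (k := k) p j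
      rw [← heq] at this
      rcases hall _ this with h' | h'
      · exact absurd h'.mem hp
      · exact h'.mem
    have h1 := lat_separated_two ha (hin 0) (hin 1) (by
      rw [dist_add_left, dist_eq_norm, ← norm_neg,
        show -(av a k * zeta ^ 0 - av a k * zeta ^ 1) = av a k * zeta ^ 2 by
          linear_combination (- av a k) * zeta_sq, norm_mul, norm_pow, norm_zeta, one_pow,
          mul_one, sl])
    have h2 := mul_left_cancel₀ (av_ne_zero ha k) (add_left_cancel h1)
    exact absurd (zeta_pow_injOn (by simp) (by simp) h2) (by norm_num)
  have hE : ∀ j, EdgeAt o a D k p (p + av a k * zeta ^ j) := by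
    intro j
    have := mem_nbrs (a := a) (k := k) p j
    rw [← heq] at this
    rcases hall _ this with h' | h'
    · exact h'
    · exact absurd h'.mem (add_zeta_pow_notMem ha hpmem j)
  refine ⟨k, hsk, hpmem, (hE 0).notMem, ?_⟩
  rintro l rfl q hq hd
  -- Both `q` and the remembered center `y` are at distance `sl a (l + 1)` from the end of the edge,
  -- so they are closer than `3 · sl a (l + 1) = √3 · sl a l` and coincide.
  have main : ∀ j, dist q (p + av a (l + 1) * zeta ^ j) = sl a (l + 1) → q ∈ lev D l := by
    intro j hj
    obtain ⟨y, hy, hyd⟩ := (hE j).pred l rfl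
    convert hy
    refine lat_separated hq (hD.mem _ _ hy) ?_
    have := dist_triangle_right q y (p + av a (l + 1) * zeta ^ j)
    have h3 := sl_pos ha (l + 1)
    rw [hj, hyd] at this
    rw [sl_succ, ← mul_assoc, ← pow_two, sqrt_three_sq]
    linarith
  rcases eq_or_exists_zeta_pow ha hpmem (lat_subset_succ hq) hd with rfl | ⟨j, -, rfl⟩
  · exact main 0 (dist_add_zeta_pow q 0)
  · refine main j ?_
    rw [← av_succ a l, dist_add_left, dist_eq_norm,
      show av a (l + 1) * theta * zeta ^ j - av a (l + 1) * zeta ^ j =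
        av a (l + 1) * zeta ^ (j + 1) by unfold theta; ring, norm_mul, norm_pow, norm_zeta,
        one_pow, mul_one, sl]

end

section

variable {o a : ℂ} {k : ℕ}

/-! ### The effect of one replacement on the mesh -/

lemma zeta_pow_add_six_mul (j m : ℕ) : zeta ^ (j + 6 * m) = zeta ^ j := by
  rw [pow_add, pow_mul, zeta_pow_six, one_pow, mul_one]

/-- `D'` arises from `D` by adding the replacement of level `k` at `p`. -/
structure Adds (o a : ℂ) (D : Finset (ℕ × ℂ)) (k : ℕ) (p : ℂ) (D' : Finset (ℕ × ℂ)) : Prop where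
  down : IsDown o a D
  down' : IsDown o a D'
  notMem : p ∉ lev D k
  iff : ∀ l x, x ∈ lev D' l ↔ x ∈ lev D l ∨ (l = k ∧ x = p)

namespace Adds
variable {D D' : Finset (ℕ × ℂ)} {p : ℂ}

lemma mem (h : Adds o a D k p D') : p ∈ lev D' k := (h.iff k p).2 (Or.inr ⟨rfl, rfl⟩)

lemma mem_lat (h : Adds o a D k p D') : p ∈ lat o a k := h.down'.mem _ _ h.mem

lemma lev_eq (h : Adds o a D k p D') {l : ℕ} (hl : l ≠ k) : lev D' l = lev D l := by
  ext x; rw [h.iff]; simp [hl]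

lemma lev_subset (h : Adds o a D k p D') (l : ℕ) : lev D l ⊆ lev D' l :=
  fun x hx => (h.iff l x).2 (Or.inl hx)

lemma pred (h : Adds o a D (k + 1) p D') {q : ℂ} (hq : q ∈ lat o a k) (hd : dist p q ≤ sl a k) :
    q ∈ lev D k := by
  have := h.down'.down k p q h.mem hq hd
  rwa [h.lev_eq (by omega)] at this

/-- No replacement of level `k + 1` has been made at a point that needs `(k, p)`. -/
lemma notMem_succ (h : Adds o a D k p D') {c : ℂ} (hd : dist c p ≤ sl a k) :
    c ∉ lev D' (k + 1) := by
  rw [h.lev_eq (by omega)]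
  exact fun hc => h.notMem (h.down.down k c p hc h.mem_lat hd)

/-- At positive level, if `p` is a vertex of the previous lattice, then the diamonds centered at `p`
supply the edge. Otherwise the three diamonds reaching `p` from its replaced neighbors have two
sides each at `p`, which gives all six directions. -/
lemma exists_edge (h : Adds o a D k p D') (j : ℕ) :
    ∃ Q ∈ Ex o a D k, ∃ i, Q i = p ∧
      (Q (i + 1) = p + av a k * zeta ^ j ∨ Q (i + 3) = p + av a k * zeta ^ j) := by
  have hp := h.mem_lat
  cases k with
  | zero =>
    have hmod : av a 0 * zeta ^ j = a * zeta ^ (j % 6) := by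
      rw [av_zero]
      conv_lhs => rw [← Nat.mod_add_div j 6, zeta_pow_add_six_mul]
    rw [hmod]
    have hj : j % 6 < 6 := Nat.mod_lt _ (by norm_num)
    generalize j % 6 = i at hj
    by_cases hi : i < 3
    · obtain ⟨z, ⟨m, n, rfl⟩, hz⟩ := hp
      refine ⟨_, ⟨m, n, ⟨i, hi⟩, p, ?_, rfl⟩, 0, rfl, Or.inl rfl⟩
      rw [hz, av_zero, theta]
    -- The directions `3, 4, 5` belong to tiles that `rhombille` lists from their other acute
    -- corner.
    · obtain ⟨l, rfl⟩ : ∃ l, i = l + 3 := ⟨i - 3, by omega⟩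
      have hp2 := lat_add_theta hp (pow_mem zeta_mem (l + 3))
      obtain ⟨z, ⟨m, n, rfl⟩, hz⟩ := hp2
      refine ⟨_, ⟨m, n, ⟨l, by omega⟩, p + av a 0 * (theta * zeta ^ (l + 3)),
        by rw [hz, av_zero, theta], rfl⟩, 2, ?_, Or.inl ?_⟩
      · simp only [Matrix.cons_val]
        rw [av_zero, zeta_pow_add_three, theta]; ring
      · simp only [Fin.reduceAdd, Matrix.cons_val]
        rw [av_zero, zeta_pow_add_three, theta]; ring
  | succ l =>
    rcases exists_neighbors hp with hl | ⟨i, hi⟩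
    · have hpl : p ∈ lev D l := h.pred hl (by rw [dist_self]; exact sl_nonneg _ _)
      exact ⟨_, Or.inl ⟨p, hpl, j, rfl⟩, 0, rfl, Or.inl (diamond_corner p j).one⟩
    -- The diamond arriving along direction `t = i + 2m` has sides in the directions `t` and `t +
    -- 1`, so `m` is chosen by parity. The multiple `6 * i` only keeps the subtraction nonnegative.
    · obtain ⟨m, hm⟩ : ∃ m, i + 2 * m = j + 6 * i ∨ i + 2 * m + 1 = j + 6 * i :=
        ⟨(j + 5 * i) / 2, by omega⟩
      have hx := hi m
      set t := i + 2 * m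
      set x := p + av a l * zeta ^ t
      have hxl : x ∈ lev D l := h.pred hx (dist_add_zeta_pow p t).le
      have hc := (diamond_corner (a := a) (k := l) x (t + 3)).opp
      have h2 : diamond x (x + av a l * zeta ^ (t + 3)) (0 + 2) = p := by
        change x + av a l * zeta ^ (t + 3) = p
        rw [zeta_pow_add_three]; ring
      refine ⟨_, Or.inl ⟨x, hxl, t + 3, rfl⟩, 0 + 2, h2, ?_⟩
      have e1 := hc.one
      have e3 := hc.three'
      rw [h2] at e1 e3
      rcases hm with hm | hm
      · left
        rw [e1, show t + 3 + 3 = j + 6 * (i + 1) by omega, zeta_pow_add_six_mul]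
      · right
        rw [e3, show t + 3 + 3 + 1 = j + 6 * (i + 1) by omega, zeta_pow_add_six_mul]

lemma isEdge (ha : a ≠ 0) (h : Adds o a D k p D') (j : ℕ) :
    IsEdge (mesh o a D) p (p + av a k * zeta ^ j) := by
  obtain ⟨Q, hQ, i, rfl, hi⟩ := h.exists_edge j
  obtain ⟨j', hc⟩ := (isRhomb_of_mem_Ex ha h.down hQ).corner ha h.mem_lat
  refine ⟨_, ⟨k, Q, hQ, ⟨i, h.mem_lat, h.notMem⟩, rfl⟩, ?_⟩
  have e0 := cutSet_of_notMem h.notMem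
  rcases hi with hi | hi
  · refine ⟨i, Or.inl ⟨e0, ?_⟩⟩
    rw [cutSet_of_notMem, hi]
    exact fun h' => hc.one_notMem ha h.mem_lat (h.down.mem _ _ h')
  · refine ⟨i + 3, Or.inr ⟨?_, ?_⟩⟩
    · rw [cutSet_of_notMem, hi]
      exact fun h' => hc.three_notMem ha h.mem_lat (h.down.mem _ _ h')
    · rw [fin_four_add_three_one]; exact e0

/-- The length determines the level, and since `p ∈ lat o a k`, it must be the coarse end of any
level `k` edge. -/
lemma edges_eq (ha : a ≠ 0) (h : Adds o a D k p D') :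
    {u | IsEdge (mesh o a D) p u ∧ dist p u = sl a k} = nbrs a k p := by
  ext u
  constructor
  · rintro ⟨hu, hd⟩
    obtain ⟨k', hk'⟩ := edgeAt_of_isEdge ha h.down hu
    have : sl a k = sl a k' := by
      rw [← hd]; rcases hk' with hk' | hk'
      · exact hk'.dist_eq
      · rw [dist_comm]; exact hk'.dist_eq
    obtain rfl := (sl_strictAnti ha).injective this
    rcases hk' with hk' | hk'
    · obtain ⟨j, rfl⟩ := hk'.eq
      exact mem_nbrs p j
    · obtain ⟨j, hj⟩ := hk'.eq
      exact absurd h.mem_lat (hj ▸ add_zeta_pow_notMem ha hk'.mem j)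
  · rintro ⟨j, -, rfl⟩
    exact ⟨h.isEdge ha j, dist_add_zeta_pow p j⟩

lemma ready (ha : a ≠ 0) (h : Adds o a D k p D') : Ready (mesh o a D) p (sl a k) := by
  unfold Ready; rw [h.edges_eq ha, ncard_nbrs ha]

/-- The tiles of the mesh with a corner at `p` have level `k`. -/
lemma vertex (ha : a ≠ 0) (h : Adds o a D k p D') {l : ℕ} {Q : Fin 4 → ℂ}
    (hQ : Q ∈ Ex o a D l) (hU : Uncut o a D l Q) {i : Fin 4} (hi : cutSet (lev D l) Q i = p) :
    l = k ∧ Q i = p := by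
  have hR := isRhomb_of_mem_Ex ha h.down hQ
  have hp := h.mem_lat
  rcases lt_trichotomy l k with hlk | rfl | hlk
  -- Coarser tiles: having `(k, p)` in the down-closed `D'` would force the uncut acute corner of
  -- the tile to be cut.
  · exfalso
    obtain ⟨i', hi', hn⟩ := hU
    apply hn
    rw [← h.lev_eq hlk.ne]
    obtain ⟨j, hj⟩ := hR.corner ha hi'
    have h2 := hj.two_mem hi'
    have d1 : ∀ c ∈ lev D' (l + 1), dist (Q i') c = sl a l → Q i' ∈ lev D' l :=
      fun c hc hd => h.down'.down l c _ hc hi' (by rw [dist_comm, hd])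
    have ob : ∀ i, (i = i' + 1 ∨ i = i' + 3) → dist (Q i') (Q i) = sl a l := by
      rintro i (rfl | rfl)
      exacts [hj.dist_one, hj.dist_three]
    by_cases hm : Q i ∈ lev D l
    · rw [cutSet_of_mem hm] at hi
      have hil := h.down.mem _ _ hm
      obtain ⟨j2, hj2⟩ := hR.corner ha hil
      have hnk : p ∉ lat o a (l + 1) := hi ▸ hj2.cen_notMem ha hil
      have hk2 : l + 2 ≤ k := by
        rcases Nat.lt_or_ge (l + 1) k with h' | h'
        · exact h'
        · exact absurd (lat_mono h' hp) hnk
      have hp2 := h.down'.self_down hk2 h.mem (hi ▸ hj2.cen_mem hil)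
      refine d1 (Q (i + 1)) (h.down'.down (l + 1) p _ hp2 (hj2.one_mem hil) ?_) ?_
      · rw [← hi, dist_comm, hj2.dist_one_cen]
      · apply ob
        rcases fin_four_cases i' i with rfl | rfl | rfl | rfl
        · exact Or.inl rfl
        · exact absurd hil (hj.one_notMem ha hi')
        · exact Or.inr (fin_four_add_two_one i')
        · exact absurd hil (hj.three_notMem ha hi')
    · rw [cutSet_of_notMem hm] at hi
      by_cases hil : Q i ∈ lat o a l
      · apply absurd _ hm
        rw [← h.lev_eq hlk.ne]
        exact h.down'.self_down hlk.le (hi ▸ h.mem) hil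
      · have hp1 := h.down'.self_down hlk h.mem (hi ▸ hR.mem_succ i)
        refine d1 p hp1 ?_
        rw [← hi]
        apply ob
        rcases fin_four_cases i' i with rfl | rfl | rfl | rfl
        · exact absurd hi' hil
        · exact Or.inl rfl
        · exact absurd h2 hil
        · exact Or.inr rfl
  · refine ⟨rfl, ?_⟩
    by_cases hm : Q i ∈ lev D l
    · rw [cutSet_of_mem hm] at hi
      obtain ⟨j2, hj2⟩ := hR.corner ha (h.down.mem _ _ hm)
      exact absurd (lat_subset_succ hp) (hi ▸ hj2.cen_notMem ha (h.down.mem _ _ hm))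
    · rwa [cutSet_of_notMem hm] at hi
  -- Finer tiles: a corner lying in the lattice of the preceding level can only be the center of a
  -- diamond, and then the replacement at `p` was already in `D`.
  · exfalso
    obtain ⟨l, rfl⟩ : ∃ m, l = m + 1 := ⟨l - 1, by omega⟩
    have hkl : k ≤ l := by omega
    have hi0 : Q i = p := by
      by_cases hm : Q i ∈ lev D (l + 1)
      · rw [cutSet_of_mem hm] at hi
        obtain ⟨j2, hj2⟩ := hR.corner ha (h.down.mem _ _ hm)
        exact absurd (lat_mono (by omega) hp) (hi ▸ hj2.cen_notMem ha (h.down.mem _ _ hm))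
      · rwa [cutSet_of_notMem hm] at hi
    have hpl : Q i ∈ lat o a l := hi0 ▸ lat_mono hkl hp
    apply h.notMem
    rcases hQ with ⟨x, hx, j, rfl⟩ | ⟨Q, hQ, hall, rfl⟩
    · have hc := diamond_corner (a := a) (k := l) x j
      have hx1 : diamond x (x + av a l * zeta ^ j) 0 ∈ lat o a (l + 1) :=
        lat_subset_succ (h.down.mem _ _ hx)
      rcases fin_four_cases 0 i with rfl | rfl | rfl | rfl
      · have hi0 : x = p := hi0
        exact h.down.self_down hkl (hi0 ▸ hx) hp
      · exact absurd (lat_subset_succ hpl) (hc.one_notMem ha hx1)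
      · exact absurd hpl (add_zeta_pow_notMem ha (h.down.mem _ _ hx) j)
      · exact absurd (lat_subset_succ hpl) (hc.three_notMem ha hx1)
    · have hR' := isRhomb_of_mem_Ex ha h.down hQ
      by_cases hm : Q i ∈ lev D l
      · rw [cutSet_of_mem hm] at hpl
        obtain ⟨j2, hj2⟩ := hR'.corner ha (h.down.mem _ _ hm)
        exact absurd (lat_subset_succ hpl) (hj2.cen_notMem ha (h.down.mem _ _ hm))
      · rw [cutSet_of_notMem hm] at hpl
        exact absurd (hall i hpl) hm

lemma cutSet_eq_of_notMem (h : Adds o a D k p D') {l : ℕ} {Q : Fin 4 → ℂ}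
    (hQ : l = k → ∀ i, Q i ≠ p) : cutSet (lev D' l) Q = cutSet (lev D l) Q := by
  refine cutSet_congr fun i => ?_
  rw [h.iff]
  constructor
  · rintro (h' | ⟨h1, h2⟩)
    exacts [h', absurd h2 (hQ h1 i)]
  · exact Or.inl

/-- The neighbors of an acute corner are obtuse and never cut at this level. Hence the centroid
computed in the present element is that of the original tile, even if the opposite corner was cut
earlier. -/
lemma cutCorner_cutSet (ha : a ≠ 0) (h : Adds o a D k p D') {Q : Fin 4 → ℂ}
    (hQ : Q ∈ Ex o a D k) (hp : ∃ i, Q i = p) :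
    cutCorner p (cutSet (lev D k) Q) = cutSet (lev D' k) Q := by
  have hR := isRhomb_of_mem_Ex ha h.down hQ
  have hU : Uncut o a D k Q := by
    obtain ⟨i, rfl⟩ := hp
    exact ⟨i, h.mem_lat, h.notMem⟩
  funext i
  unfold cutCorner
  by_cases hi : Q i = p
  · have hil : Q i ∈ lat o a k := hi ▸ h.mem_lat
    obtain ⟨j, hj⟩ := hR.corner ha hil
    have hin : Q i ∉ lev D k := hi ▸ h.notMem
    have him : Q i ∈ lev D' k := hi ▸ h.mem
    have n1 : Q (i + 1) ∉ lev D k := fun h' => hj.one_notMem ha hil (h.down.mem _ _ h')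
    have n3 : Q (i - 1) ∉ lev D k := by
      rw [fin_four_sub_one]
      exact fun h' => hj.three_notMem ha hil (h.down.mem _ _ h')
    rw [cutSet_of_notMem hin, if_pos hi, cutSet_of_mem him, cutSet_of_notMem n1,
      cutSet_of_notMem n3]
    rfl
  · rw [if_neg fun h' => hi (h.vertex ha hQ hU h').2]
    by_cases hm : Q i ∈ lev D k
    · rw [cutSet_of_mem hm, cutSet_of_mem (h.lev_subset k hm)]
    · rw [cutSet_of_notMem hm, cutSet_of_notMem]
      rw [h.iff]; tauto

end Adds

/-- A promoted tile already has all its acute corners cut, so further replacements of the same level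
do not alter it. -/
lemma Ex_mono {D D' : Finset (ℕ × ℂ)} (hD' : IsDown o a D') (hsub : D ⊆ D') :
    Ex o a D k ⊆ Ex o a D' k := by
  induction k with
  | zero => exact subset_rfl
  | succ k ih =>
    rintro Q (⟨x, hx, j, rfl⟩ | ⟨Q, hQ, hall, rfl⟩)
    · exact Or.inl ⟨x, hsub hx, j, rfl⟩
    · refine Or.inr ⟨Q, ih hQ, fun i hi => hsub (hall i hi), cutSet_congr fun i => ?_⟩
      exact ⟨fun h => hsub h, fun h => hall i (hD'.mem _ _ h)⟩

namespace Adds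
variable {D D' : Finset (ℕ × ℂ)} {p : ℂ}

lemma subset (h : Adds o a D k p D') : D ⊆ D' := fun x hx => h.lev_subset x.1 hx

/-- A new tile of level `k + 1`. -/
def NewTile (o a : ℂ) (D D' : Finset (ℕ × ℂ)) (k : ℕ) (p : ℂ) (Q : Fin 4 → ℂ) : Prop :=
  (∃ j : ℕ, Q = diamond p (p + av a k * zeta ^ j)) ∨
    ∃ Q₀ ∈ Ex o a D k, (∃ i, Q₀ i = p) ∧ (∀ i, Q₀ i ∈ lat o a k → Q₀ i ∈ lev D' k) ∧
      Q = cutSet (lev D' k) Q₀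

lemma NewTile.mem_Ex (h : Adds o a D k p D') {Q : Fin 4 → ℂ} (hQ : NewTile o a D D' k p Q) :
    Q ∈ Ex o a D' (k + 1) := by
  rcases hQ with ⟨j, rfl⟩ | ⟨Q₀, hQ₀, -, hall, rfl⟩
  · exact Or.inl ⟨p, h.mem, j, rfl⟩
  · exact Or.inr ⟨Q₀, Ex_mono h.down' h.subset hQ₀, hall, rfl⟩

lemma NewTile.notMem (ha : a ≠ 0) (h : Adds o a D k p D') {Q : Fin 4 → ℂ}
    (hQ : NewTile o a D D' k p Q) (i : Fin 4) : Q i ∉ lev D' (k + 1) := by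
  by_cases hi : Q i ∈ lat o a (k + 1)
  · apply h.notMem_succ
    rcases hQ with ⟨j, rfl⟩ | ⟨Q₀, hQ₀, ⟨i', hi'⟩, hall, rfl⟩
    · have hc := diamond_corner (a := a) (k := k) p j
      have hx1 : diamond p (p + av a k * zeta ^ j) 0 ∈ lat o a (k + 1) :=
        lat_subset_succ h.mem_lat
      rcases fin_four_cases 0 i with rfl | rfl | rfl | rfl
      · simp only [diamond, Matrix.cons_val_zero, dist_self]; exact sl_nonneg _ _
      · exact absurd hi (hc.one_notMem ha hx1)
      · rw [dist_comm]; exact (dist_add_zeta_pow p j).le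
      · exact absurd hi (hc.three_notMem ha hx1)
    · have hR := isRhomb_of_mem_Ex ha h.down hQ₀
      have hl' : Q₀ i' ∈ lat o a k := hi' ▸ h.mem_lat
      obtain ⟨j, hj⟩ := hR.corner ha hl'
      by_cases hm : Q₀ i ∈ lev D' k
      · rw [cutSet_of_mem hm] at hi
        obtain ⟨j2, hj2⟩ := hR.corner ha (h.down'.mem _ _ hm)
        exact absurd hi (hj2.cen_notMem ha (h.down'.mem _ _ hm))
      · rw [cutSet_of_notMem hm, dist_comm, ← hi']
        rcases fin_four_cases i' i with rfl | rfl | rfl | rfl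
        · exact absurd (hall _ hl') hm
        · exact hj.dist_one.le
        · exact absurd (hall _ (hj.two_mem hl')) hm
        · exact hj.dist_three.le
  · exact fun h' => hi (h.down'.mem _ _ h')

lemma NewTile.mem_mesh (ha : a ≠ 0) (h : Adds o a D k p D') {Q : Fin 4 → ℂ}
    (hQ : NewTile o a D D' k p Q) : Q ∈ mesh o a D' := by
  refine ⟨k + 1, Q, hQ.mem_Ex h, ?_, (cutSet_eq_self (hQ.notMem ha h)).symm⟩
  obtain ⟨i, hi⟩ := (isRhomb_of_mem_Ex ha h.down' (hQ.mem_Ex h)).exists_mem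
  exact ⟨i, hi, hQ.notMem ha h i⟩

/-- No new tile has a corner in `lev D' (k + 1)`, so new tiles are not promoted again and only level
`k + 1` gains tiles. -/
lemma mem_Ex_cases (ha : a ≠ 0) (h : Adds o a D k p D') {l : ℕ} {Q : Fin 4 → ℂ}
    (hQ : Q ∈ Ex o a D' l) : Q ∈ Ex o a D l ∨ (l = k + 1 ∧ NewTile o a D D' k p Q) := by
  induction l generalizing Q with
  | zero => exact Or.inl hQ
  | succ l ih =>
    rcases hQ with ⟨x, hx, j, rfl⟩ | ⟨Q, hQ, hall, rfl⟩
    · rcases (h.iff _ _).1 hx with hx | ⟨rfl, rfl⟩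
      · exact Or.inl (Or.inl ⟨x, hx, j, rfl⟩)
      · exact Or.inr ⟨rfl, Or.inl ⟨j, rfl⟩⟩
    · rcases ih hQ with hQ' | ⟨rfl, hN⟩
      · by_cases hp : l = k ∧ ∃ i, Q i = p
        · obtain ⟨rfl, hp⟩ := hp
          exact Or.inr ⟨rfl, Or.inr ⟨Q, hQ', hp, hall, rfl⟩⟩
        · have hne : l = k → ∀ i, Q i ≠ p := fun h1 i h2 => hp ⟨h1, i, h2⟩
          refine Or.inl (Or.inr ⟨Q, hQ', fun i hi => ?_, h.cutSet_eq_of_notMem hne⟩)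
          rcases (h.iff _ _).1 (hall i hi) with h' | ⟨h1, h2⟩
          exacts [h', absurd h2 (hne h1 i)]
      · obtain ⟨i, hi⟩ := (isRhomb_of_mem_Ex ha h.down' hQ).exists_mem
        exact absurd (hall i hi) (hN.notMem ha h i)

/-- By `vertex` the elements at `p` come from level `k` tiles. A tile whose other acute corner is
uncut becomes a kite, one whose other acute corner is cut becomes a rhombus of level `k + 1`, and
the diamonds are the only further new tiles. -/
lemma replaceAt_eq (ha : a ≠ 0) (h : Adds o a D k p D') :
    replaceAt (mesh o a D) p (sl a k) = mesh o a D' := by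
  ext Q'
  constructor
  · rintro ((⟨⟨l, Q, hQ, hU, rfl⟩, hp⟩ | ⟨_, ⟨l, Q, hQ, hU, rfl⟩, ⟨i, hi⟩, rfl⟩) |
      ⟨u, hu, hd, rfl⟩)
    · have hne : l = k → ∀ i, Q i ≠ p := by
        rintro rfl i hi
        refine hp ⟨i, ?_⟩
        rw [cutSet_of_notMem (hi ▸ h.notMem), hi]
      refine ⟨l, Q, Ex_mono h.down' h.subset hQ, ?_, (h.cutSet_eq_of_notMem hne).symm⟩
      obtain ⟨i, hi, hn⟩ := hU
      refine ⟨i, hi, fun h' => ?_⟩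
      rcases (h.iff _ _).1 h' with h' | ⟨h1, h2⟩
      exacts [hn h', hne h1 i h2]
    · obtain ⟨rfl, hi⟩ := h.vertex ha hQ hU hi
      rw [h.cutCorner_cutSet ha hQ ⟨i, hi⟩]
      by_cases hU' : Uncut o a D' l Q
      · exact ⟨l, Q, Ex_mono h.down' h.subset hQ, hU', rfl⟩
      · refine NewTile.mem_mesh ha h (Or.inr ⟨Q, hQ, ⟨i, hi⟩, fun i' hi' => ?_, rfl⟩)
        by_contra hn
        exact hU' ⟨i', hi', hn⟩
    · have : u ∈ nbrs a k p := by rw [← h.edges_eq ha]; exact ⟨hu, hd⟩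
      obtain ⟨j, -, rfl⟩ := this
      exact NewTile.mem_mesh ha h (Or.inl ⟨j, rfl⟩)
  · rintro ⟨l, Q, hQ, ⟨i₀, hi₀, hn₀⟩, rfl⟩
    have hU : Uncut o a D l Q := ⟨i₀, hi₀, fun h' => hn₀ (h.lev_subset l h')⟩
    have hcut : Q ∈ Ex o a D k → (∃ i, Q i = p) →
        cutSet (lev D' k) Q ∈ replaceAt (mesh o a D) p (sl a k) := by
      rintro hQ ⟨i, hi⟩
      refine Or.inl (Or.inr ⟨_, ⟨k, Q, hQ, ⟨i, hi ▸ h.mem_lat, hi ▸ h.notMem⟩, rfl⟩, ⟨i, ?_⟩,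
        (h.cutCorner_cutSet ha hQ ⟨i, hi⟩).symm⟩)
      rw [cutSet_of_notMem (hi ▸ h.notMem), hi]
    rcases h.mem_Ex_cases ha hQ with hQ' | ⟨rfl, hN⟩
    · by_cases hp : l = k ∧ ∃ i, Q i = p
      · obtain ⟨rfl, hp⟩ := hp
        exact hcut hQ' hp
      · have hne : l = k → ∀ i, Q i ≠ p := fun h1 i h2 => hp ⟨h1, i, h2⟩
        rw [h.cutSet_eq_of_notMem hne]
        refine Or.inl (Or.inl ⟨⟨l, Q, hQ', hU, rfl⟩, ?_⟩)
        rintro ⟨i, hi⟩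
        obtain ⟨h1, h2⟩ := h.vertex ha hQ' hU hi
        exact hne h1 i h2
    · rw [cutSet_eq_self (hN.notMem ha h)]
      rcases hN with ⟨j, rfl⟩ | ⟨Q₀, hQ₀, ⟨i, hi⟩, -, rfl⟩
      · exact Or.inr ⟨_, h.isEdge ha j, dist_add_zeta_pow p j, rfl⟩
      · refine Or.inl (Or.inr ⟨_, ⟨k, Q₀, hQ₀, ⟨i, hi ▸ h.mem_lat, hi ▸ h.notMem⟩, rfl⟩, ⟨i, ?_⟩,
          (h.cutCorner_cutSet ha hQ₀ ⟨i, hi⟩).symm⟩)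
        rw [cutSet_of_notMem (hi ▸ h.notMem), hi]

end Adds

end

section

variable {o a : ℂ} {k : ℕ}

/-! ### Diamond-kite meshes and down-closed sets -/

open Classical in
lemma adds_insert {D : Finset (ℕ × ℂ)} (hD : IsDown o a D) {p : ℂ} (hp : p ∈ lat o a k)
    (hn : p ∉ lev D k)
    (hpred : ∀ l, k = l + 1 → ∀ q ∈ lat o a l, dist p q ≤ sl a l → q ∈ lev D l) :
    Adds o a D k p (insert (k, p) D) := by
  have hiff : ∀ l x, x ∈ lev (insert (k, p) D) l ↔ x ∈ lev D l ∨ (l = k ∧ x = p) := by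
    intro l x
    simp only [lev, Set.mem_ofPred_eq, Finset.mem_insert, Prod.mk.injEq]
    tauto
  refine ⟨hD, ⟨?_, ?_⟩, hn, hiff⟩
  · intro l x hx
    rcases (hiff _ _).1 hx with hx | ⟨rfl, rfl⟩
    exacts [hD.mem _ _ hx, hp]
  · intro l x q hx hq hd
    refine (hiff _ _).2 (Or.inl ?_)
    rcases (hiff _ _).1 hx with hx | ⟨h1, rfl⟩
    exacts [hD.down l x q hx hq hd, hpred l h1.symm q hq hd]

lemma exists_mesh_of_refines (ha : a ≠ 0) {D : Finset (ℕ × ℂ)} (hD : IsDown o a D)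
    {M : QuadMesh} (h : Refines (mesh o a D) M) :
    ∃ D', IsDown o a D' ∧ D ⊆ D' ∧ M = mesh o a D' := by
  induction h with
  | refl => exact ⟨D, hD, subset_rfl, rfl⟩
  | tail _ hstep ih =>
    obtain ⟨D', hD', hsub, rfl⟩ := ih
    obtain ⟨p, s, hr, rfl⟩ := hstep
    obtain ⟨k, rfl, hp, hn, hpred⟩ := ready_imp ha hD' hr
    have hadd := adds_insert hD' hp hn hpred
    exact ⟨_, hadd.down', hsub.trans hadd.subset, hadd.replaceAt_eq ha⟩

/-- Among the missing pairs one of least level has all its prerequisites present, so the missing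
pairs can be added one at a time. -/
lemma refines_of_subset (ha : a ≠ 0) {D D' : Finset (ℕ × ℂ)} (hD : IsDown o a D)
    (hD' : IsDown o a D') (hsub : D ⊆ D') : Refines (mesh o a D) (mesh o a D') := by
  classical
  obtain ⟨n, hn⟩ : ∃ n, (D' \ D).card = n := ⟨_, rfl⟩
  induction n generalizing D with
  | zero =>
    rw [Finset.card_eq_zero, Finset.sdiff_eq_empty_iff_subset] at hn
    rw [hsub.antisymm hn]
    exact Relation.ReflTransGen.refl
  | succ n ih =>
    have hne : (D' \ D).Nonempty := by rw [← Finset.card_pos]; omega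
    obtain ⟨⟨k, p⟩, hkp, hmin⟩ := Finset.exists_min_image (D' \ D) Prod.fst hne
    rw [Finset.mem_sdiff] at hkp
    have hadd := adds_insert (k := k) (p := p) hD (hD'.mem _ _ hkp.1) hkp.2 (by
      rintro l rfl q hq hd
      by_contra hql
      have := hmin (l, q) (Finset.mem_sdiff.2 ⟨hD'.down l p q hkp.1 hq hd, hql⟩)
      simp at this)
    refine Relation.ReflTransGen.head ⟨p, sl a k, hadd.ready ha, rfl⟩ ?_
    rw [hadd.replaceAt_eq ha]
    refine ih hadd.down' (Finset.insert_subset hkp.1 hsub) ?_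
    rw [Finset.sdiff_insert, Finset.card_erase_of_mem (Finset.mem_sdiff.2 hkp), hn]
    rfl

/-- At the first level where the sets differ, a center in one set only can be replaced in the mesh
of the other set. The meshes being equal, `ready_imp` says that it is absent from both. -/
lemma mesh_injective (ha : a ≠ 0) {D D' : Finset (ℕ × ℂ)} (hD : IsDown o a D)
    (hD' : IsDown o a D') (h : mesh o a D = mesh o a D') : D = D' := by
  have main : ∀ {D D' : Finset (ℕ × ℂ)}, IsDown o a D → IsDown o a D' →
      mesh o a D = mesh o a D' → ∀ k, (∀ l < k, lev D l = lev D' l) → lev D' k ⊆ lev D k := by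
    intro D D' hD hD' h k hl p hp
    by_contra hn
    have hadd := adds_insert hD (hD'.mem _ _ hp) hn (by
      rintro l rfl q hq hd
      rw [hl l (by omega)]
      exact hD'.down l p q hp hq hd)
    have hr := hadd.ready ha
    rw [h] at hr
    obtain ⟨k', hk', -, hn', -⟩ := ready_imp ha hD' hr
    rw [← (sl_strictAnti ha).injective hk'] at hn'
    exact hn' hp
  have hlev : ∀ k, lev D k = lev D' k := by
    intro k
    induction k using Nat.strong_induction_on with
    | _ k ih =>
      exact (main hD' hD h.symm k fun l hl => (ih l hl).symm).antisymm (main hD hD' h k ih)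
  ext ⟨k, x⟩
  change x ∈ lev D k ↔ x ∈ lev D' k
  rw [hlev]

lemma isDown_empty : IsDown o a ∅ := ⟨by simp [lev], by simp [lev]⟩

lemma exists_mesh_of_refines_rhombille (ha : a ≠ 0) {M : QuadMesh}
    (h : Refines (rhombille o a) M) : ∃ D, IsDown o a D ∧ M = mesh o a D := by
  rw [← mesh_empty ha] at h
  obtain ⟨D, hD, -, rfl⟩ := exists_mesh_of_refines ha isDown_empty h
  exact ⟨D, hD, rfl⟩

lemma refines_mesh (ha : a ≠ 0) {D : Finset (ℕ × ℂ)} (hD : IsDown o a D) :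
    Refines (rhombille o a) (mesh o a D) := by
  rw [← mesh_empty ha]
  exact refines_of_subset ha isDown_empty hD (Finset.empty_subset _)

lemma subset_of_refines (ha : a ≠ 0) {D D' : Finset (ℕ × ℂ)} (hD : IsDown o a D)
    (hD' : IsDown o a D') (h : Refines (mesh o a D) (mesh o a D')) : D ⊆ D' := by
  obtain ⟨D'', hD'', hsub, he⟩ := exists_mesh_of_refines ha hD h
  rwa [mesh_injective ha hD' hD'' he]

end

section

variable {o a : ℂ} {k : ℕ}

/-! ### Regions of tiles -/

lemma region_subset {v : Fin 4 → ℂ} {K : Set ℂ} (hK : Convex ℝ K) (hv : ∀ i, v i ∈ K) :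
    (Element.quad v).region ⊆ K := by
  apply Set.union_subset <;> refine convexHull_min ?_ hK <;>
    · rintro _ (rfl | rfl | rfl) <;> exact hv _

lemma mem_convexHull_three {s : Set ℂ} {A B C : ℂ} (hA : A ∈ s) (hB : B ∈ s) (hC : C ∈ s)
    {x y z : ℝ} (hx : 0 ≤ x) (hy : 0 ≤ y) (hz : 0 ≤ z) (h : x + y + z = 1) :
    (x * A + y * B + z * C : ℂ) ∈ convexHull ℝ s := by
  have := (convex_convexHull ℝ s).sum_mem (t := Finset.univ) (w := ![x, y, z]) (z := ![A, B, C])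
    (by intro i _; fin_cases i <;> simpa) (by simp [Fin.sum_univ_three, h])
    (by intro i _; fin_cases i <;> simp <;> exact subset_convexHull ℝ s ‹_›)
  simpa [Fin.sum_univ_three] using this

lemma convex_parallelogram (P e : ℂ) :
    Convex ℝ {z : ℂ | ∃ x y : ℝ, 0 ≤ x ∧ x ≤ 1 ∧ 0 ≤ y ∧ y ≤ 1 ∧ z = P + e * (x + y * zeta)} := by
  rintro _ ⟨x, y, hx, hx', hy, hy', rfl⟩ _ ⟨u, v, hu, hu', hv, hv', rfl⟩ s t hs ht hst
  refine ⟨s * x + t * u, s * y + t * v, by positivity, by nlinarith, by positivity, by nlinarith, ?_⟩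
  have : (s : ℂ) + t = 1 := by exact_mod_cast hst
  simp only [Complex.real_smul]
  push_cast
  linear_combination P * this

lemma Corner.exists_coords {Q : Fin 4 → ℂ} {i : Fin 4} {j : ℕ} (h : Corner a k Q i j) {z : ℂ}
    (hz : z ∈ (Element.quad Q).region) :
    ∃ x y : ℝ, 0 ≤ x ∧ x ≤ 1 ∧ 0 ≤ y ∧ y ≤ 1 ∧ z = Q i + av a k * zeta ^ j * (x + y * zeta) := by
  refine region_subset (convex_parallelogram (Q i) (av a k * zeta ^ j)) (fun l => ?_) hz
  rcases fin_four_cases i l with rfl | rfl | rfl | rfl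
  · exact ⟨0, 0, by simp⟩
  · exact ⟨1, 0, by simp [h.one]⟩
  · exact ⟨1, 1, by simp [h.two, theta]⟩
  · exact ⟨0, 1, by simp [h.three]⟩

/-- In the coordinates `x, y` the kite has corners `(1/3, 1/3)`, `(1, 0)`, `(1, 1)`, `(0, 1)`, and
the four inequalities are its sides. `region` splits it along the line `x = y` or along `x + y = 1`,
according to the parity of `i`, so both splittings are prepared. -/
lemma mem_kite {v : Fin 4 → ℂ} {i : Fin 4} {P e : ℂ} (h0 : v i = P + e * theta / 3)
    (h1 : v (i + 1) = P + e) (h2 : v (i + 2) = P + e * theta) (h3 : v (i + 3) = P + e * zeta)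
    {x y : ℝ} (hx : x ≤ 1) (hy : y ≤ 1) (hxy : 1 ≤ x + 2 * y) (hyx : 1 ≤ 2 * x + y) :
    P + e * (x + y * zeta) ∈ (Element.quad v).region := by
  have A1 : y ≤ x → ∀ s : Set ℂ, v i ∈ s → v (i + 1) ∈ s → v (i + 2) ∈ s →
      P + e * (x + y * zeta) ∈ convexHull ℝ s := by
    intro hle s m0 m1 m2
    convert mem_convexHull_three m0 m1 m2 (x := 3 / 2 * (1 - x)) (y := x - y)
      (z := (2 * y + x - 1) / 2) (by linarith) (by linarith) (by linarith) (by ring) using 1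
    rw [h0, h1, h2, theta]; push_cast; ring
  have A2 : x ≤ y → ∀ s : Set ℂ, v i ∈ s → v (i + 3) ∈ s → v (i + 2) ∈ s →
      P + e * (x + y * zeta) ∈ convexHull ℝ s := by
    intro hle s m0 m1 m2
    convert mem_convexHull_three m0 m1 m2 (x := 3 / 2 * (1 - y)) (y := y - x)
      (z := (2 * x + y - 1) / 2) (by linarith) (by linarith) (by linarith) (by ring) using 1
    rw [h0, h3, h2, theta]; push_cast; ring
  have B1 : 1 ≤ x + y → ∀ s : Set ℂ, v (i + 1) ∈ s → v (i + 2) ∈ s → v (i + 3) ∈ s →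
      P + e * (x + y * zeta) ∈ convexHull ℝ s := by
    intro hle s m0 m1 m2
    convert mem_convexHull_three m0 m1 m2 (x := 1 - y) (y := x + y - 1)
      (z := 1 - x) (by linarith) (by linarith) (by linarith) (by ring) using 1
    rw [h1, h2, h3, theta]; push_cast; ring
  have B2 : x + y ≤ 1 → ∀ s : Set ℂ, v i ∈ s → v (i + 1) ∈ s → v (i + 3) ∈ s →
      P + e * (x + y * zeta) ∈ convexHull ℝ s := by
    intro hle s m0 m1 m2
    convert mem_convexHull_three m0 m1 m2 (x := 3 * (1 - x - y)) (y := 2 * x + y - 1)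
      (z := x + 2 * y - 1) (by linarith) (by linarith) (by linarith) (by ring) using 1
    rw [h0, h1, h3, theta]; push_cast; ring
  clear h0 h1 h2 h3
  unfold Element.region
  fin_cases i <;> simp only [Fin.zero_eta, Fin.mk_one, Fin.reduceFinMk, Fin.isValue, zero_add,
    Fin.reduceAdd] at A1 A2 B1 B2
  · rcases le_total x y with hle | hle
    · exact Or.inr (A2 hle _ (by simp) (by simp) (by simp))
    · exact Or.inl (A1 hle _ (by simp) (by simp) (by simp))
  · rcases le_total (x + y) 1 with hs | hs
    · exact Or.inl (B2 hs _ (by simp) (by simp) (by simp))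
    · exact Or.inr (B1 hs _ (by simp) (by simp) (by simp))
  · rcases le_total x y with hle | hle
    · exact Or.inl (A2 hle _ (by simp) (by simp) (by simp))
    · exact Or.inr (A1 hle _ (by simp) (by simp) (by simp))
  · rcases le_total (x + y) 1 with hs | hs
    · exact Or.inr (B2 hs _ (by simp) (by simp) (by simp))
    · exact Or.inl (B1 hs _ (by simp) (by simp) (by simp))

lemma Corner.mem_kite (ha : a ≠ 0) {Q : Fin 4 → ℂ} {i : Fin 4} {j : ℕ} {S : Set ℂ}
    (hS : S ⊆ lat o a k) (hi : Q i ∈ lat o a k) (h : Corner a k Q i j) (h0 : Q i ∈ S)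
    (h2 : Q (i + 2) ∉ S) {x y : ℝ} (hx : x ≤ 1) (hy : y ≤ 1) (hxy : 1 ≤ x + 2 * y)
    (hyx : 1 ≤ 2 * x + y) :
    Q i + av a k * zeta ^ j * (x + y * zeta) ∈ (Element.quad (cutSet S Q)).region := by
  refine DiamondKite.mem_kite ?_ ?_ ?_ ?_ hx hy hxy hyx (i := i)
  · rw [cutSet_of_mem h0, cen, fin_four_sub_one, h.one, h.three, theta]; ring
  · rw [cutSet_of_notMem fun h' => h.one_notMem ha hi (hS h'), h.one]
  · rw [cutSet_of_notMem h2, h.two]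
  · rw [cutSet_of_notMem fun h' => h.three_notMem ha hi (hS h'), h.three]

lemma sl_eq_two (a : ℂ) (k : ℕ) : sl a k ≤ 2 * sl a (k + 1) := by
  have := sl_nonneg a (k + 1)
  rw [sl_succ a k]
  nlinarith [sqrt_three_lt]

/-- Every point of an element is close to one of its uncut acute corners. -/
lemma exists_uncut_near (ha : a ≠ 0) {Q : Fin 4 → ℂ} {S : Set ℂ} (hQ : IsRhomb o a k Q)
    (hS : S ⊆ lat o a k) (hU : ∃ i, Q i ∈ lat o a k ∧ Q i ∉ S) {z : ℂ}
    (hz : z ∈ (Element.quad (cutSet S Q)).region) :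
    ∃ i, Q i ∈ lat o a k ∧ Q i ∉ S ∧ dist z (Q i) ≤ 2 * sl a (k + 1) := by
  obtain ⟨i, hi, hn⟩ := hU
  obtain ⟨j, hj⟩ := hQ.corner ha hi
  have n1 := hj.one_notMem ha hi
  have n3 := hj.three_notMem ha hi
  by_cases h2 : Q (i + 2) ∈ S
  · refine ⟨i, hi, hn, ?_⟩
    refine region_subset (convex_closedBall (Q i) (2 * sl a (k + 1))) (fun l => ?_) hz
    rw [Metric.mem_closedBall, dist_comm]
    rcases fin_four_cases i l with rfl | rfl | rfl | rfl
    · rw [cutSet_of_notMem hn, dist_self]; linarith [sl_nonneg a (k + 1)]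
    · rw [cutSet_of_notMem fun h' => n1 (hS h'), hj.dist_one]; exact sl_eq_two a k
    -- The long diagonal is `3 · sl a (k + 1)`, and the centroid lies two thirds of the way along
    -- it. This is the source of the constant `2`.
    · rw [cutSet_of_mem h2, hj.opp.cen_eq, hj.two, ← av_succ a k, add_assoc, dist_self_add_right,
        show av a (k + 1) * theta * zeta ^ j * theta + av a (k + 1) * zeta ^ (j + 3 + 1) =
          av a (k + 1) * zeta ^ (j + 1) * 2 by
            rw [show j + 3 + 1 = j + 1 + 3 by ring, zeta_pow_add_three]
            linear_combination av a (k + 1) * zeta ^ j * theta_sq]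
      rw [norm_mul, norm_mul, norm_pow, norm_zeta, one_pow, mul_one, ← sl]
      norm_num
      linarith
    · rw [cutSet_of_notMem fun h' => n3 (hS h'), hj.dist_three]; exact sl_eq_two a k
  · have hcut : cutSet S Q = Q := by
      refine cutSet_eq_self fun l => ?_
      rcases fin_four_cases i l with rfl | rfl | rfl | rfl
      exacts [hn, fun h' => n1 (hS h'), h2, fun h' => n3 (hS h')]
    rw [hcut] at hz
    obtain ⟨x, y, hx, hx', hy, hy', rfl⟩ := hj.exists_coords hz
    have key : ∀ u v : ℝ, 0 ≤ u → 0 ≤ v → u + v ≤ 1 → ‖(u + v * zeta : ℂ)‖ ≤ 1 := by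
      intro u v hu hv huv
      have := norm_add_mul_zeta_sq u v
      rw [← sq_le_one_iff₀ (norm_nonneg _), this]
      nlinarith
    -- The short diagonal cuts the rhombus into two equilateral triangles; the near corner is the
    -- acute one in the same triangle.
    rcases le_total (x + y) 1 with hs | hs
    · refine ⟨i, hi, hn, le_trans ?_ (sl_eq_two a k)⟩
      rw [dist_comm, dist_self_add_right, norm_mul, norm_mul, norm_pow, norm_zeta, one_pow,
        mul_one, ← sl]
      exact mul_le_of_le_one_right (sl_nonneg a k) (key x y hx hy hs)
    · refine ⟨i + 2, hj.two_mem hi, h2, le_trans ?_ (sl_eq_two a k)⟩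
      have := key (1 - x) (1 - y) (by linarith) (by linarith) (by linarith)
      rw [hj.two, dist_add_left, dist_eq_norm, ← norm_neg,
        show -(av a k * zeta ^ j * (x + y * zeta) - av a k * zeta ^ j * theta) =
          av a k * zeta ^ j * (((1 - x : ℝ) : ℂ) + ((1 - y : ℝ) : ℂ) * zeta) by
            unfold theta; push_cast; ring, norm_mul, norm_mul, norm_pow, norm_zeta, one_pow,
        mul_one, ← sl]
      exact mul_le_of_le_one_right (sl_nonneg a k) this

/-! ### Obeying a size function -/

lemma dist_cutSet_le (ha : a ≠ 0) {Q : Fin 4 → ℂ} {S : Set ℂ} (hQ : IsRhomb o a k Q)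
    (hS : S ⊆ lat o a k) (i : Fin 4) :
    dist (cutSet S Q i) (cutSet S Q (i + 1)) ≤ sl a k := by
  have key : ∀ i l, Q i ∈ lat o a k → (l = i + 1 ∨ l = i + 3) →
      dist (cutSet S Q i) (cutSet S Q l) ≤ sl a k := by
    intro i l hi hl
    obtain ⟨j, hj⟩ := hQ.corner ha hi
    have hln : Q l ∉ S := by
      rcases hl with rfl | rfl
      exacts [fun h => hj.one_notMem ha hi (hS h), fun h => hj.three_notMem ha hi (hS h)]
    rw [cutSet_of_notMem hln]
    by_cases hm : Q i ∈ S
    · rw [cutSet_of_mem hm, dist_comm]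
      refine le_trans ?_ (sl_succ_lt ha k).le
      rcases hl with rfl | rfl
      exacts [hj.dist_one_cen.le, hj.dist_three_cen.le]
    · rw [cutSet_of_notMem hm]
      rcases hl with rfl | rfl
      exacts [hj.dist_one.le, hj.dist_three.le]
  rcases hQ.or_succ i with h | h
  · exact key _ _ h (Or.inl rfl)
  · rw [dist_comm]
    exact key _ _ h (Or.inr (fin_four_add_one_three i).symm)

/-- An uncut acute corner keeps its two sides of full length `sl a k`, and cutting never lengthens a
side, so `sl a k` is the longest side. -/
lemma obeysSize_mesh_iff (ha : a ≠ 0) {D : Finset (ℕ × ℂ)} (hD : IsDown o a D) {Ω : Set ℂ}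
    {σ : ℂ → ℝ} : ObeysSize (mesh o a D) Ω σ ↔ ∀ k, ∀ Q ∈ Ex o a D k, Uncut o a D k Q →
      ∀ z ∈ (Element.quad (cutSet (lev D k) Q)).region ∩ Ω, sl a k ≤ σ z := by
  constructor
  · intro h k Q hQ hU z hz
    have hU' := hU
    obtain ⟨i, hi, hn⟩ := hU
    obtain ⟨j, hj⟩ := (isRhomb_of_mem_Ex ha hD hQ).corner ha hi
    have := h _ ⟨k, Q, hQ, hU', rfl⟩ z hz _ _ ⟨i, Or.inl ⟨rfl, rfl⟩⟩
    rwa [cutSet_of_notMem hn, cutSet_of_notMem fun h' => hj.one_notMem ha hi (hD.mem _ _ h'),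
      hj.dist_one] at this
  · rintro h _ ⟨k, Q, hQ, hU, rfl⟩ z hz x y ⟨i, hi⟩
    refine le_trans ?_ (h k Q hQ hU z hz)
    have := dist_cutSet_le ha (isRhomb_of_mem_Ex ha hD hQ) (hD.lev_subset k) i
    rcases hi with ⟨rfl, rfl⟩ | ⟨rfl, rfl⟩
    · exact this
    · rwa [dist_comm]

open Classical in
lemma IsDown.inter {D D' : Finset (ℕ × ℂ)} (hD : IsDown o a D) (hD' : IsDown o a D') :
    IsDown o a (D ∩ D') := by
  refine ⟨fun k x hx => hD.mem k x (Finset.mem_inter.1 hx).1, fun k x q hx hq hd => ?_⟩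
  exact Finset.mem_inter.2 ⟨hD.down k x q (Finset.mem_inter.1 hx).1 hq hd,
    hD'.down k x q (Finset.mem_inter.1 hx).2 hq hd⟩

/-- A tile whose corner `i` is cut in `S₁` only and whose opposite corner is cut in `S₂` only is
the union of the two kites. -/
lemma region_subset_union (ha : a ≠ 0) {Q : Fin 4 → ℂ} {S₁ S₂ : Set ℂ} (hQ : IsRhomb o a k Q)
    (hS₁ : S₁ ⊆ lat o a k) (hS₂ : S₂ ⊆ lat o a k) {i : Fin 4} (h1 : Q i ∈ S₁)
    (h1' : Q (i + 2) ∉ S₁) (h2 : Q i ∉ S₂) (h2' : Q (i + 2) ∈ S₂) :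
    (Element.quad Q).region ⊆
      (Element.quad (cutSet S₁ Q)).region ∪ (Element.quad (cutSet S₂ Q)).region := by
  intro z hz
  have hi := hS₁ h1
  obtain ⟨j, hj⟩ := hQ.corner ha hi
  obtain ⟨x, y, hx, hx', hy, hy', rfl⟩ := hj.exists_coords hz
  -- Cutting a corner leaves the half of the rhombus beyond the short diagonal intact.
  rcases le_total 1 (x + y) with hs | hs
  · exact Or.inl (hj.mem_kite ha hS₁ hi h1 h1' hx' hy' (by linarith) (by linarith))
  · right
    have := hj.opp.mem_kite ha hS₂ (hj.two_mem hi) h2' (by rwa [fin_four_add_two_two])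
      (x := 1 - x) (y := 1 - y) (by linarith) (by linarith) (by linarith) (by linarith)
    convert this using 1
    rw [hj.two, zeta_pow_add_three, theta]
    push_cast; ring

open Classical in
-- Only the acute corners of a tile can be cut. If its pattern of cuts for the intersection is that
-- of `D₁` or of `D₂`, the element belongs to that mesh. Otherwise opposite corners are cut, one in
-- `D₁` only and one in `D₂` only, and the two kites cover the uncut rhombus.
lemma obeysSize_inter (ha : a ≠ 0) {D₁ D₂ : Finset (ℕ × ℂ)} (hD₁ : IsDown o a D₁)
    (hD₂ : IsDown o a D₂) {Ω : Set ℂ} {σ : ℂ → ℝ} (h₁ : ObeysSize (mesh o a D₁) Ω σ)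
    (h₂ : ObeysSize (mesh o a D₂) Ω σ) : ObeysSize (mesh o a (D₁ ∩ D₂)) Ω σ := by
  rw [obeysSize_mesh_iff ha (hD₁.inter hD₂)]
  rw [obeysSize_mesh_iff ha hD₁] at h₁
  rw [obeysSize_mesh_iff ha hD₂] at h₂
  rintro k Q hQ ⟨i, hi, hn⟩ z ⟨hz, hzΩ⟩
  have hR := isRhomb_of_mem_Ex ha (hD₁.inter hD₂) hQ
  have hQ₁ : Q ∈ Ex o a D₁ k := Ex_mono hD₁ Finset.inter_subset_left hQ
  have hQ₂ : Q ∈ Ex o a D₂ k := Ex_mono hD₂ Finset.inter_subset_right hQ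
  have hlev : ∀ x, x ∈ lev (D₁ ∩ D₂) k ↔ x ∈ lev D₁ k ∧ x ∈ lev D₂ k := fun x =>
    Finset.mem_inter
  obtain ⟨j, hj⟩ := hR.corner ha hi
  have n1 := hj.one_notMem ha hi
  have n3 := hj.three_notMem ha hi
  have h2 := hj.two_mem hi
  have hcongr : ∀ S : Set ℂ, S ⊆ lat o a k → (Q i ∈ lev (D₁ ∩ D₂) k ↔ Q i ∈ S) →
      (Q (i + 2) ∈ lev (D₁ ∩ D₂) k ↔ Q (i + 2) ∈ S) → cutSet (lev (D₁ ∩ D₂) k) Q = cutSet S Q := by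
    intro S hS e0 e2
    refine cutSet_congr fun l => ?_
    rcases fin_four_cases i l with rfl | rfl | rfl | rfl
    · exact e0
    · exact ⟨fun h => absurd ((hD₁.inter hD₂).mem _ _ h) n1, fun h => absurd (hS h) n1⟩
    · exact e2
    · exact ⟨fun h => absurd ((hD₁.inter hD₂).mem _ _ h) n3, fun h => absurd (hS h) n3⟩
  have hS₁ := hD₁.lev_subset k
  have hS₂ := hD₂.lev_subset k
  by_cases a1 : Q i ∈ lev D₁ k <;> by_cases b1 : Q (i + 2) ∈ lev D₁ k <;>
    by_cases a2 : Q i ∈ lev D₂ k <;> by_cases b2 : Q (i + 2) ∈ lev D₂ k <;>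
    simp only [hlev, a1, b1, a2, b2, not_true_eq_false, and_self, and_true, and_false,
      not_false_eq_true, true_iff, false_iff] at hn hcongr <;>
    first
    | (rw [hcongr _ hS₂ (by tauto) (by tauto)] at hz
       exact h₂ k Q hQ₂ ⟨i, hi, by tauto⟩ z ⟨hz, hzΩ⟩)
    | (rw [hcongr _ hS₁ (by tauto) (by tauto)] at hz
       exact h₁ k Q hQ₁ ⟨i, hi, by tauto⟩ z ⟨hz, hzΩ⟩)
    | (rw [hcongr ∅ (Set.empty_subset _) (by simp) (by simp), cutSet_eq_self (by simp)] at hz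
       first
       | (rcases region_subset_union ha hR hS₁ hS₂ a1 b1 a2 b2 hz with hz | hz
          · exact h₁ k Q hQ₁ ⟨_, h2, b1⟩ z ⟨hz, hzΩ⟩
          · exact h₂ k Q hQ₂ ⟨i, hi, a2⟩ z ⟨hz, hzΩ⟩)
       | (rcases region_subset_union ha hR hS₂ hS₁ a2 b2 a1 b1 hz with hz | hz
          · exact h₂ k Q hQ₂ ⟨_, h2, b2⟩ z ⟨hz, hzΩ⟩
          · exact h₁ k Q hQ₁ ⟨i, hi, a1⟩ z ⟨hz, hzΩ⟩))

end

section

variable {o a : ℂ} {k : ℕ}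

/-! ### Packing -/

/-- The disjoint discs fit into one disc of radius `R + r`; compare areas. -/
lemma packing_finset {ι : Type*} (S : Finset ι) (c : ι → ℂ) {z : ℂ} {r R : ℝ} (hr : 0 < r)
    (hR : ∀ i ∈ S, dist (c i) z ≤ R)
    (hd : ∀ i ∈ S, ∀ j ∈ S, i ≠ j → Disjoint (Metric.ball (c i) r) (Metric.ball (c j) r)) :
    (S.card : ℝ) ≤ ((R + r) / r) ^ 2 := by
  rcases S.eq_empty_or_nonempty with rfl | ⟨i₀, hi₀⟩
  · simp; positivity
  have hR0 : 0 ≤ R := dist_nonneg.trans (hR i₀ hi₀)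
  have h1 : MeasureTheory.volume (⋃ i ∈ S, Metric.ball (c i) r) =
      ∑ i ∈ S, MeasureTheory.volume (Metric.ball (c i) r) := by
    apply MeasureTheory.measure_biUnion_finset
    · intro i hi j hj hij
      exact hd i hi j hj hij
    · intro i _
      exact measurableSet_ball
  have h2 : (⋃ i ∈ S, Metric.ball (c i) r) ⊆ Metric.ball z (R + r) := by
    refine Set.iUnion₂_subset fun i hi => Metric.ball_subset_ball' ?_
    linarith [hR i hi]
  have h3 := MeasureTheory.measure_mono (μ := MeasureTheory.volume) h2
  rw [h1] at h3
  simp only [Complex.volume_ball, Finset.sum_const, nsmul_eq_mul] at h3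
  have h4 := ENNReal.toReal_mono (by finiteness) h3
  simp only [ENNReal.toReal_mul, ENNReal.toReal_natCast, ENNReal.toReal_pow,
    ENNReal.toReal_ofReal hr.le, ENNReal.toReal_ofReal (add_nonneg hR0 hr.le),
    ENNReal.coe_toReal, NNReal.coe_real_pi] at h4
  rw [div_pow, le_div_iff₀ (by positivity)]
  have hpi := Real.pi_pos
  nlinarith

lemma packing {ι : Type*} (S : Set ι) (c : ι → ℂ) {z : ℂ} {r R : ℝ} (hr : 0 < r)
    (hR : ∀ i ∈ S, dist (c i) z ≤ R)
    (hd : ∀ i ∈ S, ∀ j ∈ S, i ≠ j → Disjoint (Metric.ball (c i) r) (Metric.ball (c j) r)) :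
    S.Finite ∧ (S.ncard : ℝ) ≤ ((R + r) / r) ^ 2 := by
  have hfin : S.Finite := by
    by_contra hinf
    obtain ⟨N, hN⟩ := exists_nat_gt (((R + r) / r) ^ 2)
    obtain ⟨T, hTS, hT⟩ := Set.Infinite.exists_subset_card_eq hinf N
    have := packing_finset T c hr (fun i hi => hR i (hTS hi))
      fun i hi j hj => hd i (hTS hi) j (hTS hj)
    rw [hT] at this
    linarith
  refine ⟨hfin, ?_⟩
  rw [Set.ncard_eq_toFinset_card S hfin]
  exact packing_finset _ c hr (fun i hi => hR i (by simpa using hi))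
    fun i hi j hj => hd i (by simpa using hi) j (by simpa using hj)

/-! ### Gradation -/

/-- Of three equal vectors at mutual angles of `120°`, one is within `60°` of `w`, and subtracting
it does not lengthen `w` as long as it is no longer than `w`. -/
lemma exists_norm_sub_le (w v : ℂ) (h : ‖v‖ ≤ ‖w‖) : ∃ m : ℕ, ‖w - v * zeta ^ (2 * m)‖ ≤ ‖w‖ := by
  by_contra! hcon
  have h3 := sqrt_three_sq
  have e0 := hcon 0
  have e1 := hcon 1
  have e2 := hcon 2
  have e4 : zeta ^ 4 = -zeta := by linear_combination zeta * zeta_cube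
  simp only [mul_zero, pow_zero, mul_one, Nat.reduceMul, zeta_sq, e4] at e0 e1 e2
  rw [← sq_lt_sq₀ (norm_nonneg _) (norm_nonneg _), ← Complex.normSq_eq_norm_sq,
    ← Complex.normSq_eq_norm_sq] at e0 e1 e2
  rw [← sq_le_sq₀ (norm_nonneg _) (norm_nonneg _), ← Complex.normSq_eq_norm_sq,
    ← Complex.normSq_eq_norm_sq] at h
  simp only [Complex.normSq_apply, Complex.sub_re, Complex.sub_im, Complex.mul_re, Complex.mul_im,
    zeta, Complex.neg_re, Complex.neg_im, Complex.one_re, Complex.one_im] at e0 e1 e2 h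
  set s := Real.sqrt 3
  obtain ⟨p, q⟩ := w
  obtain ⟨x, y⟩ := v
  simp only at e0 e1 e2 h
  set T := (x * x + y * y) / 2 with hT
  have f0 : 0 < T - (p * x + q * y) := by rw [hT]; nlinarith
  have f1 : 0 < T - (p * (-x / 2 - s / 2 * y) + q * (s / 2 * x - y / 2)) := by
    rw [hT]; nlinarith
  have f2 : 0 < T - (p * (-x / 2 + s / 2 * y) + q * (-s / 2 * x - y / 2)) := by
    rw [hT]; nlinarith
  have g0 := mul_pos f0 f1
  have g1 := mul_pos f1 f2
  have g2 := mul_pos f2 f0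
  -- If all three differences were longer than `w`, these three factors would be positive, yet the
  -- sum of their pairwise products is at most zero because `‖v‖ ≤ ‖w‖`.
  have key : (T - (p * x + q * y)) * (T - (p * (-x / 2 - s / 2 * y) + q * (s / 2 * x - y / 2))) +
      (T - (p * (-x / 2 - s / 2 * y) + q * (s / 2 * x - y / 2))) *
        (T - (p * (-x / 2 + s / 2 * y) + q * (-s / 2 * x - y / 2))) +
      (T - (p * (-x / 2 + s / 2 * y) + q * (-s / 2 * x - y / 2))) * (T - (p * x + q * y)) =
      3 / 4 * (x * x + y * y) * ((x * x + y * y) - (p * p + q * q)) := by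
    rw [hT]
    linear_combination (-1 / 4 * (p * y - q * x) ^ 2) * h3
  have : 0 ≤ x * x + y * y := add_nonneg (mul_self_nonneg x) (mul_self_nonneg y)
  nlinarith

/-- Descend through prerequisites without moving away from `y`: if `y` is within `sl a j` it is
itself a prerequisite, and otherwise some prerequisite is no farther from `y` than `x`. At level `k`
the lattice spacing forces the center reached to be `y`. -/
lemma IsDown.descent {D : Finset (ℕ × ℂ)} (hD : IsDown o a D) {j : ℕ} (hkj : k ≤ j)
    {x y : ℂ} (hx : x ∈ lev D j) (hy : y ∈ lat o a k) (hd : dist x y < Real.sqrt 3 * sl a k) :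
    y ∈ lev D k := by
  induction j, hkj using Nat.le_induction generalizing x with
  | base => rwa [← lat_separated (hD.mem _ _ hx) hy hd]
  | succ j hj ih =>
    have hyj := lat_mono hj hy
    rcases le_or_gt (dist x y) (sl a j) with h | h
    · exact hD.self_down hj (hD.down j x y hx hyj h) hy
    · obtain ⟨q, hq, hxq, hqy⟩ : ∃ q ∈ lat o a j, dist x q ≤ sl a j ∧ dist q y ≤ dist x y := by
        rcases exists_neighbors (hD.mem _ _ hx) with hxl | ⟨i, hi⟩
        · exact ⟨x, hxl, by rw [dist_self]; exact sl_nonneg _ _, le_rfl⟩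
        · obtain ⟨m, hm⟩ := exists_norm_sub_le (y - x) (av a j * zeta ^ i) (by
            rw [norm_mul, norm_pow, norm_zeta, one_pow, mul_one, ← sl, ← dist_eq_norm, dist_comm]
            exact h.le)
          refine ⟨_, hi m, (dist_add_zeta_pow x _).le, ?_⟩
          rw [dist_comm, dist_eq_norm, dist_comm x, dist_eq_norm y x]
          rwa [show y - (x + av a j * zeta ^ (i + 2 * m)) =
            y - x - av a j * zeta ^ i * zeta ^ (2 * m) by ring]
      exact ih (hD.down j x q hx hq hxq) (hqy.trans_lt hd)

/-! ### Elements located by an uncut acute corner -/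

/-- `Q'` is an element of the mesh of level `k` with uncut acute corner `y` near `z`. -/
structure IsElt (o a : ℂ) (D : Finset (ℕ × ℂ)) (k : ℕ) (y z : ℂ) (Q' : Fin 4 → ℂ) : Prop where
  mem : y ∈ lat o a k
  notMem : y ∉ lev D k
  near : dist z y ≤ 2 * sl a (k + 1)
  exists_tile : ∃ Q ∈ Ex o a D k, ∃ i, Q i = y ∧ Q' = cutSet (lev D k) Q

lemma exists_isElt (ha : a ≠ 0) {D : Finset (ℕ × ℂ)} (hD : IsDown o a D) {Q' : Fin 4 → ℂ}
    (hQ' : Q' ∈ mesh o a D) {z : ℂ} (hz : z ∈ (Element.quad Q').region) :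
    ∃ k y, IsElt o a D k y z Q' := by
  obtain ⟨k, Q, hQ, hU, rfl⟩ := hQ'
  obtain ⟨i, hi, hn, hd⟩ :=
    exists_uncut_near ha (isRhomb_of_mem_Ex ha hD hQ) (hD.lev_subset k) hU hz
  exact ⟨k, Q i, hi, hn, hd, Q, hQ, i, rfl, rfl⟩

lemma IsElt.exists_pred (ha : a ≠ 0) {D : Finset (ℕ × ℂ)} (hD : IsDown o a D) {y z : ℂ}
    {Q' : Fin 4 → ℂ} (h : IsElt o a D (k + 1) y z Q') : ∃ x ∈ lev D k, dist x y ≤ sl a k := by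
  obtain ⟨Q, hQ, i, rfl, -⟩ := h.exists_tile
  exact exists_pred_acute ha hD hQ h.mem

lemma sl_antitone (ha : a ≠ 0) : Antitone (sl a) := (sl_strictAnti ha).antitone

/-- A much finer nearby element comes from a replacement that is closer than `√3 · sl a k` to `y`,
and then `descent` would cut the corner `y`. With a level difference of at least five the distances
add up to less than that. -/
lemma IsElt.gap (ha : a ≠ 0) {D : Finset (ℕ × ℂ)} (hD : IsDown o a D) {k' : ℕ} {y z y' z' : ℂ}
    {Q Q' : Fin 4 → ℂ} (h : IsElt o a D k y z Q) (h' : IsElt o a D k' y' z' Q')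
    (hd : dist z z' ≤ sl a k / 4) : k' ≤ k + 4 := by
  by_contra! hk
  obtain ⟨m, rfl⟩ : ∃ m, k' = m + 1 := ⟨k' - 1, by omega⟩
  obtain ⟨x, hx, hxy⟩ := h'.exists_pred ha hD
  refine h.notMem (hD.descent (by omega) hx h.mem ?_)
  have hm : sl a m ≤ sl a (k + 4) := sl_antitone ha (by omega)
  have hm1 : sl a (m + 2) ≤ sl a (k + 5) := sl_antitone ha (by omega)
  have e1 := sl_succ_succ a k
  have e2 := sl_succ_succ a (k + 2)
  have e3 := sl_succ_succ a (k + 1)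
  have e4 := sl_succ_succ a (k + 3)
  have e5 := sl_succ a k
  have hp := sl_pos ha (k + 1)
  have n1 := h.near
  have n2 := h'.near
  have t1 := dist_triangle x y' y
  have t2 := dist_triangle y' z' y
  have t3 := dist_triangle z' z y
  rw [dist_comm y' z'] at t2
  rw [dist_comm z' z] at t3
  have e6 : Real.sqrt 3 * sl a k = 3 * sl a (k + 1) := by
    rw [e5, ← mul_assoc, ← pow_two, sqrt_three_sq]
  have e7 : sl a k ≤ 1.74 * sl a (k + 1) := by
    rw [e5]; nlinarith [sqrt_three_lt]
  rw [e6]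
  linarith

/-- At one level this is the lattice spacing. At different levels the finer element comes from a
replacement within `sl a k` of its corner, and `1 + 2 / 3 < √3` lets `descent` cut the coarser
corner. -/
lemma IsElt.separated (ha : a ≠ 0) {D : Finset (ℕ × ℂ)} (hD : IsDown o a D) {k' : ℕ}
    {y z y' z' : ℂ} {Q Q' : Fin 4 → ℂ} (h : IsElt o a D k y z Q) (h' : IsElt o a D k' y' z' Q')
    (hne : (k, y) ≠ (k', y')) : 2 / 3 * sl a k ≤ dist y y' := by
  have s3 := sqrt_three_gt
  have key : ∀ {k k' : ℕ} {y z y' z' : ℂ} {Q Q' : Fin 4 → ℂ}, IsElt o a D k y z Q →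
      IsElt o a D k' y' z' Q' → k < k' → 2 / 3 * sl a k ≤ dist y y' := by
    intro k k' y z y' z' Q Q' h h' hk
    by_contra! hlt
    obtain ⟨m, rfl⟩ : ∃ m, k' = m + 1 := ⟨k' - 1, by omega⟩
    obtain ⟨x, hx, hxy⟩ := h'.exists_pred ha hD
    refine h.notMem (hD.descent (by omega) hx h.mem ?_)
    have hm : sl a m ≤ sl a k := sl_antitone ha (by omega)
    have := dist_triangle_right x y y'
    nlinarith [sl_pos ha k]
  rcases lt_trichotomy k k' with hk | rfl | hk
  · exact key h h' hk
  · by_contra! hlt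
    refine hne ?_
    rw [lat_separated h.mem h'.mem]
    nlinarith [sl_pos ha k]
  · rw [dist_comm]
    refine le_trans ?_ (key h' h hk)
    have := sl_antitone ha hk.le
    linarith

/-- An uncut corner is shared by at most `4 · 6` listed elements, one for each position in the list
and each direction. This is the factor `24` in the counts. -/
lemma IsElt.eq_rho (ha : a ≠ 0) {D : Finset (ℕ × ℂ)} (hD : IsDown o a D) {y z : ℂ}
    {Q' : Fin 4 → ℂ} (h : IsElt o a D k y z Q') : ∃ (i : Fin 4) (j : Fin 6),
      Q' = cutSet (lev D k) fun l => rho y (av a k * zeta ^ (j : ℕ)) (l - i) := by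
  obtain ⟨Q, hQ, i, rfl, rfl⟩ := h.exists_tile
  obtain ⟨j, hj⟩ := (isRhomb_of_mem_Ex ha hD hQ).corner ha h.mem
  refine ⟨i, ⟨j % 6, Nat.mod_lt _ (by norm_num)⟩, ?_⟩
  have e : zeta ^ j = zeta ^ (j % 6) := by
    conv_lhs => rw [← Nat.mod_add_div j 6, zeta_pow_add_six_mul]
  congr 1
  funext l
  obtain ⟨m, rfl⟩ : ∃ m, l = i + m := ⟨l - i, by abel⟩
  simp only [add_sub_cancel_left, ← e]
  fin_cases m
  · simp [rho]
  · exact hj.one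
  · exact hj.two
  · exact hj.three

/-- Counting the elements of a bounded part of the mesh that are not too small. -/
lemma ncard_elements_le (ha : a ≠ 0) {D : Finset (ℕ × ℂ)} (hD : IsDown o a D)
    {S : Set (Fin 4 → ℂ)} {r R : ℝ} {w : ℂ} (hr : 0 < r)
    (hS : ∀ Q ∈ S, ∃ k y z, IsElt o a D k y z Q ∧ r ≤ sl a k ∧ dist y w ≤ R) :
    S.Finite ∧ (S.ncard : ℝ) ≤ 24 * (3 * R / r + 1) ^ 2 := by
  set K : Set (ℕ × ℂ) := {q | ∃ Q z, IsElt o a D q.1 q.2 z Q ∧ r ≤ sl a q.1 ∧ dist q.2 w ≤ R}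
  have hK : K.Finite ∧ (K.ncard : ℝ) ≤ ((R + r / 3) / (r / 3)) ^ 2 := by
    refine packing K Prod.snd (z := w) (by positivity) (fun q hq => ?_) ?_
    · obtain ⟨Q, z, -, -, h⟩ := hq
      exact h
    · rintro q ⟨Q, z, h, hrq, -⟩ q' ⟨Q', z', h', -, -⟩ hne
      refine Metric.ball_disjoint_ball ?_
      have := h.separated ha hD h' (by simpa using hne)
      linarith
  set g : (ℕ × ℂ) × (Fin 4 × Fin 6) → (Fin 4 → ℂ) := fun t => cutSet (lev D t.1.1) fun l =>
    rho t.1.2 (av a t.1.1 * zeta ^ (t.2.2 : ℕ)) (l - t.2.1)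
  have hsub : S ⊆ g '' (K ×ˢ Set.univ) := by
    intro Q hQ
    obtain ⟨k, y, z, h, hr, hR⟩ := hS Q hQ
    obtain ⟨i, j, hij⟩ := h.eq_rho ha hD
    exact ⟨((k, y), (i, j)), ⟨⟨Q, z, h, hr, hR⟩, trivial⟩, hij.symm⟩
  have hfin : (K ×ˢ (Set.univ : Set (Fin 4 × Fin 6))).Finite := hK.1.prod Set.finite_univ
  refine ⟨(hfin.image g).subset hsub, ?_⟩
  have h1 := (Set.ncard_le_ncard hsub (hfin.image g)).trans (Set.ncard_image_le hfin)
  rw [Set.ncard_prod, Set.ncard_univ, Nat.card_prod, Nat.card_fin, Nat.card_fin] at h1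
  have h2 : (S.ncard : ℝ) ≤ K.ncard * 24 := by exact_mod_cast h1
  have h3 : (R + r / 3) / (r / 3) = 3 * R / r + 1 := by field_simp
  rw [← h3]
  linarith [hK.2]

/-! ### The coarsest mesh -/

lemma sl_eq (a : ℂ) (k : ℕ) : sl a k = ‖a‖ * (1 / Real.sqrt 3) ^ k := by
  rw [sl, av, norm_div, norm_pow, norm_theta, one_div, inv_pow]; rfl

lemma exists_sl_lt (a : ℂ) {δ : ℝ} (hδ : 0 < δ) : ∃ K, sl a K < δ := by
  have h1 : Filter.Tendsto (sl a) Filter.atTop (nhds (‖a‖ * 0)) := by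
    rw [show sl a = fun k => ‖a‖ * (1 / Real.sqrt 3) ^ k from funext (sl_eq a)]
    refine (tendsto_pow_atTop_nhds_zero_of_lt_one (by positivity) ?_).const_mul _
    rw [div_lt_one (by positivity)]
    linarith [sqrt_three_gt]
  rw [mul_zero] at h1
  exact (h1.eventually_lt_const hδ).exists

/-- A down-closed set of replacements whose mesh obeys `σ`. -/
def bigSet (o a : ℂ) (Ω : Set ℂ) (σ : ℂ → ℝ) : Set (ℕ × ℂ) :=
  {t | t.2 ∈ lat o a t.1 ∧ ∃ q ∈ Ω, dist t.2 q ≤ 3 * sl a t.1 ∧ σ q < sl a t.1}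

lemma finite_lat_inter (ha : a ≠ 0) (k : ℕ) (w : ℂ) (R : ℝ) :
    {x | x ∈ lat o a k ∧ dist x w ≤ R}.Finite := by
  have hp := sl_pos ha k
  refine (packing {x | x ∈ lat o a k ∧ dist x w ≤ R} id (r := sl a k / 2) (by positivity)
    (fun x hx => hx.2) ?_).1
  intro x hx y hy hne
  refine Metric.ball_disjoint_ball ?_
  by_contra! h
  refine hne (lat_separated_two ha hx.1 hy.1 ?_)
  simp only [id] at h
  linarith

lemma finite_bigSet (ha : a ≠ 0) {Ω : Set ℂ} (hΩ : Bornology.IsBounded Ω) {σ : ℂ → ℝ} {δ : ℝ}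
    (hδ : 0 < δ) (hσ : ∀ p ∈ Ω, δ ≤ σ p) : (bigSet o a Ω σ).Finite := by
  obtain ⟨K, hK⟩ := exists_sl_lt a hδ
  obtain ⟨R, hR⟩ := hΩ.subset_closedBall 0
  have hfin : (⋃ k ∈ Set.Iio K, (Prod.mk k) ''
      {x | x ∈ lat o a k ∧ dist x 0 ≤ 3 * sl a 0 + R}).Finite :=
    (Set.finite_Iio K).biUnion fun k _ => (finite_lat_inter ha k 0 _).image _
  refine hfin.subset ?_
  rintro ⟨k, x⟩ ⟨hx, q, hq, hd, hs⟩
  have hkK : k < K := by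
    by_contra! h
    have := sl_antitone ha h
    have := hσ q hq
    simp only at hs
    linarith
  simp only [Set.mem_iUnion]
  refine ⟨k, hkK, x, ⟨hx, ?_⟩, rfl⟩
  have h1 := dist_triangle x q 0
  have h2 : dist q 0 ≤ R := hR hq
  have h3 := sl_antitone ha (Nat.zero_le k)
  simp only at hd
  linarith

lemma exists_bigD (ha : a ≠ 0) {Ω : Set ℂ} (hΩ : Bornology.IsBounded Ω) {σ : ℂ → ℝ} {δ : ℝ}
    (hδ : 0 < δ) (hσ : ∀ p ∈ Ω, δ ≤ σ p) : ∃ D : Finset (ℕ × ℂ), IsDown o a D ∧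
      ObeysSize (mesh o a D) Ω σ ∧ ∀ k, ∀ x ∈ lev D k, ∃ q ∈ Ω, dist x q ≤ 3 * sl a k ∧
        σ q < sl a k := by
  have hfin := finite_bigSet (o := o) ha hΩ hδ hσ
  have hlev : ∀ k x, x ∈ lev hfin.toFinset k ↔ x ∈ lat o a k ∧ ∃ q ∈ Ω, dist x q ≤ 3 * sl a k ∧
      σ q < sl a k := by
    intro k x
    simp only [lev, Set.mem_ofPred_eq, Set.Finite.mem_toFinset]
    rfl
  have hdown : IsDown o a hfin.toFinset := by
    refine ⟨fun k x hx => ((hlev k x).1 hx).1, fun k x q hx hq hd => ?_⟩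
    obtain ⟨-, t, ht, htd, hts⟩ := (hlev _ _).1 hx
    -- The radius factor `3` is large enough to be inherited by prerequisites: `sl a k + 3 · sl a (k
    -- + 1) ≤ 3 · sl a k`.
    refine (hlev _ _).2 ⟨hq, t, ht, ?_, hts.trans (sl_succ_lt ha k)⟩
    have h1 := dist_triangle_left q t x
    have h2 := sl_succ a k
    have h3 := sl_pos ha (k + 1)
    nlinarith [sqrt_three_gt]
  refine ⟨hfin.toFinset, hdown, ?_, fun k x hx => ((hlev k x).1 hx).2⟩
  rw [obeysSize_mesh_iff ha hdown]
  rintro k Q hQ hU z ⟨hz, hzΩ⟩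
  obtain ⟨i, hi, hn, hd⟩ :=
    exists_uncut_near ha (isRhomb_of_mem_Ex ha hdown hQ) (hdown.lev_subset k) hU hz
  by_contra! hlt
  refine hn ((hlev _ _).2 ⟨hi, z, hzΩ, ?_, hlt⟩)
  rw [dist_comm]
  have := (sl_succ_lt ha k).le
  linarith [sl_pos ha k]

/-- A set `D` with fewest replacements lies in every other admissible `D'`, since `D ∩ D'` is
admissible too. -/
lemma exists_isCoarsest (ha : a ≠ 0) {Ω : Set ℂ} (hΩ : Bornology.IsBounded Ω) {σ : ℂ → ℝ} {δ : ℝ}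
    (hδ : 0 < δ) (hσ : ∀ p ∈ Ω, δ ≤ σ p) : ∃ M, IsCoarsest (rhombille o a) Ω σ M := by
  classical
  obtain ⟨D₀, hD₀, hob₀, -⟩ := exists_bigD (o := o) ha hΩ hδ hσ
  have hex : ∃ n, ∃ D : Finset (ℕ × ℂ), D.card = n ∧ IsDown o a D ∧ ObeysSize (mesh o a D) Ω σ :=
    ⟨_, D₀, rfl, hD₀, hob₀⟩
  obtain ⟨D, hcard, hD, hob⟩ := Nat.find_spec hex
  refine ⟨mesh o a D, refines_mesh ha hD, hob, fun M' hM' hob' => ?_⟩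
  obtain ⟨D', hD', rfl⟩ := exists_mesh_of_refines_rhombille ha hM'
  have hmin := Nat.find_min' hex ⟨D ∩ D', rfl, hD.inter hD', obeysSize_inter ha hD hD' hob hob'⟩
  rw [← hcard] at hmin
  have : D ∩ D' = D := Finset.eq_of_subset_of_card_le Finset.inter_subset_left hmin
  exact refines_of_subset ha hD hD' (Finset.inter_eq_left.1 this)

/-- The elements of a coarsest mesh are not much smaller than the local feature size. -/
lemma exists_of_isCoarsest (ha : a ≠ 0) {Ω : Set ℂ} (hΩ : Bornology.IsBounded Ω) {σ : ℂ → ℝ}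
    {δ : ℝ} (hδ : 0 < δ) (hσ : ∀ p ∈ Ω, δ ≤ σ p) {M : QuadMesh}
    (hM : IsCoarsest (rhombille o a) Ω σ M) : ∃ D, IsDown o a D ∧ M = mesh o a D ∧
      ∀ k y z Q, z ∈ Ω → IsElt o a D k y z Q → k = 0 ∨ localFeatureSize Ω σ z ≤ 10 * sl a k := by
  obtain ⟨D, hD, rfl⟩ := exists_mesh_of_refines_rhombille ha hM.refines
  obtain ⟨D₀, hD₀, hob₀, hbd⟩ := exists_bigD (o := o) ha hΩ hδ hσ
  have hsub := subset_of_refines ha hD hD₀ (hM.coarsest _ (refines_mesh ha hD₀) hob₀)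
  refine ⟨D, hD, rfl, fun k y z Q hz h => ?_⟩
  cases k with
  | zero => exact Or.inl rfl
  | succ k =>
    right
    obtain ⟨x, hx, hxy⟩ := h.exists_pred ha hD
    obtain ⟨q, hq, hxq, hqs⟩ := hbd k x (hsub hx)
    have hbdd : BddBelow (Set.range fun q : Ω => dist z (q : ℂ) + σ q) := by
      refine ⟨0, ?_⟩
      rintro _ ⟨q, rfl⟩
      have := hσ q q.2
      exact add_nonneg dist_nonneg (hδ.le.trans this)
    have h1 : localFeatureSize Ω σ z ≤ dist z q + σ q := ciInf_le hbdd ⟨q, hq⟩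
    have h2 := dist_triangle z y q
    have h3 := dist_triangle y x q
    have h4 := h.near
    rw [dist_comm y x] at h3
    have e1 := sl_succ a k
    have e2 := sl_succ_succ a k
    have hp := sl_pos ha (k + 1)
    -- The distances and `σ q` add up to `5 · sl a k + 2 · sl a (k + 2)`, which is `17 / √3 < 10`
    -- times `sl a (k + 1)`.
    nlinarith [sqrt_three_lt]

end

section

/-! ### Plane geometry -/

/-- The determinant of two plane vectors. -/
def cross (z w : ℂ) : ℝ := z.re * w.im - z.im * w.re

lemma cross_ne_zero {x y z : ℂ} (h : AffineIndependent ℝ ![x, y, z]) :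
    cross (y - x) (z - x) ≠ 0 := by
  intro h0
  rw [affineIndependent_iff_not_collinear_set] at h
  apply h
  unfold cross at h0
  rw [collinear_iff_of_mem (p₀ := x) (by simp)]
  by_cases hyx : y - x = 0
  · refine ⟨z - x, ?_⟩
    rintro p (rfl | rfl | rfl)
    · exact ⟨0, by simp⟩
    · exact ⟨0, by simp; linear_combination hyx⟩
    · exact ⟨1, by simp⟩
  · refine ⟨y - x, ?_⟩
    rintro p (rfl | rfl | rfl)
    · exact ⟨0, by simp⟩
    · exact ⟨1, by simp⟩
    · have hn : Complex.normSq (y - x) ≠ 0 := by simpa using hyx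
      refine ⟨((p - x).re * (y - x).re + (p - x).im * (y - x).im) / Complex.normSq (y - x), ?_⟩
      rw [Complex.normSq_apply] at hn ⊢
      rw [vadd_eq_add, ← sub_eq_iff_eq_add, Complex.real_smul]
      apply Complex.ext
      · rw [Complex.re_ofReal_mul, div_mul_eq_mul_div, eq_div_iff hn]
        linear_combination (-(y - x).im) * h0
      · rw [Complex.im_ofReal_mul, div_mul_eq_mul_div, eq_div_iff hn]
        linear_combination (y - x).re * h0

/-- Cramer's rule. -/
lemma cross_smul_eq {u w : ℂ} (h : cross u w ≠ 0) (z : ℂ) :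
    z = ((cross z w / cross u w : ℝ) : ℂ) * u + ((cross u z / cross u w : ℝ) : ℂ) * w := by
  have h1 : (cross u w : ℂ) * z = cross z w * u + cross u z * w := by
    apply Complex.ext
    · simp only [Complex.add_re, Complex.re_ofReal_mul]
      unfold cross; ring
    · simp only [Complex.add_im, Complex.im_ofReal_mul]
      unfold cross; ring
  have h2 : (cross u w : ℂ) ≠ 0 := by exact_mod_cast h
  push_cast
  field_simp
  linear_combination h1

lemma mem_segment_iff_exists {x y p : ℂ} :
    p ∈ segment ℝ x y ↔ ∃ t : ℝ, 0 ≤ t ∧ t ≤ 1 ∧ p = x + t * (y - x) := by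
  rw [segment_eq_image']
  constructor
  · rintro ⟨t, ht, rfl⟩
    exact ⟨t, ht.1, ht.2, by simp⟩
  · rintro ⟨t, h0, h1, rfl⟩
    exact ⟨t, ⟨h0, h1⟩, by simp⟩

/-- Two segments from `v` diverge at a definite rate. -/
lemma le_dist_of_infDist {v w u : ℂ} {m : ℝ} (hw : m ≤ Metric.infDist w (segment ℝ v u))
    (hu : m ≤ Metric.infDist u (segment ℝ v w)) {t τ : ℝ} (ht : 0 ≤ t) (hτ : 0 ≤ τ) :
    m * max t τ ≤ dist (v + t * (w - v)) (v + τ * (u - v)) := by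
  have key : ∀ {w u : ℂ} {t τ : ℝ}, m ≤ Metric.infDist w (segment ℝ v u) → 0 ≤ t → 0 ≤ τ → τ ≤ t →
      m * t ≤ dist (v + t * (w - v)) (v + τ * (u - v)) := by
    intro w u t τ hw ht hτ hle
    rcases ht.eq_or_lt with rfl | hpos
    · rw [mul_zero]; exact dist_nonneg
    have hmem : v + ((τ / t : ℝ) : ℂ) * (u - v) ∈ segment ℝ v u :=
      mem_segment_iff_exists.2 ⟨τ / t, by positivity, (div_le_one hpos).2 hle, rfl⟩
    have h1 := hw.trans (Metric.infDist_le_dist_of_mem hmem)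
    have htc : (t : ℂ) ≠ 0 := by exact_mod_cast hpos.ne'
    have h2 : dist (v + t * (w - v)) (v + τ * (u - v)) =
        t * dist w (v + ((τ / t : ℝ) : ℂ) * (u - v)) := by
      rw [dist_eq_norm, dist_eq_norm]
      nth_rw 2 [← Complex.norm_of_nonneg ht]
      rw [← norm_mul]
      congr 1
      push_cast
      field_simp
      ring
    rw [h2, mul_comm]
    exact mul_le_mul_of_nonneg_left h1 ht
  rcases le_total τ t with h | h
  · rw [max_eq_left h]; exact key hw ht hτ h
  · rw [max_eq_right h, dist_comm]; exact key hu hτ ht h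

/-- The distance of two disjoint segments is attained at an end. -/
lemma le_dist_of_disjoint_segments {x y z w : ℂ} {m : ℝ}
    (hdisj : Disjoint (segment ℝ x y) (segment ℝ z w))
    (hx : m ≤ Metric.infDist x (segment ℝ z w)) (hy : m ≤ Metric.infDist y (segment ℝ z w))
    (hz : m ≤ Metric.infDist z (segment ℝ x y)) (hw : m ≤ Metric.infDist w (segment ℝ x y))
    {p q : ℂ} (hp : p ∈ segment ℝ x y) (hq : q ∈ segment ℝ z w) : m ≤ dist p q := by
  obtain ⟨s₀, hs0, hs1, rfl⟩ := mem_segment_iff_exists.1 hp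
  obtain ⟨t₀, ht0, ht1, rfl⟩ := mem_segment_iff_exists.1 hq
  set K : Set (ℝ × ℝ) := Set.Icc 0 1 ×ˢ Set.Icc 0 1
  set g : ℝ × ℝ → ℂ := fun t => (x + t.1 * (y - x)) - (z + t.2 * (w - z)) with hg
  have hmem1 : ∀ t ∈ K, x + (t.1 : ℂ) * (y - x) ∈ segment ℝ x y := fun t ht =>
    mem_segment_iff_exists.2 ⟨t.1, ht.1.1, ht.1.2, rfl⟩
  have hmem2 : ∀ t ∈ K, z + (t.2 : ℂ) * (w - z) ∈ segment ℝ z w := fun t ht =>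
    mem_segment_iff_exists.2 ⟨t.2, ht.2.1, ht.2.2, rfl⟩
  have hne : ∀ t ∈ K, g t ≠ 0 := by
    intro t ht h0
    refine Set.disjoint_left.1 hdisj (hmem1 t ht) ?_
    rw [sub_eq_zero.1 h0]
    exact hmem2 t ht
  have hK₀ : (s₀, t₀) ∈ K := ⟨⟨hs0, hs1⟩, ⟨ht0, ht1⟩⟩
  have hbd : ∀ t ∈ K, (t.1 = 0 ∨ t.1 = 1 ∨ t.2 = 0 ∨ t.2 = 1) → m ≤ ‖g t‖ := by
    intro t ht hb
    rw [hg]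
    simp only
    rw [← dist_eq_norm]
    have h1 := hmem1 t ht
    have h2 := hmem2 t ht
    rcases hb with hb | hb | hb | hb
    · refine hx.trans ?_
      have := Metric.infDist_le_dist_of_mem (x := x) h2
      simpa [hb] using this
    · refine hy.trans ?_
      have := Metric.infDist_le_dist_of_mem (x := y) h2
      simpa [hb] using this
    · refine hz.trans ?_
      have := Metric.infDist_le_dist_of_mem (x := z) h1
      rw [dist_comm]
      simpa [hb] using this
    · refine hw.trans ?_
      have := Metric.infDist_le_dist_of_mem (x := w) h1
      rw [dist_comm]
      simpa [hb] using this
  -- The difference `g` is affine on the unit square. A path leaving the square along which `‖g‖`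
  -- never exceeds its initial value crosses the boundary, where one of the points is an end of its
  -- segment.
  suffices hpath : ∃ γ : ℝ → ℝ × ℝ, Continuous γ ∧ γ 0 = (s₀, t₀) ∧
      ∃ T ≥ 0, γ T ∉ K ∧ ∀ τ ∈ Set.Icc 0 T, ‖g (γ τ)‖ ≤ ‖g (s₀, t₀)‖ by
    obtain ⟨γ, hγ, hγ0, T, hT, hTK, hle⟩ := hpath
    have hconn : IsPreconnected (γ '' Set.Icc 0 T) := isPreconnected_Icc.image _ hγ.continuousOn
    have hclosed : IsClosed K := isClosed_Icc.prod isClosed_Icc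
    obtain ⟨t, ⟨τ, hτ, rfl⟩, ht⟩ : ((γ '' Set.Icc 0 T) ∩ frontier K).Nonempty := by
      by_contra hemp
      have hsub : γ '' Set.Icc 0 T ⊆ interior K ∪ Kᶜ := by
        intro t ht
        by_cases htK : t ∈ K
        · left
          by_contra hni
          exact hemp ⟨t, ht, subset_closure htK, hni⟩
        · exact Or.inr htK
      have hmem : (s₀, t₀) ∈ γ '' Set.Icc 0 T := ⟨0, ⟨le_rfl, hT⟩, hγ0⟩
      obtain ⟨t, -, h1, h2⟩ := hconn _ _ isOpen_interior hclosed.isOpen_compl hsub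
        ⟨_, hmem, (hsub hmem).resolve_right fun h => h hK₀⟩ ⟨_, ⟨T, ⟨hT, le_rfl⟩, rfl⟩, hTK⟩
      exact h2 (interior_subset h1)
    have htK : γ τ ∈ K := hclosed.frontier_subset ht
    have hbdy : (γ τ).1 = 0 ∨ (γ τ).1 = 1 ∨ (γ τ).2 = 0 ∨ (γ τ).2 = 1 := by
      rw [frontier_prod_eq, frontier_Icc zero_le_one] at ht
      rcases ht with ⟨-, h⟩ | ⟨h, -⟩
      · rcases h with h | h
        · exact Or.inr (Or.inr (Or.inl h))
        · exact Or.inr (Or.inr (Or.inr h))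
      · rcases h with h | h
        · exact Or.inl h
        · exact Or.inr (Or.inl h)
    rw [dist_eq_norm]
    exact (hbd _ htK hbdy).trans (hle τ hτ)
  by_cases hc : cross (y - x) (w - z) = 0
  -- Parallel directions: `g` is constant along some line in the parameter plane.
  · have hxy : ∃ α β : ℝ, (α ≠ 0 ∨ β ≠ 0) ∧ (α : ℂ) * (y - x) = β * (w - z) := by
      by_cases h0 : w - z = 0
      · exact ⟨0, 1, Or.inr one_ne_zero, by simp [h0]⟩
      · unfold cross at hc
        have hn : Complex.normSq (w - z) ≠ 0 := by simpa using h0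
        rw [Complex.normSq_apply] at hn
        refine ⟨(w - z).re * (w - z).re + (w - z).im * (w - z).im,
          (y - x).re * (w - z).re + (y - x).im * (w - z).im, Or.inl hn, ?_⟩
        apply Complex.ext
        · rw [Complex.re_ofReal_mul, Complex.re_ofReal_mul]
          linear_combination (w - z).im * hc
        · rw [Complex.im_ofReal_mul, Complex.im_ofReal_mul]
          linear_combination (-(w - z).re) * hc
    obtain ⟨α, β, hαβ, he⟩ := hxy
    have hconst : ∀ τ : ℝ, g (s₀ + τ * α, t₀ + τ * β) = g (s₀, t₀) := by
      intro τ
      simp only [hg]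
      push_cast
      linear_combination (τ : ℂ) * he
    refine ⟨fun τ => (s₀ + τ * α, t₀ + τ * β), by fun_prop, by simp, ?_⟩
    rcases hαβ with h | h
    · refine ⟨2 / |α|, by positivity, ?_, fun τ _ => by rw [hconst]⟩
      rintro ⟨⟨h1, h2⟩, -⟩
      simp only at h1 h2
      rcases lt_or_gt_of_ne h with h' | h'
      · rw [abs_of_neg h', div_neg, neg_mul, div_mul_cancel₀ _ h] at h1; linarith
      · rw [abs_of_pos h', div_mul_cancel₀ _ h] at h2; linarith
    · refine ⟨2 / |β|, by positivity, ?_, fun τ _ => by rw [hconst]⟩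
      rintro ⟨-, ⟨h1, h2⟩⟩
      simp only at h1 h2
      rcases lt_or_gt_of_ne h with h' | h'
      · rw [abs_of_neg h', div_neg, neg_mul, div_mul_cancel₀ _ h] at h1; linarith
      · rw [abs_of_pos h', div_mul_cancel₀ _ h] at h2; linarith
  -- Independent directions: `g` can be scaled linearly down to `0`, a value it does not take in the
  -- square because the segments are disjoint.
  · obtain ⟨α, β, he⟩ : ∃ α β : ℝ, g (s₀, t₀) = α * (y - x) - β * (w - z) := by
      have := cross_smul_eq hc (g (s₀, t₀))
      refine ⟨cross (g (s₀, t₀)) (w - z) / cross (y - x) (w - z),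
        -(cross (y - x) (g (s₀, t₀)) / cross (y - x) (w - z)), this.trans ?_⟩
      push_cast
      ring
    have hscale : ∀ τ : ℝ, g (s₀ - τ * α, t₀ - τ * β) = ((1 - τ : ℝ) : ℂ) * g (s₀, t₀) := by
      intro τ
      have : g (s₀ - τ * α, t₀ - τ * β) = g (s₀, t₀) - τ * (α * (y - x) - β * (w - z)) := by
        simp only [hg]
        push_cast
        ring
      rw [this, ← he]
      push_cast
      ring
    refine ⟨fun τ => (s₀ - τ * α, t₀ - τ * β), by fun_prop, by simp, 1, zero_le_one, ?_, ?_⟩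
    · intro h
      exact hne _ h (by rw [hscale]; simp)
    · intro τ hτ
      rw [hscale, norm_mul, Complex.norm_of_nonneg (by linarith [hτ.2])]
      exact mul_le_of_le_one_left (norm_nonneg _) (by linarith [hτ.1])

/-! ### Discs in cones and triangles -/

lemma abs_cross_le (z w : ℂ) : |cross z w| ≤ ‖z‖ * ‖w‖ := by
  rw [← sq_le_sq₀ (abs_nonneg _) (by positivity), sq_abs, mul_pow, ← Complex.normSq_eq_norm_sq,
    ← Complex.normSq_eq_norm_sq, Complex.normSq_apply, Complex.normSq_apply]
  unfold cross
  nlinarith [sq_nonneg (z.re * w.re + z.im * w.im)]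

/-- A cone with unit directions `u`, `w` contains a ball about a unit vector. -/
lemma cone_ball {u w : ℂ} (hu : ‖u‖ = 1) (hw : ‖w‖ = 1) (hpos : 0 < cross u w) :
    ∃ m : ℂ, ‖m‖ = 1 ∧ ∀ z, ‖z - m‖ ≤ ‖u - w‖ / 2 →
      ∃ x y : ℝ, 0 ≤ x ∧ 0 ≤ y ∧ x ≤ 2 / cross u w ∧ y ≤ 2 / cross u w ∧ z = x * u + y * w := by
  have hu2 : u.re ^ 2 + u.im ^ 2 = 1 := by
    have := Complex.normSq_eq_norm_sq u
    rw [hu, Complex.normSq_apply] at this; linarith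
  have hw2 : w.re ^ 2 + w.im ^ 2 = 1 := by
    have := Complex.normSq_eq_norm_sq w
    rw [hw, Complex.normSq_apply] at this; linarith
  -- The area of the rhombus on `u`, `w` through its diagonals. It shows that the unit bisector has
  -- distance `‖u - w‖ / 2` from the lines spanned by `u` and `w`.
  have hprod : ‖u + w‖ * ‖u - w‖ = 2 * cross u w := by
    rw [← sq_eq_sq₀ (by positivity) (by positivity), mul_pow, ← Complex.normSq_eq_norm_sq,
      ← Complex.normSq_eq_norm_sq, Complex.normSq_apply, Complex.normSq_apply]
    unfold cross
    simp only [Complex.add_re, Complex.add_im, Complex.sub_re, Complex.sub_im]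
    have e : (u.re * w.re + u.im * w.im) ^ 2 + (u.re * w.im - u.im * w.re) ^ 2 = 1 := by
      have : (u.re ^ 2 + u.im ^ 2) * (w.re ^ 2 + w.im ^ 2) = 1 := by rw [hu2, hw2]; norm_num
      linarith
    have e1 : (u.re + w.re) * (u.re + w.re) + (u.im + w.im) * (u.im + w.im) =
      2 + 2 * (u.re * w.re + u.im * w.im) := by linear_combination hu2 + hw2
    have e2 : (u.re - w.re) * (u.re - w.re) + (u.im - w.im) * (u.im - w.im) =
      2 - 2 * (u.re * w.re + u.im * w.im) := by linear_combination hu2 + hw2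
    rw [e1, e2]
    linear_combination (-4) * e
  have hs : 0 < ‖u + w‖ := by
    by_contra! h
    have : ‖u + w‖ = 0 := le_antisymm h (norm_nonneg _)
    rw [this] at hprod; linarith
  set s := ‖u + w‖ with hsdef
  have hle2 : ‖u - w‖ ≤ 2 := (norm_sub_le u w).trans (by rw [hu, hw]; norm_num)
  refine ⟨((1 / s : ℝ) : ℂ) * (u + w), ?_, fun z hz => ?_⟩
  · rw [norm_mul, Complex.norm_of_nonneg (by positivity), ← hsdef]
    field_simp
  set ε := z - ((1 / s : ℝ) : ℂ) * (u + w) with hε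
  have hz' : z = ((1 / s : ℝ) : ℂ) * (u + w) + ε := by rw [hε]; ring
  have hcs : cross u w / s = ‖u - w‖ / 2 := by
    rw [div_eq_div_iff hs.ne' two_ne_zero]; linarith
  have c1 : cross z w = ‖u - w‖ / 2 + cross ε w := by
    rw [← hcs, hz']; unfold cross
    simp only [Complex.add_re, Complex.add_im, Complex.re_ofReal_mul, Complex.im_ofReal_mul]
    field_simp
    ring
  have c2 : cross u z = ‖u - w‖ / 2 + cross u ε := by
    rw [← hcs, hz']; unfold cross
    simp only [Complex.add_re, Complex.add_im, Complex.re_ofReal_mul, Complex.im_ofReal_mul]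
    field_simp
    ring
  have b1 := abs_cross_le ε w
  have b2 := abs_cross_le u ε
  rw [hw, mul_one] at b1
  rw [hu, one_mul] at b2
  refine ⟨cross z w / cross u w, cross u z / cross u w, ?_, ?_, ?_, ?_, ?_⟩
  · refine div_nonneg ?_ hpos.le
    linarith [neg_abs_le (cross ε w)]
  · refine div_nonneg ?_ hpos.le
    linarith [neg_abs_le (cross u ε)]
  · refine div_le_div_of_nonneg_right ?_ hpos.le
    linarith [le_abs_self (cross ε w)]
  · refine div_le_div_of_nonneg_right ?_ hpos.le
    linarith [le_abs_self (cross u ε)]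
  · exact cross_smul_eq hpos.ne' z

/-- The unit vector in the direction of `z`. -/
def unit (z : ℂ) : ℂ := z / (‖z‖ : ℂ)

lemma norm_unit {z : ℂ} (hz : z ≠ 0) : ‖unit z‖ = 1 := by
  rw [unit, norm_div, Complex.norm_real, norm_norm, div_self (norm_ne_zero_iff.2 hz)]

lemma norm_mul_unit {z : ℂ} (hz : z ≠ 0) : (‖z‖ : ℂ) * unit z = z := by
  have : (‖z‖ : ℂ) ≠ 0 := by exact_mod_cast norm_ne_zero_iff.2 hz
  rw [unit]; field_simp

lemma cross_unit {z w : ℂ} (hz : z ≠ 0) (hw : w ≠ 0) :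
    cross z w = ‖z‖ * ‖w‖ * cross (unit z) (unit w) := by
  conv_lhs => rw [← norm_mul_unit hz, ← norm_mul_unit hw]
  unfold cross
  simp only [Complex.re_ofReal_mul, Complex.im_ofReal_mul]
  ring

/-- A triangle contains, near its corner `v`, balls of radius proportional to the distance. -/
lemma triangle_ball {v w u : ℂ} (h : cross (w - v) (u - v) ≠ 0) :
    ∃ r₀ > 0, ∀ r > 0, r ≤ r₀ → ∃ y, dist y v ≤ r ∧
      Metric.ball y (r * (‖unit (w - v) - unit (u - v)‖ / 2)) ⊆ convexHull ℝ {v, w, u} := by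
  wlog hpos : 0 < cross (w - v) (u - v) generalizing w u
  · have h1 : cross (u - v) (w - v) = - cross (w - v) (u - v) := by unfold cross; ring
    have h2 : 0 < cross (u - v) (w - v) := by
      rw [h1]
      have := lt_of_le_of_ne (not_lt.1 hpos) h
      linarith
    have := this h2.ne' h2
    rw [show ({v, w, u} : Set ℂ) = {v, u, w} by rw [Set.pair_comm], norm_sub_rev]
    exact this
  have hw : w - v ≠ 0 := by rintro h0; rw [h0] at h; simp [cross] at h
  have hu : u - v ≠ 0 := by rintro h0; rw [h0] at h; simp [cross] at h
  have nw := norm_pos_iff.2 hw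
  have nu := norm_pos_iff.2 hu
  have hc : 0 < cross (unit (w - v)) (unit (u - v)) := by
    rw [cross_unit hw hu] at hpos
    exact pos_of_mul_pos_right hpos (by positivity)
  obtain ⟨m, hm, hball⟩ := cone_ball (norm_unit hw) (norm_unit hu) hc
  set c := cross (unit (w - v)) (unit (u - v))
  set M := min ‖w - v‖ ‖u - v‖
  have hM : 0 < M := lt_min nw nu
  -- This bound on `r` keeps the barycentric weights of `w` and `u` at most `1 / 2` each.
  refine ⟨c * M / 4, by positivity, fun r hr hr0 => ⟨v + r * m, ?_, fun z hz => ?_⟩⟩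
  · rw [dist_comm, dist_self_add_right, norm_mul, hm, mul_one, Complex.norm_of_nonneg hr.le]
  · have hrc : (r : ℂ) ≠ 0 := by exact_mod_cast hr.ne'
    obtain ⟨x, y, hx, hy, hx2, hy2, hzxy⟩ := hball ((z - v) / r) (by
      rw [Metric.mem_ball, dist_eq_norm] at hz
      rw [show (z - v) / r - m = (z - (v + r * m)) / r by field_simp; ring, norm_div,
        Complex.norm_of_nonneg hr.le, div_le_iff₀ hr]
      linarith)
    have hz2 : z = v + r * (x * unit (w - v) + y * unit (u - v)) := by
      rw [← hzxy]; field_simp; ring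
    have b : ∀ t n : ℝ, M ≤ n → 0 ≤ t → t ≤ 2 / c → r * t / n ≤ 1 / 2 := by
      intro t n hn ht0 ht
      have hn0 : 0 < n := hM.trans_le hn
      rw [div_le_iff₀ hn0]
      have h1 : r * t ≤ c * M / 4 * (2 / c) := mul_le_mul hr0 ht ht0 (by positivity)
      have h2 : c * M / 4 * (2 / c) = M / 2 := by field_simp; ring
      linarith
    have b1 := b x _ (min_le_left _ _) hx hx2
    have b2 := b y _ (min_le_right _ _) hy hy2
    have hmem := mem_convexHull_three (s := {v, w, u}) (A := v) (B := w) (C := u) (by simp)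
      (by simp) (by simp) (x := 1 - r * x / ‖w - v‖ - r * y / ‖u - v‖) (y := r * x / ‖w - v‖)
      (z := r * y / ‖u - v‖) (by linarith) (by positivity) (by positivity) (by ring)
    convert hmem using 1
    rw [hz2, unit, unit]
    have hwc : (‖w - v‖ : ℂ) ≠ 0 := by exact_mod_cast nw.ne'
    have huc : (‖u - v‖ : ℂ) ≠ 0 := by exact_mod_cast nu.ne'
    push_cast
    field_simp
    ring

end

section

/-! ### Geometry of elements -/

lemma cross_swap {x y z : ℂ} (h : cross (y - x) (z - x) ≠ 0) : cross (z - x) (y - x) ≠ 0 := by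
  intro h'; apply h; unfold cross at *; linarith

lemma cross_rotate {x y z : ℂ} (h : cross (y - x) (z - x) ≠ 0) : cross (z - y) (x - y) ≠ 0 := by
  intro h'; apply h; unfold cross at *
  simp only [Complex.sub_re, Complex.sub_im] at *
  linarith

lemma ne_of_cross {x y z : ℂ} (h : cross (y - x) (z - x) ≠ 0) : x ≠ y := by
  rintro rfl; simp [cross] at h

lemma cross_mul_right (z : ℂ) (t : ℝ) (w : ℂ) : cross z (t * w) = t * cross z w := by
  unfold cross; rw [Complex.re_ofReal_mul, Complex.im_ofReal_mul]; ring

lemma cross_self (z : ℂ) : cross z z = 0 := by unfold cross; ring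

/-- In a nondegenerate triangle two sides meet only in their common corner. -/
lemma segment_inter {x y z p : ℂ} (h : cross (y - x) (z - x) ≠ 0) (hy : p ∈ segment ℝ x y)
    (hz : p ∈ segment ℝ x z) : p = x := by
  obtain ⟨t, -, -, rfl⟩ := mem_segment_iff_exists.1 hy
  obtain ⟨s, -, -, hs⟩ := mem_segment_iff_exists.1 hz
  have h1 : (t : ℂ) * (y - x) = s * (z - x) := add_left_cancel hs
  have h2 : s * cross (y - x) (z - x) = 0 := by
    rw [← cross_mul_right, ← h1, cross_mul_right, cross_self, mul_zero]
  have h3 : s = 0 := (mul_eq_zero.1 h2).resolve_right h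
  rw [hs, h3]; simp

namespace Element

variable {E : Element} {A : ℝ}

/-- The length of the longest side. -/
def size : Element → ℝ
  | tri v => Finset.univ.sup' Finset.univ_nonempty fun i => dist (v i) (v (i + 1))
  | quad v => Finset.univ.sup' Finset.univ_nonempty fun i => dist (v i) (v (i + 1))

lemma dist_le_size {x y : ℂ} (h : E.IsSide x y) : dist x y ≤ E.size := by
  cases E with
  | tri v =>
    obtain ⟨i, ⟨rfl, rfl⟩ | ⟨rfl, rfl⟩⟩ := h
    · exact Finset.le_sup' (fun i => dist (v i) (v (i + 1))) (Finset.mem_univ i)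
    · rw [dist_comm]
      exact Finset.le_sup' (fun i => dist (v i) (v (i + 1))) (Finset.mem_univ i)
  | quad v =>
    obtain ⟨i, ⟨rfl, rfl⟩ | ⟨rfl, rfl⟩⟩ := h
    · exact Finset.le_sup' (fun i => dist (v i) (v (i + 1))) (Finset.mem_univ i)
    · rw [dist_comm]
      exact Finset.le_sup' (fun i => dist (v i) (v (i + 1))) (Finset.mem_univ i)

lemma exists_dist_eq_size (E : Element) : ∃ x y, E.IsSide x y ∧ E.size = dist x y := by
  cases E with
  | tri v =>
    obtain ⟨i, -, hi⟩ := Finset.exists_mem_eq_sup' (Finset.univ_nonempty (α := Fin 3))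
      fun i => dist (v i) (v (i + 1))
    exact ⟨_, _, ⟨i, Or.inl ⟨rfl, rfl⟩⟩, hi⟩
  | quad v =>
    obtain ⟨i, -, hi⟩ := Finset.exists_mem_eq_sup' (Finset.univ_nonempty (α := Fin 4))
      fun i => dist (v i) (v (i + 1))
    exact ⟨_, _, ⟨i, Or.inl ⟨rfl, rfl⟩⟩, hi⟩

lemma IsSide.symm {x y : ℂ} (h : E.IsSide x y) : E.IsSide y x := by
  cases E <;> exact h.imp fun i => Or.symm

lemma IsSide.mem_left {x y : ℂ} (h : E.IsSide x y) : x ∈ E.vertices := by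
  cases E <;> obtain ⟨i, ⟨rfl, rfl⟩ | ⟨rfl, rfl⟩⟩ := h <;> exact ⟨_, rfl⟩

lemma IsSide.mem_right {x y : ℂ} (h : E.IsSide x y) : y ∈ E.vertices := h.symm.mem_left

lemma tri_injective {v : Fin 3 → ℂ} (h : (tri v).IsProper) : Function.Injective v := by
  have h0 := cross_ne_zero h
  have h1 := cross_rotate h0
  have h2 := cross_rotate h1
  have n0 := ne_of_cross h0
  have n1 := ne_of_cross h1
  have n2 := ne_of_cross h2
  intro i j hij
  fin_cases i <;> fin_cases j <;> simp at hij ⊢ <;>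
    first
    | exact n0 hij
    | exact n0 hij.symm
    | exact n1 hij
    | exact n1 hij.symm
    | exact n2 hij
    | exact n2 hij.symm

lemma quad_injective {v : Fin 4 → ℂ} (h : (quad v).IsProper) : Function.Injective v := by
  obtain ⟨hA, hB, hAB⟩ := h
  have h0 := cross_ne_zero hA
  have h1 := cross_rotate h0
  have h2 := cross_rotate h1
  have g0 := cross_ne_zero hB
  have g1 := cross_rotate g0
  have g2 := cross_rotate g1
  have n0 := ne_of_cross h0
  have n1 := ne_of_cross h1
  have n2 := ne_of_cross h2
  have m1 := ne_of_cross g1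
  have m2 := ne_of_cross g2
  have n13 : v 1 ≠ v 3 := by
    intro h13
    have hmem : v 1 ∈ convexHull ℝ {v 0, v 1, v 2} ∩ convexHull ℝ {v 0, v 2, v 3} :=
      ⟨subset_convexHull ℝ _ (by simp), subset_convexHull ℝ _ (by simp [h13])⟩
    rw [hAB] at hmem
    exact n0 (segment_inter h0 (right_mem_segment ℝ _ _) hmem).symm
  intro i j hij
  fin_cases i <;> fin_cases j <;> simp at hij ⊢ <;>
    first
    | exact n0 hij
    | exact n0 hij.symm
    | exact n1 hij
    | exact n1 hij.symm
    | exact n2 hij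
    | exact n2 hij.symm
    | exact m1 hij
    | exact m1 hij.symm
    | exact m2 hij
    | exact m2 hij.symm
    | exact n13 hij
    | exact n13 hij.symm

lemma IsSide.ne (hp : E.IsProper) {x y : ℂ} (h : E.IsSide x y) : x ≠ y := by
  cases E with
  | tri v =>
    have hi := tri_injective hp
    obtain ⟨i, ⟨rfl, rfl⟩ | ⟨rfl, rfl⟩⟩ := h
    · exact fun h => absurd (hi h) (by clear * - i; revert i; decide)
    · exact fun h => absurd (hi h) (by clear * - i; revert i; decide)
  | quad v =>
    have hi := quad_injective hp
    obtain ⟨i, ⟨rfl, rfl⟩ | ⟨rfl, rfl⟩⟩ := h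
    · exact fun h => absurd (hi h) (by clear * - i; revert i; decide)
    · exact fun h => absurd (hi h) (by clear * - i; revert i; decide)

lemma IsSide.exists_other (hp : E.IsProper) {x y : ℂ} (h : E.IsSide x y) :
    ∃ u, E.IsSide y u ∧ u ≠ x := by
  cases E with
  | tri v =>
    have hi := tri_injective hp
    obtain ⟨i, ⟨rfl, rfl⟩ | ⟨rfl, rfl⟩⟩ := h
    · exact ⟨v (i + 1 + 1), ⟨i + 1, Or.inl ⟨rfl, rfl⟩⟩,
        fun h => absurd (hi h) (by clear * - i; revert i; decide)⟩
    · have e : i - 1 + 1 = i := by abel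
      exact ⟨v (i - 1), ⟨i - 1, Or.inr ⟨rfl, by rw [e]⟩⟩,
        fun h => absurd (hi h) (by clear * - i; revert i; decide)⟩
  | quad v =>
    have hi := quad_injective hp
    obtain ⟨i, ⟨rfl, rfl⟩ | ⟨rfl, rfl⟩⟩ := h
    · exact ⟨v (i + 1 + 1), ⟨i + 1, Or.inl ⟨rfl, rfl⟩⟩,
        fun h => absurd (hi h) (by clear * - i; revert i; decide)⟩
    · have e : i - 1 + 1 = i := by abel
      exact ⟨v (i - 1), ⟨i - 1, Or.inr ⟨rfl, by rw [e]⟩⟩,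
        fun h => absurd (hi h) (by clear * - i; revert i; decide)⟩

lemma size_pos (hp : E.IsProper) : 0 < E.size := by
  obtain ⟨x, y, h, he⟩ := E.exists_dist_eq_size
  rw [he]; exact dist_pos.2 (h.ne hp)

lemma AspectRatioLE.size_le (hA : E.AspectRatioLE A) {z w v : ℂ} (h : E.IsSide z w)
    (hv : v ∈ E.vertices) (hz : v ≠ z) (hw : v ≠ w) :
    E.size ≤ A * Metric.infDist v (segment ℝ z w) := by
  obtain ⟨x, y, hs, he⟩ := E.exists_dist_eq_size
  rw [he]; exact hA x y hs z w h v hv hz hw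

lemma AspectRatioLE.mono (hA : E.AspectRatioLE A) {B : ℝ} (hAB : A ≤ B) : E.AspectRatioLE B :=
  fun x y hs z w h v hv hz hw => (hA x y hs z w h v hv hz hw).trans
    (mul_le_mul_of_nonneg_right hAB Metric.infDist_nonneg)

/-- The next side at `y` does not contain the vertex `x` as an end, and its distance from `x` is at
most `dist x y`. -/
lemma AspectRatioLE.size_le_side (hp : E.IsProper) (hA : E.AspectRatioLE A) (hA0 : 0 < A)
    {x y : ℂ} (h : E.IsSide x y) : E.size ≤ A * dist x y := by
  obtain ⟨u, hu, hux⟩ := h.exists_other hp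
  refine (hA.size_le hu h.mem_left (h.ne hp) hux.symm).trans ?_
  exact mul_le_mul_of_nonneg_left
    (Metric.infDist_le_dist_of_mem (left_mem_segment ℝ y u)) hA0.le

/-- Opposite sides lie in different triangles, so a common point is on the diagonal; but one side
meets the diagonal only in vertex `0`, the other only in vertex `2`. -/
lemma quad_disjoint {v : Fin 4 → ℂ} (h : (quad v).IsProper) (i : Fin 4) :
    Disjoint (segment ℝ (v i) (v (i + 1))) (segment ℝ (v (i + 2)) (v (i + 3))) := by
  obtain ⟨hA, hB, hAB⟩ := h
  have h0 := cross_ne_zero hA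
  have g0 := cross_ne_zero hB
  have n2 := ne_of_cross (cross_rotate (cross_rotate h0))
  have sub : ∀ {x y : ℂ} {s : Set ℂ}, x ∈ s → y ∈ s → segment ℝ x y ⊆ convexHull ℝ s :=
    fun hx hy => (convex_convexHull ℝ _).segment_subset (subset_convexHull ℝ _ hx)
      (subset_convexHull ℝ _ hy)
  have d1 : Disjoint (segment ℝ (v 0) (v 1)) (segment ℝ (v 2) (v 3)) := by
    rw [Set.disjoint_left]
    intro p hp hp'
    have hmem : p ∈ convexHull ℝ {v 0, v 1, v 2} ∩ convexHull ℝ {v 0, v 2, v 3} :=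
      ⟨sub (by simp) (by simp) hp, sub (by simp) (by simp) hp'⟩
    rw [hAB] at hmem
    have e1 := segment_inter h0 hp hmem
    have e2 := segment_inter (cross_rotate g0) hp' (by rwa [segment_symm])
    exact n2 (e2.symm.trans e1)
  have d2 : Disjoint (segment ℝ (v 1) (v 2)) (segment ℝ (v 3) (v 0)) := by
    rw [Set.disjoint_left]
    intro p hp hp'
    have hmem : p ∈ convexHull ℝ {v 0, v 1, v 2} ∩ convexHull ℝ {v 0, v 2, v 3} :=
      ⟨sub (by simp) (by simp) hp, sub (by simp) (by simp) hp'⟩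
    rw [hAB] at hmem
    have e1 := segment_inter (cross_swap (cross_rotate (cross_rotate h0)))
      (by rwa [segment_symm]) (by rwa [segment_symm]) (p := p) (x := v 2) (y := v 1) (z := v 0)
    have e2 := segment_inter (cross_swap g0) (by rwa [segment_symm]) hmem
    exact n2 (e1.symm.trans e2)
  fin_cases i
  · exact d1
  · exact d2
  · exact d1.symm
  · exact d2.symm

lemma disjoint_sides (hp : E.IsProper) {x y z w : ℂ} (h : E.IsSide x y) (h' : E.IsSide z w)
    (hxz : x ≠ z) (hxw : x ≠ w) (hyz : y ≠ z) (hyw : y ≠ w) :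
    Disjoint (segment ℝ x y) (segment ℝ z w) := by
  cases E with
  | tri v =>
    exfalso
    obtain ⟨i, hi⟩ := h
    obtain ⟨j, hj⟩ := h'
    have : j = i ∨ j = i + 1 ∨ i = j + 1 := by
      clear * - i j; revert i j; decide
    rcases this with rfl | rfl | rfl <;> grind
  | quad v =>
    obtain ⟨i, hi⟩ := h
    obtain ⟨j, hj⟩ := h'
    have : j = i ∨ j = i + 1 ∨ i = j + 1 ∨ j = i + 2 := by
      clear * - i j; revert i j; decide
    rcases this with rfl | rfl | rfl | rfl
    · grind
    · grind
    · grind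
    · have hd := quad_disjoint hp i
      have e : i + 2 + 1 = i + 3 := fin_four_add_two_one i
      rw [e] at hj
      rcases hi with ⟨rfl, rfl⟩ | ⟨rfl, rfl⟩ <;> rcases hj with ⟨rfl, rfl⟩ | ⟨rfl, rfl⟩
      · exact hd
      · rwa [segment_symm ℝ (v (i + 3))]
      · rwa [segment_symm ℝ (v (i + 1))]
      · rwa [segment_symm ℝ (v (i + 1)), segment_symm ℝ (v (i + 3))]

lemma isClosed_region (E : Element) : IsClosed E.region := by
  have h : ∀ x y z : ℂ, IsClosed (convexHull ℝ {x, y, z}) := fun x y z =>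
    (Set.toFinite {x, y, z}).isClosed_convexHull ℝ
  cases E with
  | tri v => exact h _ _ _
  | quad v => exact (h _ _ _).union (h _ _ _)

lemma region_subset_closedBall (E : Element) : ∃ c, E.region ⊆ Metric.closedBall c (2 * E.size) := by
  cases E with
  | tri v =>
    refine ⟨v 0, convexHull_min ?_ (convex_closedBall _ _)⟩
    have h1 : dist (v 0) (v 1) ≤ size (tri v) := dist_le_size ⟨0, Or.inl ⟨rfl, rfl⟩⟩
    have h2 : dist (v 2) (v 0) ≤ size (tri v) := dist_le_size ⟨2, Or.inl ⟨rfl, rfl⟩⟩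
    have h0 : 0 ≤ size (tri v) := dist_nonneg.trans h1
    rintro _ (rfl | rfl | rfl) <;> rw [Metric.mem_closedBall]
    · rw [dist_self]; linarith
    · rw [dist_comm]; linarith
    · linarith
  | quad v =>
    have h1 : dist (v 0) (v 1) ≤ size (quad v) := dist_le_size ⟨0, Or.inl ⟨rfl, rfl⟩⟩
    have h2 : dist (v 1) (v 2) ≤ size (quad v) := dist_le_size ⟨1, Or.inl ⟨rfl, rfl⟩⟩
    have h3 : dist (v 3) (v 0) ≤ size (quad v) := dist_le_size ⟨3, Or.inl ⟨rfl, rfl⟩⟩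
    have h0 : 0 ≤ size (quad v) := dist_nonneg.trans h1
    refine ⟨v 0, region_subset (convex_closedBall _ _) fun i => ?_⟩
    rw [Metric.mem_closedBall, dist_comm]
    fin_cases i
    · simp; linarith
    · change dist (v 0) (v 1) ≤ _; linarith
    · change dist (v 0) (v 2) ≤ _
      linarith [dist_triangle (v 0) (v 1) (v 2)]
    · change dist (v 0) (v 3) ≤ _
      rw [dist_comm]; linarith

lemma dist_le_of_mem_region {p q : ℂ} (hp : p ∈ E.region) (hq : q ∈ E.region) :
    dist p q ≤ 4 * E.size := by
  obtain ⟨c, hc⟩ := E.region_subset_closedBall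
  have h1 := hc hp
  have h2 := hc hq
  rw [Metric.mem_closedBall] at h1 h2
  linarith [dist_triangle_right p q c]

lemma triangle_subset_closure {x y z : ℂ} (h : cross (y - x) (z - x) ≠ 0) :
    convexHull ℝ {x, y, z} ⊆ closure (interior (convexHull ℝ {x, y, z})) := by
  have hne : (interior (convexHull ℝ {x, y, z})).Nonempty := by
    obtain ⟨r, hr, h1⟩ := triangle_ball h
    obtain ⟨c, -, hc⟩ := h1 r hr le_rfl
    have hy : y - x ≠ 0 := sub_ne_zero.2 (ne_of_cross h).symm
    have hz : z - x ≠ 0 := sub_ne_zero.2 (ne_of_cross (cross_swap h)).symm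
    have hpos : 0 < ‖unit (y - x) - unit (z - x)‖ := by
      rw [norm_pos_iff, sub_ne_zero]
      intro he
      rw [cross_unit hy hz, he, cross_self] at h
      simp at h
    exact ⟨c, interior_maximal hc Metric.isOpen_ball (Metric.mem_ball_self (by positivity))⟩
  rw [(convex_convexHull ℝ _).closure_interior_eq_closure_of_nonempty_interior hne]
  exact subset_closure

lemma region_subset_closure_interior (hp : E.IsProper) :
    E.region ⊆ closure (interior E.region) := by
  cases E with
  | tri v => exact triangle_subset_closure (cross_ne_zero hp)
  | quad v =>
    refine Set.union_subset ?_ ?_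
    · exact (triangle_subset_closure (cross_ne_zero hp.1)).trans
        (closure_mono (interior_mono Set.subset_union_left))
    · exact (triangle_subset_closure (cross_ne_zero hp.2.1)).trans
        (closure_mono (interior_mono Set.subset_union_right))

/-- A lower bound for the angle at `v`, obtained by comparing the points at unit distance from `v`
in the directions of the two sides. -/
lemma AspectRatioLE.le_norm_unit_sub (hp : E.IsProper) (hA : E.AspectRatioLE A) (hA0 : 0 < A)
    {v w u : ℂ} (hw : E.IsSide v w) (hu : E.IsSide v u) (hwu : w ≠ u) :
    1 / A ≤ ‖unit (w - v) - unit (u - v)‖ := by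
  have h1 := hA.size_le hu hw.mem_right (hw.ne hp).symm hwu
  have h2 := hA.size_le hw hu.mem_right (hu.ne hp).symm hwu.symm
  have hw0 : w - v ≠ 0 := sub_ne_zero.2 (hw.ne hp).symm
  have hu0 : u - v ≠ 0 := sub_ne_zero.2 (hu.ne hp).symm
  have nw := norm_pos_iff.2 hw0
  have nu := norm_pos_iff.2 hu0
  have key := le_dist_of_infDist (m := E.size / A) (by rw [div_le_iff₀ hA0]; linarith)
    (by rw [div_le_iff₀ hA0]; linarith) (v := v) (w := w) (u := u)
    (t := 1 / ‖w - v‖) (τ := 1 / ‖u - v‖) (by positivity) (by positivity)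
  have e : dist (v + ((1 / ‖w - v‖ : ℝ) : ℂ) * (w - v)) (v + ((1 / ‖u - v‖ : ℝ) : ℂ) * (u - v)) =
      ‖unit (w - v) - unit (u - v)‖ := by
    rw [dist_add_left, dist_eq_norm, unit, unit]
    congr 1
    push_cast
    ring
  rw [e] at key
  refine le_trans ?_ key
  have hs : ‖w - v‖ ≤ E.size := by
    rw [← dist_eq_norm, dist_comm]; exact dist_le_size hw
  calc 1 / A ≤ E.size / A * (1 / ‖w - v‖) := by
        rw [div_mul_div_comm, mul_one, div_le_div_iff₀ hA0 (by positivity)]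
        nlinarith
    _ ≤ _ := by
        refine mul_le_mul_of_nonneg_left (le_max_left _ _) ?_
        have := size_pos hp
        positivity

/-- Near each of its vertices an element contains balls of radius proportional to the distance. -/
lemma AspectRatioLE.exists_ball (hp : E.IsProper) (hA : E.AspectRatioLE A) (hA0 : 0 < A) {v : ℂ}
    (hv : v ∈ E.vertices) : ∃ r₀ > 0, ∀ r > 0, r ≤ r₀ → ∃ y, dist y v ≤ r ∧
      Metric.ball y (r * (1 / (4 * A))) ⊆ E.region := by
  have one : ∀ {w u : ℂ}, cross (w - v) (u - v) ≠ 0 → convexHull ℝ {v, w, u} ⊆ E.region →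
      1 / (2 * A) ≤ ‖unit (w - v) - unit (u - v)‖ → ∃ r₀ > 0, ∀ r > 0, r ≤ r₀ → ∃ y, dist y v ≤ r ∧
        Metric.ball y (r * (1 / (4 * A))) ⊆ E.region := by
    intro w u hc hsub hle
    obtain ⟨r₀, hr₀, h⟩ := triangle_ball hc
    refine ⟨r₀, hr₀, fun r hr hrr => ?_⟩
    obtain ⟨y, hy, hb⟩ := h r hr hrr
    refine ⟨y, hy, (Metric.ball_subset_ball ?_).trans (hb.trans hsub)⟩
    refine mul_le_mul_of_nonneg_left ?_ hr.le
    have : 1 / (4 * A) = 1 / (2 * A) / 2 := by field_simp; norm_num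
    linarith
  have half : 1 / (2 * A) ≤ 1 / A := by
    rw [div_le_div_iff₀ (by positivity) hA0]; linarith
  -- At an end of the inner diagonal the angle is divided between two triangles, and by the triangle
  -- inequality one of them keeps half of the bound.
  have two : ∀ {w d u : ℂ}, E.IsSide v w → E.IsSide v u → w ≠ u → cross (w - v) (d - v) ≠ 0 →
      cross (d - v) (u - v) ≠ 0 → convexHull ℝ {v, w, d} ⊆ E.region →
      convexHull ℝ {v, d, u} ⊆ E.region → ∃ r₀ > 0, ∀ r > 0, r ≤ r₀ → ∃ y, dist y v ≤ r ∧
        Metric.ball y (r * (1 / (4 * A))) ⊆ E.region := by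
    intro w d u hw hu hwu h1 h2 s1 s2
    have hsep := hA.le_norm_unit_sub hp hA0 hw hu hwu
    have htri := norm_sub_le_norm_sub_add_norm_sub (unit (w - v)) (unit (d - v)) (unit (u - v))
    rcases le_or_gt (1 / (2 * A)) ‖unit (w - v) - unit (d - v)‖ with h | h
    · exact one h1 s1 h
    · refine one h2 s2 ?_
      have : 1 / A = 1 / (2 * A) + 1 / (2 * A) := by field_simp; norm_num
      linarith
  cases E with
  | tri v' =>
    have hinj := tri_injective hp
    have h0 := cross_ne_zero hp
    have key : ∀ i : Fin 3, cross (v' (i + 1) - v' i) (v' (i + 2) - v' i) ≠ 0 ∧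
        convexHull ℝ {v' i, v' (i + 1), v' (i + 2)} ⊆ (tri v').region := by
      intro i
      refine ⟨?_, convexHull_mono ?_⟩
      · fin_cases i
        exacts [h0, cross_rotate h0, cross_rotate (cross_rotate h0)]
      · fin_cases i <;> rintro _ (rfl | rfl | rfl) <;> simp
    obtain ⟨i, rfl⟩ := hv
    refine one (key i).1 (key i).2 (half.trans ?_)
    have e : i + 2 + 1 = i := by clear * - i; revert i; decide
    refine hA.le_norm_unit_sub hp hA0 ⟨i, Or.inl ⟨rfl, rfl⟩⟩ ⟨i + 2, Or.inr ⟨rfl, by rw [e]⟩⟩ ?_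
    exact fun h => absurd (hinj h) (by clear * - i; revert i; decide)
  | quad v' =>
    have hinj := quad_injective hp
    have h0 := cross_ne_zero hp.1
    have g0 := cross_ne_zero hp.2.1
    have s1 : convexHull ℝ {v' 0, v' 1, v' 2} ⊆ (quad v').region := Set.subset_union_left
    have s2 : convexHull ℝ {v' 0, v' 2, v' 3} ⊆ (quad v').region := Set.subset_union_right
    have m : ∀ {s t : Set ℂ}, s ⊆ t → convexHull ℝ t ⊆ (quad v').region →
        convexHull ℝ s ⊆ (quad v').region := fun h h' => (convexHull_mono h).trans h'
    obtain ⟨i, rfl⟩ := hv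
    fin_cases i
    · exact two (w := v' 1) (d := v' 2) (u := v' 3) ⟨0, Or.inl ⟨rfl, rfl⟩⟩
        ⟨3, Or.inr ⟨rfl, rfl⟩⟩ (fun h => absurd (hinj h) (by decide)) h0 g0 s1 s2
    · refine one (w := v' 0) (u := v' 2) (cross_swap (cross_rotate h0)) (m ?_ s1) (half.trans ?_)
      · rintro _ (rfl | rfl | rfl) <;> simp
      · exact hA.le_norm_unit_sub hp hA0 ⟨0, Or.inr ⟨rfl, rfl⟩⟩ ⟨1, Or.inl ⟨rfl, rfl⟩⟩
          (fun h => absurd (hinj h) (by decide))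
    · refine two (w := v' 1) (d := v' 0) (u := v' 3) ⟨1, Or.inr ⟨rfl, rfl⟩⟩
        ⟨2, Or.inl ⟨rfl, rfl⟩⟩ (fun h => absurd (hinj h) (by decide))
        (cross_swap (cross_rotate (cross_rotate h0))) (cross_swap (cross_rotate g0)) (m ?_ s1) (m ?_ s2)
      · rintro _ (rfl | rfl | rfl) <;> simp
      · rintro _ (rfl | rfl | rfl) <;> simp
    · refine one (w := v' 2) (u := v' 0)
        (cross_swap (cross_rotate (cross_rotate g0))) (m ?_ s2) (half.trans ?_)
      · rintro _ (rfl | rfl | rfl) <;> simp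
      · exact hA.le_norm_unit_sub hp hA0 ⟨2, Or.inr ⟨rfl, rfl⟩⟩ ⟨3, Or.inl ⟨rfl, rfl⟩⟩
          (fun h => absurd (hinj h) (by decide))

end Element

end

section

/-! ### Potentials on an element -/

/-- The linear interpolation along the segment from `x` to `y` of the values of `f` at its ends. -/
def edgeVal (f : ℂ → ℝ) (x y p : ℂ) : ℝ := (f x * dist p y + f y * dist p x) / dist x y

lemma edgeVal_symm (f : ℂ → ℝ) (x y p : ℂ) : edgeVal f x y p = edgeVal f y x p := by
  unfold edgeVal; rw [dist_comm x y, add_comm]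

lemma edgeVal_param (f : ℂ → ℝ) {x y : ℂ} (hxy : x ≠ y) {t : ℝ} (h0 : 0 ≤ t) (h1 : t ≤ 1) :
    edgeVal f x y (x + t * (y - x)) = f x + t * (f y - f x) := by
  have hd : 0 < dist x y := dist_pos.2 hxy
  have e1 : dist (x + t * (y - x)) x = t * dist x y := by
    rw [dist_self_add_left, norm_mul, Complex.norm_of_nonneg h0, dist_comm x y, dist_eq_norm]
  have e2 : dist (x + t * (y - x)) y = (1 - t) * dist x y := by
    rw [dist_eq_norm, show x + t * (y - x) - y = ((1 - t : ℝ) : ℂ) * (x - y) by push_cast; ring,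
      norm_mul, Complex.norm_of_nonneg (by linarith), dist_eq_norm]
  unfold edgeVal
  rw [e1, e2]
  field_simp
  ring

lemma edgeVal_congr {f g : ℂ → ℝ} {x y : ℂ} (hx : f x = g x) (hy : f y = g y) (p : ℂ) :
    edgeVal f x y p = edgeVal g x y p := by
  unfold edgeVal; rw [hx, hy]

namespace Element

variable {E : Element} {A : ℝ}

/-- The union of the sides. -/
def sides (E : Element) : Set ℂ := {p | ∃ x y, E.IsSide x y ∧ p ∈ segment ℝ x y}

lemma edgeVal_mem {f : ℂ → ℝ} {l u : ℝ} (hp : E.IsProper)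
    (hf : ∀ v ∈ E.vertices, l ≤ f v ∧ f v ≤ u) {x y p : ℂ} (h : E.IsSide x y)
    (hs : p ∈ segment ℝ x y) : l ≤ edgeVal f x y p ∧ edgeVal f x y p ≤ u := by
  obtain ⟨t, h0, h1, rfl⟩ := mem_segment_iff_exists.1 hs
  rw [edgeVal_param f (h.ne hp) h0 h1]
  have hx := hf x h.mem_left
  have hy := hf y h.mem_right
  constructor <;> nlinarith

/-- Values vary by at most the size of the element. Disjoint sides are at least size`/A` apart,
sides with a common corner diverge at that rate, and a single side has at least that length. The
factor `2` comes from adding the changes along two sides at a corner. -/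
lemma abs_edgeVal_sub_le (hp : E.IsProper) (hA : E.AspectRatioLE A) (hA0 : 0 < A) {f : ℂ → ℝ}
    (hf : ∀ v ∈ E.vertices, 0 ≤ f v ∧ f v ≤ E.size) {x y z w p q : ℂ} (h : E.IsSide x y)
    (h' : E.IsSide z w) (hs : p ∈ segment ℝ x y) (hs' : q ∈ segment ℝ z w) :
    |edgeVal f x y p - edgeVal f z w q| ≤ 2 * A * dist p q := by
  have hsub : ∀ {v w : ℂ}, v ∈ E.vertices → w ∈ E.vertices → |f v - f w| ≤ E.size := by
    intro v w hv hw
    have := hf v hv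
    have := hf w hw
    rw [abs_le]; constructor <;> linarith
  have same : ∀ {x y p q : ℂ}, E.IsSide x y → p ∈ segment ℝ x y → q ∈ segment ℝ x y →
      |edgeVal f x y p - edgeVal f x y q| ≤ 2 * A * dist p q := by
    intro x y p q h hs hs'
    obtain ⟨t, h0, h1, rfl⟩ := mem_segment_iff_exists.1 hs
    obtain ⟨s, g0, g1, rfl⟩ := mem_segment_iff_exists.1 hs'
    rw [edgeVal_param f (h.ne hp) h0 h1, edgeVal_param f (h.ne hp) g0 g1]
    have e : dist (x + t * (y - x)) (x + s * (y - x)) = |t - s| * dist x y := by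
      rw [dist_add_left, dist_eq_norm, ← sub_mul, norm_mul, dist_comm x y, dist_eq_norm,
        ← Complex.ofReal_sub, Complex.norm_real, Real.norm_eq_abs]
    rw [e, show f x + t * (f y - f x) - (f x + s * (f y - f x)) = (t - s) * (f y - f x) by ring,
      abs_mul]
    have h2 := hsub h.mem_right h.mem_left
    have h3 := hA.size_le_side hp hA0 h
    calc |t - s| * |f y - f x| ≤ |t - s| * (A * dist x y) := by
          refine mul_le_mul_of_nonneg_left (h2.trans h3) (abs_nonneg _)
      _ ≤ 2 * A * (|t - s| * dist x y) := by
          have : 0 ≤ A * (|t - s| * dist x y) := by positivity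
          linarith
  have corner : ∀ {v w u p q : ℂ}, E.IsSide v w → E.IsSide v u → p ∈ segment ℝ v w →
      q ∈ segment ℝ v u → |edgeVal f v w p - edgeVal f v u q| ≤ 2 * A * dist p q := by
    intro v w u p q hw hu hs hs'
    rcases eq_or_ne w u with rfl | hwu
    · exact same hw hs hs'
    obtain ⟨t, h0, h1, rfl⟩ := mem_segment_iff_exists.1 hs
    obtain ⟨s, g0, g1, rfl⟩ := mem_segment_iff_exists.1 hs'
    rw [edgeVal_param f (hw.ne hp) h0 h1, edgeVal_param f (hu.ne hp) g0 g1]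
    have h1 := hA.size_le hu hw.mem_right (hw.ne hp).symm hwu
    have h2 := hA.size_le hw hu.mem_right (hu.ne hp).symm hwu.symm
    have key := le_dist_of_infDist (m := E.size / A) (by rw [div_le_iff₀ hA0]; linarith)
      (by rw [div_le_iff₀ hA0]; linarith) (v := v) (w := w) (u := u) h0 g0
    rw [div_mul_eq_mul_div, div_le_iff₀ hA0] at key
    have hS := (size_pos hp).le
    have b1 := abs_le.1 (hsub hw.mem_right hw.mem_left)
    have b2 := abs_le.1 (hsub hu.mem_right hu.mem_left)
    have k1 : E.size * t ≤ E.size * max t s := mul_le_mul_of_nonneg_left (le_max_left _ _) hS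
    have k2 : E.size * s ≤ E.size * max t s := mul_le_mul_of_nonneg_left (le_max_right _ _) hS
    have c1 : |t * (f w - f v)| ≤ E.size * t := by
      rw [abs_mul, abs_of_nonneg h0, mul_comm]
      exact mul_le_mul_of_nonneg_right (abs_le.2 b1) h0
    have c2 : |s * (f u - f v)| ≤ E.size * s := by
      rw [abs_mul, abs_of_nonneg g0, mul_comm]
      exact mul_le_mul_of_nonneg_right (abs_le.2 b2) g0
    rw [show f v + t * (f w - f v) - (f v + s * (f u - f v)) =
      t * (f w - f v) - s * (f u - f v) by ring]
    have := abs_sub (t * (f w - f v)) (s * (f u - f v))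
    linarith
  by_cases hxz : x = z
  · subst hxz; exact corner h h' hs hs'
  by_cases hxw : x = w
  · subst hxw
    rw [edgeVal_symm f z]
    exact corner h h'.symm hs (by rwa [segment_symm])
  by_cases hyz : y = z
  · subst hyz
    rw [edgeVal_symm f x]
    exact corner h.symm h' (by rwa [segment_symm]) hs'
  by_cases hyw : y = w
  · subst hyw
    rw [edgeVal_symm f x, edgeVal_symm f z]
    exact corner h.symm h'.symm (by rwa [segment_symm]) (by rwa [segment_symm])
  have m : ∀ {z w v : ℂ}, E.IsSide z w → v ∈ E.vertices → v ≠ z → v ≠ w →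
      E.size / A ≤ Metric.infDist v (segment ℝ z w) := by
    intro z w v h hv h1 h2
    rw [div_le_iff₀ hA0]; linarith [hA.size_le h hv h1 h2]
  have key := le_dist_of_disjoint_segments (disjoint_sides hp h h' hxz hxw hyz hyw)
    (m h' h.mem_left hxz hxw) (m h' h.mem_right hyz hyw)
    (m h h'.mem_left (Ne.symm hxz) (Ne.symm hyz)) (m h h'.mem_right (Ne.symm hxw) (Ne.symm hyw))
    hs hs'
  rw [div_le_iff₀ hA0] at key
  have b1 := edgeVal_mem hp hf h hs
  have b2 := edgeVal_mem hp hf h' hs'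
  have hS := (size_pos hp).le
  rw [abs_le]; constructor <;> nlinarith

/-- A function on the vertices extends linearly along the sides, and to a Lipschitz function on the
plane within the same bounds. -/
lemma exists_potential (hp : E.IsProper) (hA : E.AspectRatioLE A) (hA0 : 0 < A) {f : ℂ → ℝ} {l : ℝ}
    (hl : 0 ≤ l) (hf : ∀ v ∈ E.vertices, l ≤ f v ∧ f v ≤ E.size) :
    ∃ G : ℂ → ℝ, (∀ p q, |G p - G q| ≤ 2 * A * dist p q) ∧ (∀ p, l ≤ G p ∧ G p ≤ E.size) ∧
      ∀ x y p, E.IsSide x y → p ∈ segment ℝ x y → G p = edgeVal f x y p := by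
  have hf0 : ∀ v ∈ E.vertices, 0 ≤ f v ∧ f v ≤ E.size := fun v hv =>
    ⟨hl.trans (hf v hv).1, (hf v hv).2⟩
  have hls : l ≤ E.size := by
    obtain ⟨x, y, h, -⟩ := E.exists_dist_eq_size
    exact (hf x h.mem_left).1.trans (hf x h.mem_left).2
  -- The Lipschitz estimate at distance zero shows that the value does not depend on the side
  -- chosen.
  have hdef : ∀ p : ℂ, ∃ g : ℝ, ∀ x y, E.IsSide x y → p ∈ segment ℝ x y → g = edgeVal f x y p := by
    intro p
    by_cases h : p ∈ E.sides
    · obtain ⟨x, y, h, hs⟩ := h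
      refine ⟨edgeVal f x y p, fun z w h' hs' => ?_⟩
      have := abs_edgeVal_sub_le hp hA hA0 hf0 h h' hs hs'
      rw [dist_self, mul_zero] at this
      exact sub_eq_zero.1 (abs_nonpos_iff.1 this)
    · exact ⟨0, fun x y h1 h2 => absurd ⟨x, y, h1, h2⟩ h⟩
  choose g hg using hdef
  have hlip : LipschitzOnWith ⟨2 * A, by positivity⟩ g E.sides := by
    refine LipschitzOnWith.of_dist_le_mul ?_
    rintro p ⟨x, y, h, hs⟩ q ⟨z, w, h', hs'⟩
    rw [hg p x y h hs, hg q z w h' hs', Real.dist_eq]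
    exact abs_edgeVal_sub_le hp hA hA0 hf0 h h' hs hs'
  obtain ⟨G, hG, hGg⟩ := hlip.extend_real
  -- Truncation restores the bounds off the sides, keeps the Lipschitz constant and leaves the
  -- values on the sides unchanged.
  refine ⟨fun p => max l (min E.size (G p)), fun p q => ?_, fun p => ⟨le_max_left _ _, ?_⟩, ?_⟩
  · have h1 := hG.dist_le_mul p q
    rw [Real.dist_eq] at h1
    refine le_trans ?_ h1
    refine (abs_max_sub_max_le_max _ _ _ _).trans ?_
    rw [sub_self, abs_zero]
    refine max_le (abs_nonneg _) ((abs_min_sub_min_le_max _ _ _ _).trans ?_)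
    rw [sub_self, abs_zero]
    exact max_le (abs_nonneg _) le_rfl
  · exact max_le hls (min_le_left _ _)
  · intro x y p h hs
    have hb := edgeVal_mem hp hf h hs
    have e : G p = edgeVal f x y p := (hGg ⟨x, y, h, hs⟩).symm.trans (hg p x y h hs)
    simp only [e]
    rw [min_eq_right hb.2, max_eq_right hb.1]

lemma finite_vertices (E : Element) : E.vertices.Finite := by
  cases E <;> exact Set.finite_range _

lemma exists_isSide {v : ℂ} (hv : v ∈ E.vertices) : ∃ w, E.IsSide v w := by
  cases E <;> obtain ⟨i, rfl⟩ := hv <;> exact ⟨_, i, Or.inl ⟨rfl, rfl⟩⟩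

lemma dimH_segment_le (x y : ℂ) : dimH (segment ℝ x y) ≤ 1 := by
  have h : segment ℝ x y ⊆ Set.range fun t : ℝ => x + (t : ℂ) * (y - x) := by
    intro p hp
    obtain ⟨t, -, -, rfl⟩ := mem_segment_iff_exists.1 hp
    exact ⟨t, rfl⟩
  refine (dimH_mono h).trans ?_
  have hl : ContDiff ℝ 1 fun t : ℝ => x + (t : ℂ) * (y - x) :=
    contDiff_const.add (Complex.ofRealCLM.contDiff.mul contDiff_const)
  refine hl.dimH_range_le.trans ?_
  simp

lemma dimH_sides_le (E : Element) : dimH E.sides ≤ 1 := by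
  have h : E.sides ⊆ ⋃ q ∈ E.vertices ×ˢ E.vertices, segment ℝ q.1 q.2 := by
    rintro p ⟨x, y, hs, hp⟩
    exact Set.mem_biUnion (x := (x, y)) ⟨hs.mem_left, hs.mem_right⟩ hp
  refine (dimH_mono h).trans ?_
  rw [dimH_bUnion (E.finite_vertices.prod E.finite_vertices).countable]
  exact iSup₂_le fun q _ => dimH_segment_le _ _

end Element

/-- Used for the sides of an element, which contain no disc, and for the translations that move a
rectifiable path onto a vertex. -/
lemma dense_compl_of_dimH_le_one {s : Set ℂ} (hs : dimH s ≤ 1) : Dense sᶜ := by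
  refine _root_.dense_compl_of_dimH_lt_finrank (hs.trans_lt ?_)
  rw [Complex.finrank_real_complex]
  norm_num

end

section

/-! ### Element sizes in a mesh of bounded aspect ratio -/

namespace IsMesh

variable {n : ℕ} {E : Fin n → Element} {A : ℝ} {Ω : Set ℂ} {σ : ℂ → ℝ}

lemma inter_subset_sides (hE : IsMesh E A Ω σ) {i j : Fin n} (hij : i ≠ j) :
    (E i).region ∩ (E j).region ⊆ (E i).sides := by
  intro x hx
  rcases hE.conforming i j hij x hx with h | ⟨y, z, h, -, hs⟩
  · obtain ⟨w, hw⟩ := Element.exists_isSide h.1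
    exact ⟨x, w, hw, left_mem_segment ℝ _ _⟩
  · exact ⟨y, z, h, hs⟩

/-- The number of elements at a vertex is bounded in terms of the aspect ratio. -/
lemma ncard_vertex_le (hE : IsMesh E A Ω σ) (hA0 : 0 < A) (v : ℂ) :
    ({i | v ∈ (E i).vertices}.ncard : ℝ) ≤ (4 * A + 1) ^ 2 := by
  -- There are finitely many elements, so one radius `r` is small enough for all of them at once.
  have h1 : ∀ i, ∀ᶠ r in nhdsWithin (0 : ℝ) (Set.Ioi 0), v ∈ (E i).vertices →
      ∃ y, dist y v ≤ r ∧ Metric.ball y (r * (1 / (4 * A))) ⊆ (E i).region := by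
    intro i
    by_cases hv : v ∈ (E i).vertices
    · obtain ⟨r₀, hr₀, h⟩ := (hE.aspect i).exists_ball (hE.proper i) hA0 hv
      filter_upwards [Ioc_mem_nhdsGT hr₀] with r hr _
      exact h r hr.1 hr.2
    · exact Filter.Eventually.of_forall fun r h => absurd h hv
  obtain ⟨r, hr, h2⟩ := ((Filter.eventually_all.2 h1).and self_mem_nhdsWithin).exists.imp
    fun r h => And.intro h.2 h.1
  have hr : 0 < r := hr
  have h3 : ∀ i, ∃ y, v ∈ (E i).vertices →
      dist y v ≤ r ∧ Metric.ball y (r * (1 / (4 * A))) ⊆ (E i).region := by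
    intro i
    by_cases hv : v ∈ (E i).vertices
    · exact (h2 i hv).imp fun y h _ => h
    · exact ⟨0, fun h => absurd h hv⟩
  choose c hc using h3
  have hβ : 0 < r * (1 / (4 * A)) := by positivity
  refine (packing {i | v ∈ (E i).vertices} c (z := v) (R := r) hβ (fun i hi => (hc i hi).1)
    fun i hi j hj hij => ?_).2.trans (le_of_eq ?_)
  -- Intersecting discs would put an open set into the common part of two elements, which lies in
  -- the sides.
  · by_contra hnd
    obtain ⟨x, hx⟩ := Set.not_disjoint_iff_nonempty_inter.1 hnd
    obtain ⟨y, hy, hys⟩ := (dense_compl_of_dimH_le_one (E i).dimH_sides_le).inter_open_nonempty _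
      (Metric.isOpen_ball.inter Metric.isOpen_ball) ⟨x, hx⟩
    exact hys (hE.inter_subset_sides hij ⟨(hc i hi).2 hy.1, (hc j hj).2 hy.2⟩)
  · field_simp

/-- Two elements are adjacent around `v` if they share a side that ends at `v`. -/
def adjAt (E : Fin n → Element) (v : ℂ) : SimpleGraph (Fin n) where
  Adj i j := i ≠ j ∧ ∃ w, (E i).IsSide v w ∧ (E j).IsSide v w
  symm := ⟨fun _ _ h => ⟨h.1.symm, h.2.imp fun _ h => h.symm⟩⟩
  loopless := ⟨fun _ h => h.1 rfl⟩

/-- Each step passes through a common side, whose length is at most the size of one element and at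
least `1 / A` times that of the other. -/
lemma size_le_of_walk (hE : IsMesh E A Ω σ) (hA0 : 0 < A) {v : ℂ} {i j : Fin n}
    (p : (adjAt E v).Walk i j) : (E i).size ≤ A ^ p.length * (E j).size := by
  induction p with
  | nil => simp
  | @cons i k j h p ih =>
    obtain ⟨w, h1, h2⟩ := h.2
    calc (E i).size ≤ A * dist v w := (hE.aspect i).size_le_side (hE.proper i) hA0 h1
      _ ≤ A * (E k).size := mul_le_mul_of_nonneg_left (Element.dist_le_size h2) hA0.le
      _ ≤ A * (A ^ p.length * (E j).size) := mul_le_mul_of_nonneg_left ih hA0.le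
      _ = _ := by rw [SimpleGraph.Walk.length_cons]; ring

lemma mem_vertices_of_walk {v : ℂ} {i j : Fin n} (p : (adjAt E v).Walk i j)
    (hi : v ∈ (E i).vertices) : ∀ k ∈ p.support, v ∈ (E k).vertices := by
  induction p with
  | nil => simpa using hi
  | @cons i k j h p ih =>
    obtain ⟨w, h1, h2⟩ := h.2
    intro l hl
    rw [SimpleGraph.Walk.support_cons, List.mem_cons] at hl
    rcases hl with rfl | hl
    · exact hi
    · exact ih h2.mem_left l hl

/-- The bound for the ratio of the sizes of elements that are connected around a vertex. -/
def sizeRatio (A : ℝ) : ℝ := A ^ ⌈(4 * A + 1) ^ 2⌉₊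

/-- A path visits distinct elements at `v`, so its length is bounded by their number. -/
lemma size_le_of_reachable (hE : IsMesh E A Ω σ) (hA : 1 ≤ A) {v : ℂ} {i j : Fin n}
    (hi : v ∈ (E i).vertices) (h : (adjAt E v).Reachable i j) :
    (E i).size ≤ sizeRatio A * (E j).size := by
  classical
  obtain ⟨p, hp⟩ := h.exists_isPath
  refine (hE.size_le_of_walk (by linarith) p).trans ?_
  refine mul_le_mul_of_nonneg_right (pow_le_pow_right₀ hA ?_) (Element.size_pos (hE.proper j)).le
  have h1 : p.support.toFinset.card ≤ {i | v ∈ (E i).vertices}.ncard := by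
    rw [← Set.ncard_coe_finset]
    refine Set.ncard_le_ncard (fun k hk => ?_) (Set.toFinite _)
    exact mem_vertices_of_walk p hi k (by simpa using hk)
  rw [List.toFinset_card_of_nodup hp.support_nodup, SimpleGraph.Walk.length_support] at h1
  have h2 := hE.ncard_vertex_le (by linarith) v
  have h3 : ((p.length + 1 : ℕ) : ℝ) ≤ (4 * A + 1) ^ 2 := (Nat.cast_le.2 h1).trans h2
  have h4 := Nat.cast_le.1 (h3.trans (Nat.le_ceil _))
  exact (Nat.le_succ _).trans h4

/-- The smallest size of the elements that are connected to the `i`-th one around `v`. -/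
def fanSize (E : Fin n → Element) (i : Fin n) (v : ℂ) : ℝ :=
  ⨅ j : {j // (adjAt E v).Reachable i j}, (E j).size

lemma fanSize_le_of_reachable {v : ℂ} {i j : Fin n} (h : (adjAt E v).Reachable i j) :
    fanSize E i v ≤ (E j).size :=
  ciInf_le (Set.finite_range fun j : {j // (adjAt E v).Reachable i j} => (E j).size).bddBelow ⟨j, h⟩

lemma le_fanSize_of_forall {v : ℂ} {i : Fin n} {c : ℝ}
    (h : ∀ j, (adjAt E v).Reachable i j → c ≤ (E j).size) : c ≤ fanSize E i v :=
  have : Nonempty {j // (adjAt E v).Reachable i j} := ⟨⟨i, SimpleGraph.Reachable.refl i⟩⟩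
  le_ciInf fun j => h j j.2

lemma le_fanSize (hE : IsMesh E A Ω σ) (hA : 1 ≤ A) {v : ℂ} {i : Fin n}
    (hi : v ∈ (E i).vertices) : (E i).size / sizeRatio A ≤ fanSize E i v := by
  have hpos : 0 < sizeRatio A := pow_pos (by linarith) _
  refine le_fanSize_of_forall fun j hj => ?_
  rw [div_le_iff₀ hpos, mul_comm]
  exact hE.size_le_of_reachable hA hi hj

/-- Elements sharing a side at `v` are in one component of `adjAt E v`. Elements that merely touch
at `v` may have unrelated sizes, which is why the value depends on `i` and why paths must avoid
vertices. -/
lemma fanSize_eq {v w : ℂ} {i j : Fin n} (hi : (E i).IsSide v w) (hj : (E j).IsSide v w) :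
    fanSize E i v = fanSize E j v := by
  rcases eq_or_ne i j with rfl | hij
  · rfl
  have h : (adjAt E v).Reachable i j := SimpleGraph.Adj.reachable ⟨hij, w, hi, hj⟩
  exact le_antisymm (le_fanSize_of_forall fun k hk => fanSize_le_of_reachable (h.trans hk))
    (le_fanSize_of_forall fun k hk => fanSize_le_of_reachable (h.symm.trans hk))

end IsMesh

/-- A function that is pieced together from Lipschitz functions on closed sets changes along a path
by at most the Lipschitz constant times the length of the path. -/
lemma le_add_of_piecewise {ι : Type*} [Finite ι] {R : ι → Set ℂ} (hR : ∀ i, IsClosed (R i))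
    {G : ι → ℂ → ℝ} {L K : ℝ} (hL : 0 ≤ L) (hG : ∀ i p q, |G i p - G i q| ≤ L * dist p q)
    {γ : ℝ → ℂ} (hγ : ∀ s ∈ Set.Icc (0 : ℝ) 1, ∀ t ∈ Set.Icc (0 : ℝ) 1,
      dist (γ s) (γ t) ≤ K * |s - t|)
    (hcov : ∀ t ∈ Set.Icc (0 : ℝ) 1, ∃ i, γ t ∈ R i)
    (heq : ∀ t ∈ Set.Icc (0 : ℝ) 1, ∀ i j, γ t ∈ R i → γ t ∈ R j → G i (γ t) = G j (γ t))
    {i j : ι} (hi : γ 0 ∈ R i) (hj : γ 1 ∈ R j) : G i (γ 0) ≤ G j (γ 1) + L * K := by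
  have hval : ∀ t, ∃ g : ℝ, t ∈ Set.Icc (0 : ℝ) 1 → ∀ i, γ t ∈ R i → g = G i (γ t) := by
    intro t
    by_cases ht : t ∈ Set.Icc (0 : ℝ) 1
    · obtain ⟨k, hk⟩ := hcov t ht
      exact ⟨G k (γ t), fun _ i hi => heq t ht k i hk hi⟩
    · exact ⟨0, fun h => absurd h ht⟩
  choose g hg using hval
  have hcont : ContinuousOn γ (Set.Icc 0 1) := by
    have hl : LipschitzOnWith (Real.toNNReal K) γ (Set.Icc 0 1) := by
      refine LipschitzOnWith.of_dist_le_mul fun s hs t ht => (hγ s hs t ht).trans ?_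
      rw [Real.dist_eq]
      exact mul_le_mul_of_nonneg_right (Real.le_coe_toNNReal K) (abs_nonneg _)
    exact hl.continuousOn
  have hloc : ∀ t ∈ Set.Icc (0 : ℝ) 1, ∀ᶠ s in nhdsWithin t (Set.Icc 0 1),
      |g s - g t| ≤ L * K * |s - t| := by
    intro t ht
    -- The pieces are closed and finite in number, so near `t` the path meets only pieces that
    -- contain `γ t`, and a single `G k` compares the two values.
    have h1 : ∀ k, ∀ᶠ s in nhdsWithin t (Set.Icc 0 1), γ s ∈ R k → γ t ∈ R k := by
      intro k
      by_cases hk : γ t ∈ R k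
      · exact Filter.Eventually.of_forall fun _ _ => hk
      · have := (hcont t ht).eventually ((hR k).isOpen_compl.mem_nhds hk)
        filter_upwards [this] with s hs hs'
        exact absurd hs' hs
    filter_upwards [Filter.eventually_all.2 h1, self_mem_nhdsWithin] with s hs hsI
    obtain ⟨k, hk⟩ := hcov s hsI
    rw [hg s hsI k hk, hg t ht k (hs k hk), mul_assoc]
    exact (hG k _ _).trans (mul_le_mul_of_nonneg_left (hγ s hsI t ht) hL)
  have hgc : ContinuousOn g (Set.Icc 0 1) := by
    intro t ht
    refine tendsto_iff_dist_tendsto_zero.2 ?_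
    have hlim : Filter.Tendsto (fun s => L * K * |s - t|) (nhdsWithin t (Set.Icc 0 1))
        (nhds 0) := by
      have : Continuous fun s : ℝ => L * K * |s - t| := by fun_prop
      have h0 := (this.tendsto t).mono_left (nhdsWithin_le_nhds (s := Set.Icc (0 : ℝ) 1))
      simpa using h0
    refine squeeze_zero' (Filter.Eventually.of_forall fun _ => dist_nonneg) ?_ hlim
    filter_upwards [hloc t ht] with s hs
    rwa [Real.dist_eq]
  -- Continuous induction along the interval: the set is closed and extends to the right of each of
  -- its points.
  have hsub : Set.Icc (0 : ℝ) 1 ⊆ {t | g 0 - g t ≤ L * K * t} := by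
    refine IsClosed.Icc_subset_of_forall_mem_nhdsWithin ?_ (by simp) ?_
    · have hc : ContinuousOn (fun t => L * K * t - (g 0 - g t)) (Set.Icc 0 1) := by fun_prop
      have := hc.preimage_isClosed_of_isClosed isClosed_Icc (isClosed_Ici (a := (0 : ℝ)))
      convert this using 1
      ext t
      simp [and_comm]
    · rintro t ⟨ht, htI⟩
      have h1 := hloc t ⟨htI.1, htI.2.le⟩
      have h2 : nhdsWithin t (Set.Ioi t) ≤ nhdsWithin t (Set.Icc 0 1) := by
        refine nhdsWithin_le_of_mem ?_
        filter_upwards [Ioc_mem_nhdsGT htI.2] with s hs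
        exact ⟨htI.1.trans hs.1.le, hs.2⟩
      filter_upwards [h2 h1, self_mem_nhdsWithin] with s hs hst
      have hst : t < s := hst
      change g 0 - g t ≤ L * K * t at ht
      change g 0 - g s ≤ L * K * s
      rw [abs_of_pos (sub_pos.2 hst)] at hs
      have := abs_le.1 hs
      linarith
  have h0 : (0 : ℝ) ∈ Set.Icc (0 : ℝ) 1 := ⟨le_rfl, zero_le_one⟩
  have h1 : (1 : ℝ) ∈ Set.Icc (0 : ℝ) 1 := ⟨zero_le_one, le_rfl⟩
  have := hsub h1
  change g 0 - g 1 ≤ L * K * 1 at this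
  rw [hg 0 h0 i hi, hg 1 h1 j hj] at this
  linarith

namespace IsMesh

variable {n : ℕ} {E : Fin n → Element} {A : ℝ} {κ : ℝ≥0} {Ω : Set ℂ} {σ : ℂ → ℝ}

/-- Element sizes vary slowly inside the domain. -/
lemma size_le_of_interior (hE : IsMesh E A Ω σ) (hA : 1 ≤ A) (hΩ : IsMeshDomain κ Ω) {i j : Fin n}
    {p q : ℂ} (hp : p ∈ interior (E i).region) (hq : q ∈ interior (E j).region)
    (hpΩ : p ∈ interior Ω) (hqΩ : q ∈ interior Ω) :
    (E i).size / sizeRatio A ≤ (E j).size + 2 * A * (κ * dist p q) := by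
  have hA0 : 0 < A := by linarith
  have hpos : 0 < sizeRatio A := pow_pos hA0 _
  obtain ⟨γ, h0, h1, hlip, hin⟩ := hΩ.joined p hpΩ q hqΩ
  -- The path is translated by a small `z` to miss all vertices. The bad `z` form finitely many
  -- Lipschitz images of an interval, so good ones are dense.
  set V : Set ℂ := ⋃ k, (E k).vertices with hV
  have hVf : V.Finite := Set.finite_iUnion fun k => (E k).finite_vertices
  set B : Set ℂ := ⋃ v ∈ V, (fun t => v - γ t) '' Set.Icc 0 1 with hB
  have hBdim : dimH B ≤ 1 := by
    rw [hB, dimH_bUnion hVf.countable]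
    refine iSup₂_le fun v _ => ?_
    have hl : LipschitzOnWith (κ * nndist p q) (fun t => v - γ t) (Set.Icc 0 1) := by
      refine LipschitzOnWith.of_dist_le_mul fun s hs t ht => ?_
      rw [dist_sub_left]
      exact hlip.dist_le_mul s hs t ht
    refine hl.dimH_image_le.trans ((dimH_mono (Set.subset_univ _)).trans ?_)
    rw [Real.dimH_univ]
  have hdense := dense_compl_of_dimH_le_one hBdim
  have hcpt : IsCompact (γ '' Set.Icc 0 1) := isCompact_Icc.image_of_continuousOn hlip.continuousOn
  obtain ⟨δ, hδ, hδs⟩ := hcpt.exists_thickening_subset_open isOpen_interior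
    (Set.image_subset_iff.2 hin)
  obtain ⟨ε₁, hε₁, hb₁⟩ := Metric.isOpen_iff.1 isOpen_interior p hp
  obtain ⟨ε₂, hε₂, hb₂⟩ := Metric.isOpen_iff.1 isOpen_interior q hq
  obtain ⟨z, hz, hzB⟩ := hdense.inter_open_nonempty _
    (Metric.isOpen_ball (x := (0 : ℂ)) (ε := min δ (min ε₁ ε₂)))
    ⟨0, Metric.mem_ball_self (by positivity)⟩
  rw [mem_ball_zero_iff, lt_min_iff, lt_min_iff] at hz
  obtain ⟨hz1, hz2, hz3⟩ := hz
  have hpz : p + z ∈ (E i).region :=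
    interior_subset (hb₁ (by rw [Metric.mem_ball, dist_self_add_left]; exact hz2))
  have hqz : q + z ∈ (E j).region :=
    interior_subset (hb₂ (by rw [Metric.mem_ball, dist_self_add_left]; exact hz3))
  have hΩz : ∀ t ∈ Set.Icc (0 : ℝ) 1, γ t + z ∈ Ω := fun t ht =>
    interior_subset (hδs (Metric.mem_thickening_iff.2
      ⟨γ t, Set.mem_image_of_mem _ ht, by rwa [dist_self_add_left]⟩))
  have hVz : ∀ t ∈ Set.Icc (0 : ℝ) 1, γ t + z ∉ V := fun t ht hv =>
    hzB (Set.mem_biUnion hv ⟨t, ht, by simp⟩)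
  have hpot : ∀ k, ∃ G : ℂ → ℝ, (∀ p q, |G p - G q| ≤ 2 * A * dist p q) ∧
      (∀ p, (E k).size / sizeRatio A ≤ G p ∧ G p ≤ (E k).size) ∧
      ∀ x y p, (E k).IsSide x y → p ∈ segment ℝ x y → G p = edgeVal (fanSize E k) x y p := fun k =>
    Element.exists_potential (hE.proper k) (hE.aspect k) hA0
      (div_nonneg (Element.size_pos (hE.proper k)).le hpos.le)
      fun v hv => ⟨hE.le_fanSize hA hv, fanSize_le_of_reachable (SimpleGraph.Reachable.refl k)⟩
  choose G hG1 hG2 hG3 using hpot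
  have key := le_add_of_piecewise (fun k => (E k).isClosed_region) (by positivity) hG1
    (γ := fun t => γ t + z) (K := κ * dist p q) (i := i) (j := j)
    (fun s hs t ht => by
      rw [dist_add_right]
      have := hlip.dist_le_mul s hs t ht
      rwa [NNReal.coe_mul, coe_nndist, Real.dist_eq] at this)
    (fun t ht => Set.mem_iUnion.1 (hE.covers (hΩz t ht)))
    -- Away from the vertices two elements meet on a common side, at whose ends their fan sizes
    -- agree.
    (fun t ht k l hk hl => by
      rcases eq_or_ne k l with rfl | hkl
      · rfl
      rcases hE.conforming k l hkl _ ⟨hk, hl⟩ with h | ⟨y, w, hy, hw, hs⟩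
      · exact absurd (Set.mem_iUnion.2 ⟨k, h.1⟩) (hVz t ht)
      · rw [hG3 k y w _ hy hs, hG3 l y w _ hw hs]
        exact edgeVal_congr (fanSize_eq hy hw) (fanSize_eq hy.symm hw.symm) _)
    (by simpa [h0] using hpz) (by simpa [h1] using hqz)
  exact ((hG2 i _).1.trans key).trans (add_le_add_left (hG2 j _).2 _)

/-- Elements are the closures of their interiors, and a finite union of closed sets is closed. So
one element serves for a whole approach to `p` from inside both the element and `Ω`. -/
lemma exists_mem_closure (hE : IsMesh E A Ω σ) (hΩ : IsMeshDomain κ Ω) {p : ℂ} (hp : p ∈ Ω) :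
    ∃ i, p ∈ closure (interior (E i).region ∩ interior Ω) := by
  have h : interior Ω ⊆ ⋃ i, closure (interior (E i).region ∩ interior Ω) := by
    intro x hx
    obtain ⟨i, hi⟩ := Set.mem_iUnion.1 (hE.covers (interior_subset hx))
    refine Set.mem_iUnion.2 ⟨i, ?_⟩
    have := Element.region_subset_closure_interior (hE.proper i) hi
    exact isOpen_interior.closure_inter ⟨this, hx⟩
  have hc : IsClosed (⋃ i, closure (interior (E i).region ∩ interior Ω)) :=
    isClosed_iUnion_of_finite fun _ => isClosed_closure
  exact Set.mem_iUnion.1 (closure_minimal h hc (hΩ.subset_closure hp))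

/-- Each point lies in an element that is not much larger than the local feature size. -/
lemma exists_size_le (hE : IsMesh E A Ω σ) (hA : 1 ≤ A) (hΩ : IsMeshDomain κ Ω) {p : ℂ}
    (hp : p ∈ Ω) : ∃ i, p ∈ (E i).region ∧
      (E i).size ≤ sizeRatio A * (1 + 2 * A * κ) * localFeatureSize Ω σ p := by
  have hA0 : 0 < A := by linarith
  have hpos : 0 < sizeRatio A := pow_pos hA0 _
  have hmem : ∀ {p : ℂ} {i}, p ∈ closure (interior (E i).region ∩ interior Ω) →
      p ∈ (E i).region := fun h => (closure_minimal
    (Set.inter_subset_left.trans interior_subset) (E _).isClosed_region) h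
  obtain ⟨i, hi⟩ := hE.exists_mem_closure hΩ hp
  refine ⟨i, hmem hi, ?_⟩
  have hB : 0 < 1 + 2 * A * κ := by positivity
  have key : (E i).size / sizeRatio A / (1 + 2 * A * κ) ≤ localFeatureSize Ω σ p := by
    have : Nonempty Ω := ⟨⟨p, hp⟩⟩
    refine le_ciInf fun ⟨q, hq⟩ => ?_
    obtain ⟨j, hj⟩ := hE.exists_mem_closure hΩ hq
    have hσ : (E j).size ≤ σ q := by
      obtain ⟨x, y, h, he⟩ := (E j).exists_dist_eq_size
      rw [he]; exact hE.obeys j q ⟨hmem hj, hq⟩ x y h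
    -- The inequality is closed in the two points and passes from interior points to the limit.
    have hlim : (E i).size / sizeRatio A ≤ (E j).size + 2 * A * (κ * dist p q) := by
      have hcl : IsClosed {x : ℂ × ℂ |
          (E i).size / sizeRatio A ≤ (E j).size + 2 * A * (κ * dist x.1 x.2)} :=
        isClosed_le continuous_const (by fun_prop)
      have hsub : (interior (E i).region ∩ interior Ω) ×ˢ (interior (E j).region ∩ interior Ω) ⊆
          {x : ℂ × ℂ | (E i).size / sizeRatio A ≤ (E j).size + 2 * A * (κ * dist x.1 x.2)} :=
        fun x hx => hE.size_le_of_interior hA hΩ hx.1.1 hx.2.1 hx.1.2 hx.2.2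
      have := closure_minimal hsub hcl
      rw [closure_prod_eq] at this
      exact this (Set.mk_mem_prod hi hj)
    have hs0 : 0 ≤ σ q := (Element.size_pos (hE.proper j)).le.trans hσ
    rw [div_le_iff₀ hB]
    have : 0 ≤ dist p q + σ q * (2 * A * κ) := by positivity
    change _ ≤ (dist p q + σ q) * _
    nlinarith
  rw [div_div, div_le_iff₀ (by positivity)] at key
  linarith

end IsMesh

end

section

/-! ### Counting the elements of the coarsest mesh -/

variable {o a : ℂ} {D : Finset (ℕ × ℂ)} {Ω : Set ℂ} {σ : ℂ → ℝ}

lemma elementsMeeting_finite (ha : a ≠ 0) (hD : IsDown o a D) (hΩ : Bornology.IsBounded Ω) :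
    (elementsMeeting (mesh o a D) Ω).Finite := by
  obtain ⟨R, hR⟩ := hΩ.subset_closedBall (0 : ℂ)
  set K := D.sup Prod.fst with hK
  refine (ncard_elements_le ha hD (sl_pos ha (K + 1)) (w := 0) (R := 2 * sl a 0 + R) ?_).1
  rintro Q ⟨hQ, z, hz, hzΩ⟩
  obtain ⟨k, y, h⟩ := exists_isElt ha hD hQ hz
  refine ⟨k, y, z, h, sl_antitone ha ?_, ?_⟩
  · rcases k with _ | k
    · exact Nat.zero_le _
    · obtain ⟨x, hx, -⟩ := h.exists_pred ha hD
      exact Nat.succ_le_succ (Finset.le_sup (f := Prod.fst) (show (k, x) ∈ D from hx))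
  · have h1 := h.near
    have h2 := hR hzΩ
    rw [Metric.mem_closedBall] at h2
    have h3 := sl_antitone ha (Nat.zero_le (k + 1))
    rw [dist_comm] at h1
    linarith [dist_triangle y z 0]

/-- The elements of the mesh that meet a set of small diameter are boundedly many, if they are not
small compared with the diameter. -/
lemma ncard_le_of_scale (ha : a ≠ 0) (hD : IsDown o a D) {S : Set (Fin 4 → ℂ)} {Z : Set ℂ}
    {ρ B : ℝ} (hB : 1 ≤ B) (hZ : ∀ z ∈ Z, ∀ z' ∈ Z, dist z z' ≤ 4 * ρ)
    (hS : ∀ Q ∈ S, ∃ k y, ∃ z ∈ Z, IsElt o a D k y z Q ∧ ρ ≤ B * sl a k) :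
    (S.ncard : ℝ) ≤ 24 * (3 * (2 + 4 * B) * (16 * B) + 1) ^ 2 := by
  classical
  rcases S.eq_empty_or_nonempty with rfl | ⟨Q₁, hQ₁⟩
  · simp; positivity
  -- The coarsest element of `S` serves as the reference for all the others.
  have hex : ∃ k, ∃ Q ∈ S, ∃ y, ∃ z ∈ Z, IsElt o a D k y z Q ∧ ρ ≤ B * sl a k := by
    obtain ⟨k, y, z, hz, h⟩ := hS Q₁ hQ₁
    exact ⟨k, Q₁, hQ₁, y, z, hz, h⟩
  obtain ⟨Q₀, hQ₀, y₀, z₀, hz₀, h₀, hρ₀⟩ := Nat.find_spec hex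
  have hmin := fun {k} => Nat.find_min' hex (m := k)
  generalize Nat.find hex = k₀ at *
  have hs₀ := sl_pos ha k₀
  have hB0 : 0 < B := by linarith
  refine (ncard_elements_le ha hD (r := sl a k₀ / (16 * B)) (R := (2 + 4 * B) * sl a k₀) (w := z₀)
    (by positivity) ?_).2.trans (le_of_eq ?_)
  · intro Q hQ
    obtain ⟨k, y, z, hz, h, hρ⟩ := hS Q hQ
    have hk : k₀ ≤ k := hmin ⟨Q, hQ, y, z, hz, h, hρ⟩
    refine ⟨k, y, z, h, ?_, ?_⟩
    · rw [div_le_iff₀ (by positivity)]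
      have hsk := sl_pos ha k
      -- Near `z₀` the levels differ by at most four, a factor of `9`. Far from it, the diameter of
      -- `Z` gives `sl a k₀ / 4 < 4 ρ ≤ 4 B · sl a k`, whence the factor `16 B`.
      rcases le_or_gt (dist z₀ z) (sl a k₀ / 4) with hd | hd
      · have h4 := sl_antitone ha (h₀.gap ha hD h hd)
        have e1 : sl a k₀ = 3 * sl a (k₀ + 2) := sl_succ_succ _ _
        have e2 : sl a (k₀ + 2) = 3 * sl a (k₀ + 4) := sl_succ_succ _ _
        nlinarith
      · have := hZ z₀ hz₀ z hz
        nlinarith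
    · have h1 := h.near
      rw [dist_comm] at h1
      have h2 := sl_antitone ha (hk.trans (Nat.le_succ k))
      have h3 := hZ z hz z₀ hz₀
      have := dist_triangle y z z₀
      nlinarith
  · field_simp

variable {n : ℕ} {E : Fin n → Element} {A lam : ℝ} {κ : ℝ≥0}

/-- The number of tiles per element of the comparison mesh. -/
def countBound (A lam : ℝ) (κ : ℝ≥0) : ℕ :=
  let B := 10 * (IsMesh.sizeRatio A * (1 + 2 * A * κ)) * lam
  ⌈24 * (3 * (2 + 4 * B) * (16 * B) + 1) ^ 2⌉₊

/-- Every tile is charged to a comparison element that contains one of its points `z ∈ Ω` and is not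
much larger than the local feature size there. -/
lemma ncard_elementsMeeting_le (ha : a ≠ 0) (hD : IsDown o a D) (hΩ : IsMeshDomain κ Ω)
    (hA : 1 ≤ A) (hlam : 1 ≤ lam) (hcoarse : IsCoarse lam Ω σ ‖a‖)
    (hlfs : ∀ k y z Q, z ∈ Ω → IsElt o a D k y z Q → k = 0 ∨ localFeatureSize Ω σ z ≤ 10 * sl a k)
    (hE : IsMesh E A Ω σ) :
    (elementsMeeting (mesh o a D) Ω).ncard ≤ countBound A lam κ * n := by
  set C := IsMesh.sizeRatio A * (1 + 2 * A * κ) with hC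
  have hC1 : 1 ≤ C := by
    have h1 : 1 ≤ IsMesh.sizeRatio A := one_le_pow₀ hA
    have h2 : 0 ≤ 2 * A * (κ : ℝ) := by positivity
    nlinarith
  have hB : 1 ≤ 10 * C * lam := by nlinarith
  set Z : Fin n → Set ℂ := fun i =>
    {z | z ∈ Ω ∧ z ∈ (E i).region ∧ (E i).size ≤ C * localFeatureSize Ω σ z} with hZdef
  set S : Fin n → Set (Fin 4 → ℂ) := fun i =>
    {Q | Q ∈ mesh o a D ∧ ((Element.quad Q).region ∩ Z i).Nonempty} with hSdef
  have hfin := elementsMeeting_finite ha hD hΩ.bounded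
  have hcard : ∀ i, (S i).ncard ≤ countBound A lam κ := by
    intro i
    refine Nat.cast_le.1 ((?_ : ((S i).ncard : ℝ) ≤ _).trans (Nat.le_ceil _))
    -- The scale is capped by `diam Ω`, since for tiles of level zero coarseness controls only the
    -- smaller of the local feature size and the diameter.
    refine ncard_le_of_scale ha hD (Z := Z i) (ρ := min (E i).size (Metric.diam Ω)) hB ?_ ?_
    · intro z hz z' hz'
      have h1 := Element.dist_le_of_mem_region hz.2.1 hz'.2.1
      have h2 := Metric.dist_le_diam_of_mem hΩ.bounded hz.1 hz'.1
      have h3 : 0 ≤ Metric.diam Ω := Metric.diam_nonneg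
      rcases min_choice (E i).size (Metric.diam Ω) with h | h <;> rw [h] <;> linarith
    · rintro Q ⟨hQ, z, hz, hzZ⟩
      obtain ⟨k, y, h⟩ := exists_isElt ha hD hQ hz
      refine ⟨k, y, z, hzZ, h, ?_⟩
      rcases hlfs k y z Q hzZ.1 h with rfl | hk
      · have h1 := hcoarse z hzZ.1
        rw [← sl_zero (a := a)] at h1
        have h3 : 0 ≤ Metric.diam Ω := Metric.diam_nonneg
        have hs := sl_pos ha 0
        have h2 : min (E i).size (Metric.diam Ω) ≤
            C * min (localFeatureSize Ω σ z) (Metric.diam Ω) := by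
          rw [mul_min_of_nonneg _ _ (by linarith)]
          exact min_le_min hzZ.2.2 (by nlinarith)
        have h4 : C * min (localFeatureSize Ω σ z) (Metric.diam Ω) ≤ C * (lam * sl a 0) :=
          mul_le_mul_of_nonneg_left h1 (by linarith)
        have h5 : 0 ≤ C * (lam * sl a 0) := by positivity
        linarith
      · have hs := sl_pos ha k
        have h1 : C * localFeatureSize Ω σ z ≤ C * (10 * sl a k) :=
          mul_le_mul_of_nonneg_left hk (by linarith)
        have h2 : C * (10 * sl a k) * 1 ≤ C * (10 * sl a k) * lam :=
          mul_le_mul_of_nonneg_left hlam (by positivity)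
        linarith [min_le_left (E i).size (Metric.diam Ω), hzZ.2.2]
  have hsub : elementsMeeting (mesh o a D) Ω ⊆ ⋃ i, S i := by
    rintro Q ⟨hQ, z, hz, hzΩ⟩
    obtain ⟨i, hi, hs⟩ := hE.exists_size_le hA hΩ hzΩ
    exact Set.mem_iUnion.2 ⟨i, hQ, z, hz, hzΩ, hi, hs⟩
  have hSfin : ∀ i, (S i).Finite := fun i =>
    hfin.subset fun Q hQ => ⟨hQ.1, hQ.2.imp fun z hz => ⟨hz.1, hz.2.1⟩⟩
  calc (elementsMeeting (mesh o a D) Ω).ncard ≤ (⋃ i, S i).ncard :=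
        Set.ncard_le_ncard hsub (Set.finite_iUnion hSfin)
    _ ≤ ∑ i, (S i).ncard := Set.ncard_iUnion_le_of_fintype S
    _ ≤ ∑ _i : Fin n, countBound A lam κ := Finset.sum_le_sum fun i _ => hcard i
    _ = countBound A lam κ * n := by simp [mul_comm]

lemma IsMesh.mono (hE : IsMesh E A Ω σ) {B : ℝ} (hAB : A ≤ B) : IsMesh E B Ω σ :=
  { hE with aspect := fun i => (hE.aspect i).mono hAB }

lemma IsCoarse.mono {s lam' : ℝ} (h : IsCoarse lam Ω σ s) (hs : 0 ≤ s) (hl : lam ≤ lam') :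
    IsCoarse lam' Ω σ s :=
  fun p hp => (h p hp).trans (mul_le_mul_of_nonneg_right hl hs)

end

end DiamondKite

end

/-! ### The main theorem -/

theorem mainTheorem1 (A lam : ℝ) (κ : NNReal) :
    ∃ C : ℕ, ∀ (o a : ℂ) (Ω : Set ℂ) (σ : ℂ → ℝ), a ≠ 0 →
      DiamondKite.IsMeshDomain κ Ω →
      (∃ δ > 0, ∀ p ∈ Ω, δ ≤ σ p) →
      DiamondKite.IsCoarse lam Ω σ ‖a‖ →
      (∃ M, DiamondKite.IsCoarsest (DiamondKite.rhombille o a) Ω σ M) ∧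
      ∀ M, DiamondKite.IsCoarsest (DiamondKite.rhombille o a) Ω σ M →
        (DiamondKite.elementsMeeting M Ω).Finite ∧
        ∀ (n : ℕ) (E : Fin n → DiamondKite.Element), DiamondKite.IsMesh E A Ω σ →
          (DiamondKite.elementsMeeting M Ω).ncard ≤ C * n := by
  -- The estimates need `A` and `lam` to be at least `1`; both hypotheses weaken when these
  -- parameters grow.
  refine ⟨DiamondKite.countBound (max A 1) (max lam 1) κ, ?_⟩
  rintro o a Ω σ ha hΩ ⟨δ, hδ, hσ⟩ hcoarse
  refine ⟨DiamondKite.exists_isCoarsest ha hΩ.bounded hδ hσ, fun M hM => ?_⟩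
  obtain ⟨D, hD, rfl, hlfs⟩ := DiamondKite.exists_of_isCoarsest ha hΩ.bounded hδ hσ hM
  refine ⟨DiamondKite.elementsMeeting_finite ha hD hΩ.bounded, fun n E hE => ?_⟩
  exact DiamondKite.ncard_elementsMeeting_le ha hD hΩ (le_max_right _ _) (le_max_right _ _)
    (hcoarse.mono (norm_nonneg a) (le_max_left _ _)) hlfs (hE.mono (le_max_left _ _))
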